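/- **Setting.** Fix $d\ge1$, $\mathfrak s\in[1,\infty)^d$, $\ell>0$, and put $|\mathfrak s|=\sum_i\mathfrak s_i$, $\|x\|_{\mathfrak s}=\sum_i|x_i|^{1/\mathfrak s_i}$, $t^{\pm\mathfrak s/\ell}x=(t^{\pm\mathfrak s_i/\ell}x_i)_i$. Fix a measurable $G:\mathbb R^d\to[0,\infty)$ and $G_t(x)=t^{-|\mathfrak s|/\ell}G(t^{-\mathfrak s/\ell}x)$. A *weight* is a continuous $w:\mathbb R^d\to(0,1]$; it is *$G$-controlled by* a continuous $w^*:\mathbb R^d\to[1,\infty)$ if $w(x+y)\le w^*(x)w(y)$ for all $x,y$ and $\sup_{0<t\le T}\sup_x\|x\|_{\mathfrak s}^n\,w^*(t^{\mathfrak s/\ell}x)\,G(x)<\infty$ for all $n\in\mathbb N$, $T>0$. Put $\|f\|_{L^p(w;X)}=\|w\,\|f\|_X\|_{L^p(\mathbb R^d)}$ for (strongly) measurable $f$ with values in a Banach space $X$, and let $L^p_c(w)$ be the closure of $C(\mathbb R^d)\cap L^p(w)$ in $L^p(w)$. Let $\{Q_t\}_{t>0}$ be a *$G$-type semigroup*: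 continuous kernels $Q_t(x,y)$ on $\mathbb R^d\times\mathbb R^d$ with $\int Q_{t-s}(x,z)Q_s(z,y)\,dz=Q_t(x,y)$ for $0<s<t$, $\lim_{t\downarrow0}\int Q_t(x,y)\,dy=1$, differentiable in $t$, and, for some constants $C_1,C_2$, $|Q_t(x,y)|\le C_1G_t(x-y)$ and $|\partial_tQ_t(x,y)|\le C_2t^{-1}G_t(x-y)$. Write $Q_t(x,f)=\int Q_t(x,y)f(y)\,dy$. **Besov spaces.** For $\beta\in\mathbb R$, $p\in[1,\infty]$ let $\|f\|_{B^{\beta,Q}_p(w)}=\|Q_1f\|_{L^p(w)}+\sup_{0<t\le1}t^{-\beta/\ell}\|Q_tf\|_{L^p(w)}$, and let $\overline{B}{}^{\beta}$ be the completion of $L^p_c(w)$ under this norm; $Q_t$ ($0<t\le1$) and the norm extend to it, its elements $\Lambda$ are determined by $(Q_t\Lambda)_{0<t\le1}$, and $\overline B{}^{\beta'}\subset\overline B{}^{\beta}$ for $\beta\le\beta'$. For $\alpha\le0$, $B^{\alpha,Q}_p(w)$ is the set of all $\Lambda\in\bigcap_{\beta<\alpha}\overline B{}^{\beta}$ with $\|\Lambda\|_{B^{\alpha,Q}_p(w)}<\infty$.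 **Structures.** For $\mathbf a=(r(\mathbf a),i(\mathbf a))\in\mathbb R\times[1,\infty]$, write $\mathbf b\prec\mathbf a$ if $r(\mathbf b)<r(\mathbf a)$ and $i(\mathbf b)\ge i(\mathbf a)$; then $r(\mathbf a\ominus\mathbf b)=r(\mathbf a)-r(\mathbf b)$ and $1/i(\mathbf a\ominus\mathbf b)=1/i(\mathbf a)-1/i(\mathbf b)$. A *regularity-integrability structure* $(\mathbf A,\mathbf T,\mathbf G)$ consists of $\mathbf A\subset\mathbb R\times[1,\infty]$ with $\{\mathbf b\in\mathbf A:\mathbf b\prec\mathbf a\}$ finite for all $\mathbf a\in\mathbb R\times[1,\infty]$, an algebraic direct sum $\mathbf T=\bigoplus_{\mathbf a\in\mathbf A}\mathbf T_{\mathbf a}$ of Banach spaces, and a group $\mathbf G$ of continuous linear operators on $\mathbf T$ with $(\Gamma-\mathrm{id})\mathbf T_{\mathbf a}\subset\bigoplus_{\mathbf b\prec\mathbf a}\mathbf T_{\mathbf b}$ for $\Gamma\in\mathbf G$. It has *regularity* $\alpha_0$ if $r(\mathbf a)\ge\alpha_0$ for all $\mathbf a\in\mathbf A$. **Models.** A *smooth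 model* consists of continuous linear $\Pi_x:\mathbf T\to C(\mathbb R^d)$ and $\Gamma_{xy}\in\mathbf G$ ($x,y\in\mathbb R^d$) with $\Pi_x\Gamma_{xy}=\Pi_y$, $\Gamma_{xx}=\mathrm{id}$, $\Gamma_{xy}\Gamma_{yz}=\Gamma_{xz}$, each $\Pi_x\tau$ ($\tau\in\mathbf T_{\mathbf a}$) lying in $L^p(w')$ for some $p\in[1,\infty]$ and some $G$-controlled weight $w'$ (so that $Q_t(x,\Pi_x\tau)$ makes sense), such that for all $\mathbf c\in\mathbb R\times[1,\infty]$ $$\|\Pi\|_{\mathbf c,w}=\max_{\mathbf a\prec\mathbf c}\sup_{0<t\le1}t^{-r(\mathbf a)/\ell}\|Q_t(x,\Pi_x(\cdot))\|_{L_x^{i(\mathbf a)}(w;\mathbf T_{\mathbf a}^*)}<\infty,$$ $$\|\Gamma\|_{\mathbf c,w}=\max_{\mathbf b\prec\mathbf a\prec\mathbf c}\sup_{h\ne0}\frac{\|\Gamma_{(x+h)x}\|_{L_x^{i(\mathbf a\ominus\mathbf b)}(w;\mathcal L(\mathbf T_{\mathbf a},\mathbf T_{\mathbf b}))}}{w^*(h)\|h\|_{\mathfrak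 s}^{r(\mathbf a\ominus\mathbf b)}}<\infty.$$ Here $\mathbf a,\mathbf b$ range over $\mathbf A$. The space $\mathscr M_w$ of *models* $M=(\Pi,\Gamma)$ is the completion of the set of smooth models under the pseudo-metrics $\|\Pi^{(1)}-\Pi^{(2)}\|_{\mathbf c,w}+\|\Gamma^{(1)}-\Gamma^{(2)}\|_{\mathbf c,w}$ for all $\mathbf c$; put $|||M|||_{\mathbf c,w}=\|\Pi\|_{\mathbf c,w}+\|\Gamma\|_{\mathbf c,w}$. For a model, $Q_t(x,\Pi_x(\cdot))$ and $\Gamma_{(x+h)x}$ are defined, for almost every $x$, as limits in these norms. **Modelled distributions.** $\mathcal D^{\mathbf c}_v(\Gamma)$ is the set of measurable $f:\mathbb R^d\to\bigoplus_{\mathbf a\in\mathbf A,\mathbf a\prec\mathbf c}\mathbf T_{\mathbf a}$ such that, with $\Delta^\Gamma_{x;h}f=f(x-h)-\Gamma_{(x-h)x}f(x)$, $$(\!|f|\!)_{\mathbf c,v}=\max_{\mathbf a\prec\mathbf c}\|f\|_{L^{i(\mathbf c\ominus\mathbf a)}(v;\mathbf T_{\mathbf a})}<\infty,\qquad \|f\|^\Gamma_{\mathbf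 c,v}=\max_{\mathbf a\prec\mathbf c}\sup_{h\ne0}\frac{\|\Delta^\Gamma_{x;h}f\|_{L_x^{i(\mathbf c\ominus\mathbf a)}(v;\mathbf T_{\mathbf a})}}{v^*(h)\|h\|_{\mathfrak s}^{r(\mathbf c\ominus\mathbf a)}}<\infty .$$ Put $|||f|||^\Gamma_{\mathbf c,v}=(\!|f|\!)_{\mathbf c,v}+\|f\|^\Gamma_{\mathbf c,v}$. For two models, $\|f^{(1)};f^{(2)}\|_{\mathbf c,v}$ is defined like $\|f\|^\Gamma_{\mathbf c,v}$ with $\Delta^{\Gamma^{(1)}}_{x;h}f^{(1)}-\Delta^{\Gamma^{(2)}}_{x;h}f^{(2)}$ in place of $\Delta^\Gamma_{x;h}f$, and $|||f^{(1)};f^{(2)}|||_{\mathbf c,v}=(\!|f^{(1)}-f^{(2)}|\!)_{\mathbf c,v}+\|f^{(1)};f^{(2)}\|_{\mathbf c,v}$. A *reconstruction* of $f\in\mathcal D_v^{\mathbf c}(\Gamma)$ for $M$ is a $\Lambda\in B^{\alpha_0,Q}_{i(\mathbf c)}(wv)$ with $$[\![\Lambda]\!]_{\mathbf c,wv}=\sup_{0<t\le1}t^{-r(\mathbf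 c)/\ell}\big\|Q_t(x,\Lambda)-Q_t(x,\Pi_xf(x))\big\|_{L_x^{i(\mathbf c)}(wv)}<\infty ;$$ $[\![\Lambda^{(1)};\Lambda^{(2)}]\!]_{\mathbf c,wv}$ is defined in the same way with the difference of the two expressions $Q_t(x,\Lambda^{(i)})-Q_t(x,\Pi^{(i)}_xf^{(i)}(x))$. **Theorem (reconstruction).** Let $(\mathbf A,\mathbf T,\mathbf G)$ be a regularity-integrability structure of regularity $\alpha_0\le0$. Let $w$ and $v$ be weights $G$-controlled by $w^*$ and $v^*$, such that moreover $wv$ is $G$-controlled by $w^*v^*$ and $w^2$ is $G$-controlled by $(w^*)^2$. Let $\mathbf c\in(0,\infty)\times[1,\infty]$. 1. For all $M=(\Pi,\Gamma)\in\mathscr M_w$ and $f\in\mathcal D^{\mathbf c}_v(\Gamma)$ there is a unique reconstruction $\mathcal Rf$ of $f$ for $M$. 2. There is a constant $C>0$ such that for all such $M$ and $f$ $$\|\mathcal Rf\|_{B^{\alpha_0,Q}_{i(\mathbf c)}(wv)}\le C\,\|\Pi\|_{\mathbf c,w}\,|||f|||^\Gamma_{\mathbf c,v},\qquad [\![\mathcal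 Rf]\!]_{\mathbf c,wv}\le C\,\|\Pi\|_{\mathbf c,w}\,\|f\|^\Gamma_{\mathbf c,v}.$$ 3. There is an affine function $R\mapsto C_R>0$ of $R>0$ such that $$\|\mathcal Rf^{(1)}-\mathcal Rf^{(2)}\|_{B^{\alpha_0,Q}_{i(\mathbf c)}(wv)}\le C_R\big(\|\Pi^{(1)}-\Pi^{(2)}\|_{\mathbf c,w}+|||f^{(1)};f^{(2)}|||_{\mathbf c,v}\big),$$ $$[\![\mathcal Rf^{(1)};\mathcal Rf^{(2)}]\!]_{\mathbf c,wv}\le C_R\big(\|\Pi^{(1)}-\Pi^{(2)}\|_{\mathbf c,w}+\|f^{(1)};f^{(2)}\|_{\mathbf c,v}\big)$$ whenever $M^{(i)}=(\Pi^{(i)},\Gamma^{(i)})\in\mathscr M_w$, $f^{(i)}\in\mathcal D^{\mathbf c}_v(\Gamma^{(i)})$, $|||M^{(i)}|||_{\mathbf c,w}\le R$ and $|||f^{(i)}|||^{\Gamma^{(i)}}_{\mathbf c,v}\le R$ for $i=1,2$. -/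

import Mathlib

open MeasureTheory Filter Topology Set
open scoped ENNReal DirectSum

noncomputable section

namespace RegInt

/-! ### Scaling, the function `G`, weights and weighted `L^p` norms -/

/-- The underlying space `ℝ^d` (with its topology and Lebesgue measure). -/
abbrev Sp (d : ℕ) : Type := Fin d → ℝ

/-- The anisotropic size `‖x‖_𝔰 = ∑ |x_i|^{1/𝔰_i}`. -/
def sNorm {d : ℕ} (s : Fin d → ℝ) (x : Sp d) : ℝ := ∑ i, |x i| ^ (1 / s i)

/-- The anisotropic dilation `t^{𝔰/ℓ} x`. -/
def dilate {d : ℕ} (s : Fin d → ℝ) (ℓ t : ℝ) (x : Sp d) : Sp d := fun i => t ^ (s i / ℓ) * x i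

/-- `G_t(x) = t^{-|𝔰|/ℓ} G(t^{-𝔰/ℓ} x)`. -/
def scaledG {d : ℕ} (s : Fin d → ℝ) (ℓ : ℝ) (G : Sp d → ℝ) (t : ℝ) (x : Sp d) : ℝ :=
  t ^ (-(∑ i, s i) / ℓ) * G (fun i => t ^ (-(s i) / ℓ) * x i)

/-- `w` is a weight (continuous, values in `(0,1]`) which is `G`-controlled, the controlling
function being `wstar`. -/
structure GControlled {d : ℕ} (s : Fin d → ℝ) (ℓ : ℝ) (G : Sp d → ℝ) (w wstar : Sp d → ℝ) :
    Prop where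
  continuous_weight : Continuous w
  weight_pos : ∀ x, 0 < w x
  weight_le_one : ∀ x, w x ≤ 1
  continuous_star : Continuous wstar
  one_le_star : ∀ x, 1 ≤ wstar x
  moderate : ∀ x y, w (x + y) ≤ wstar x * w y
  controlled : ∀ (n : ℕ) (T : ℝ), 0 < T → ∃ C : ℝ, ∀ t : ℝ, 0 < t → t ≤ T → ∀ x : Sp d,
    sNorm s x ^ n * wstar (dilate s ℓ t x) * G x ≤ C

/-- The weighted norm `‖f‖_{L^p(w;X)} = ‖ w f ‖_{L^p}`, with values in `[0,∞]`. -/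
def wLp {d : ℕ} {X : Type*} [NormedAddCommGroup X] [NormedSpace ℝ X]
    (w : Sp d → ℝ) (p : ℝ≥0∞) (f : Sp d → X) : ℝ≥0∞ :=
  eLpNorm (fun x => w x • f x) p volume

/-- `f ∈ L^p(w)`. -/
def MemWLp {d : ℕ} (w : Sp d → ℝ) (p : ℝ≥0∞) (f : Sp d → ℝ) : Prop :=
  AEStronglyMeasurable f volume ∧ wLp w p f < ∞

/-- `f ∈ L^p_c(w)`, the closure of `C(ℝ^d) ∩ L^p(w)` in `L^p(w)`. -/
def MemWLpc {d : ℕ} (w : Sp d → ℝ) (p : ℝ≥0∞) (f : Sp d → ℝ) : Prop :=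
  MemWLp w p f ∧ ∀ ε : ℝ≥0∞, 0 < ε →
    ∃ g : Sp d → ℝ, Continuous g ∧ wLp w p g < ∞ ∧ wLp w p (fun x => f x - g x) < ε

/-! ### `G`-type semigroups and the associated Besov spaces -/

/-- `Q` is a `G`-type semigroup of operators. Only the values `Q t`, `t > 0`, matter. -/
structure IsGTypeSemigroup {d : ℕ} (s : Fin d → ℝ) (ℓ : ℝ) (G : Sp d → ℝ)
    (Q : ℝ → Sp d → Sp d → ℝ) : Prop where
  continuous_kernel : ∀ t : ℝ, 0 < t → Continuous (fun z : Sp d × Sp d => Q t z.1 z.2)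
  semigroup : ∀ t₁ t : ℝ, 0 < t₁ → t₁ < t → ∀ x y, ∫ z, Q (t - t₁) x z * Q t₁ z y = Q t x y
  conservative : ∀ x, Tendsto (fun t => ∫ y, Q t x y) (𝓝[>] 0) (𝓝 1)
  upper : ∃ C : ℝ, 0 < C ∧ ∀ t : ℝ, 0 < t → ∀ x y, |Q t x y| ≤ C * scaledG s ℓ G t (x - y)
  time_derivative : ∃ C : ℝ, 0 < C ∧ ∀ t : ℝ, 0 < t → ∀ x y,
    DifferentiableAt ℝ (fun t' => Q t' x y) t ∧
      |deriv (fun t' => Q t' x y) t| ≤ C * t⁻¹ * scaledG s ℓ G t (x - y)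

/-- `(Q_t f)(x) = Q_t(x,f) = ∫ Q_t(x,y) f(y) dy`. -/
def applyQ {d : ℕ} (Q : ℝ → Sp d → Sp d → ℝ) (t : ℝ) (f : Sp d → ℝ) (x : Sp d) : ℝ :=
  ∫ y, Q t x y * f y

/-- The time parameters `0 < t ≤ 1`. -/
abbrev Tm : Type := Set.Ioc (0 : ℝ) 1

/-- The time `1`. -/
def Tm.one : Tm := ⟨1, zero_lt_one, le_refl 1⟩

/-- The Besov norm (third index `∞`) `‖Q_1 Λ‖_{L^p(w)} + sup_{0<t≤1} t^{-α/ℓ} ‖Q_t Λ‖_{L^p(w)}`,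
as a function of the family `u t = Q_t Λ`. -/
def besovNorm {d : ℕ} (ℓ α : ℝ) (p : ℝ≥0∞) (w : Sp d → ℝ) (u : Tm → Sp d → ℝ) : ℝ≥0∞ :=
  wLp w p (u Tm.one) + ⨆ t : Tm, ENNReal.ofReal ((t : ℝ) ^ (-α / ℓ)) * wLp w p (u t)

/-- Carrier of the Besov spaces. The Besov norm of `f ∈ L^p_c(w)` depends on `f` only through the
family `(Q_t f)_{0<t≤1}`, so a completion of `L^p_c(w)` under a Besov norm is the closure of
`{(Q_t f)_{0<t≤1}}` in the complete space of all families of a.e.-classes of functions with finite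
norm. An element `Λ` of a Besov space is accordingly given by the family `Λ t = Q_t Λ`; this also
makes the spaces for different `α` literally comparable. -/
abbrev BesovElt (d : ℕ) : Type := Tm → (Sp d →ₘ[(volume : Measure (Sp d))] ℝ)

/-- `Q_t(x, Λ)`. -/
def BesovElt.eval {d : ℕ} (Λ : BesovElt d) (t : Tm) (x : Sp d) : ℝ := Λ t x

/-- `Λ` belongs to the completion of `L^p_c(w)` under the Besov norm of exponents `(α, p, ∞)`. -/
def MemBesovCompletion {d : ℕ} (Q : ℝ → Sp d → Sp d → ℝ) (ℓ α : ℝ) (p : ℝ≥0∞) (w : Sp d → ℝ)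
    (Λ : BesovElt d) : Prop :=
  ∀ ε : ℝ≥0∞, 0 < ε → ∃ f : Sp d → ℝ, MemWLpc w p f ∧
    besovNorm ℓ α p w (fun t x => Λ.eval t x - applyQ Q t f x) < ε

/-- The Besov space `B_p^{α,Q}(w)`: the elements of the completions of all regularities `β < α`
whose Besov norm of regularity `α` is finite. -/
def MemBesov {d : ℕ} (Q : ℝ → Sp d → Sp d → ℝ) (ℓ α : ℝ) (p : ℝ≥0∞) (w : Sp d → ℝ)
    (Λ : BesovElt d) : Prop :=
  (∀ β : ℝ, β < α → MemBesovCompletion Q ℓ β p w Λ) ∧ besovNorm ℓ α p w Λ.eval < ∞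

/-! ### Regularity-integrability structures -/

/-- The index set `ℝ × [1,∞]`: pairs of a regularity and an integrability exponent. -/
structure Idx where
  r : ℝ
  i : ℝ≥0∞
  one_le : 1 ≤ i

/-- `b ⪯ a`. -/
def Idx.preceq (b a : Idx) : Prop := b.r ≤ a.r ∧ a.i ≤ b.i

/-- `b ≺ a`. -/
def Idx.prec (b a : Idx) : Prop := b.r < a.r ∧ a.i ≤ b.i

/-- The integrability exponent `i(a ⊖ b)`, i.e. `1/i(a ⊖ b) = 1/i(a) - 1/i(b)`, for `b ⪯ a`. The
regularity `r(a ⊖ b)` is `r(a) - r(b)`. -/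
def Idx.iOminus (a b : Idx) : ℝ≥0∞ := (a.i⁻¹ - b.i⁻¹)⁻¹

/-- The inclusion of `T_a` into the model space `⨁ T_a`. -/
def incl {A : Set Idx} {T : A → Type*} [∀ a, NormedAddCommGroup (T a)] [∀ a, NormedSpace ℝ (T a)]
    (a : A) : T a →ₗ[ℝ] ⨁ a, T a :=
  open scoped Classical in DirectSum.lof ℝ A T a

/-- The linear map on `⨁ T_a` with prescribed restrictions to the summands. -/
def glue {A : Set Idx} {T : A → Type*} [∀ a, NormedAddCommGroup (T a)] [∀ a, NormedSpace ℝ (T a)]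
    {F : Type*} [AddCommGroup F] [Module ℝ F] (φ : ∀ a, T a →ₗ[ℝ] F) : (⨁ a, T a) →ₗ[ℝ] F :=
  open scoped Classical in DirectSum.toModule ℝ A F φ

/-- A regularity-integrability structure with index set `A` and with model space the algebraic
direct sum of the Banach spaces `T a`, `a ∈ A`. An operator on the direct sum is continuous iff its
restriction to each summand is; for triangular operators as here (finitely many components) this
is continuity of each component `T a → T b`. -/
structure RIStructure (A : Set Idx) (T : A → Type*) [∀ a, NormedAddCommGroup (T a)]
    [∀ a, NormedSpace ℝ (T a)] [∀ a, CompleteSpace (T a)] where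
  finite_below : ∀ a : Idx, {b : Idx | b ∈ A ∧ b.prec a}.Finite
  group : Subgroup ((⨁ a, T a) ≃ₗ[ℝ] (⨁ a, T a))
  continuous_group : ∀ g ∈ group, ∀ a b : A, Continuous (fun τ : T a => (g (incl a τ)) b)
  triangular : ∀ g ∈ group, ∀ (a : A) (τ : T a) (b : A),
    (g (incl a τ) - incl a τ) b ≠ 0 → (b : Idx).prec (a : Idx)

/-- `α₀` is a regularity of a structure with index set `A`: `(α₀,∞) ⪯ a` for all `a ∈ A`. -/
def IsRegularity (A : Set Idx) (α₀ : ℝ) : Prop :=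
  ∀ a ∈ A, Idx.preceq ⟨α₀, ∞, le_top⟩ a

section Structure

variable {d : ℕ} {A : Set Idx} {T : A → Type*} [∀ a, NormedAddCommGroup (T a)]
  [∀ a, NormedSpace ℝ (T a)]

/-! ### Models -/

variable (d T) in
/-- What the pseudo-metrics on models see of a pair `(Π, Γ)`:
`pi t a x` is the functional `Q_t(x, Π_x(·))` on `T_a`, for `0 < t ≤ 1`;
`gam h a b x` is the component `T_a → T_b` of `Γ_{(x+h)x}`, for `b ≺ a` and `h ≠ 0`.
As functions of `x` these are meant up to equality almost everywhere. -/
structure ModelData where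
  pi : Tm → ∀ a : A, Sp d → (T a →L[ℝ] ℝ)
  gam : Sp d → ∀ a b : A, Sp d → (T a →L[ℝ] T b)

/-- The data of `(Π¹ - Π², Γ¹ - Γ²)`. -/
def ModelData.sub (M₁ M₂ : ModelData d T) : ModelData d T where
  pi t a x := M₁.pi t a x - M₂.pi t a x
  gam h a b x := M₁.gam h a b x - M₂.gam h a b x

/-- `Q_t(x, Π_x τ)` for `τ ∈ ⨁ T_a`. -/
def ModelData.evalPi (M : ModelData d T) (t : Tm) (x : Sp d) (τ : ⨁ a, T a) : ℝ :=
  glue (fun a => (M.pi t a x : T a →ₗ[ℝ] ℝ)) τ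

open scoped Classical in
/-- The component in `T_b` of `Γ_{(x+h)x} τ`, `h ≠ 0`, for `τ ∈ ⨁ T_a`. -/
def ModelData.evalGam (M : ModelData d T) (h x : Sp d) (τ : ⨁ a, T a) (b : A) : T b :=
  τ b + glue (fun a => if (b : Idx).prec (a : Idx) then (M.gam h a b x : T a →ₗ[ℝ] T b) else 0) τ

/-- `‖Π‖_{c,w}`. -/
def ModelData.piNorm (ℓ : ℝ) (w : Sp d → ℝ) (c : Idx) (M : ModelData d T) : ℝ≥0∞ :=
  ⨆ (a : A) (_ : (a : Idx).prec c) (t : Tm),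
    ENNReal.ofReal ((t : ℝ) ^ (-(a : Idx).r / ℓ)) * wLp w (a : Idx).i (M.pi t a)

/-- `‖Γ‖_{c,w}`. -/
def ModelData.gamNorm (s : Fin d → ℝ) (w wstar : Sp d → ℝ) (c : Idx) (M : ModelData d T) : ℝ≥0∞ :=
  ⨆ (a : A) (b : A) (_ : (b : Idx).prec (a : Idx)) (_ : (a : Idx).prec c) (h : Sp d) (_ : h ≠ 0),
    wLp w ((a : Idx).iOminus b) (M.gam h a b) /
      ENNReal.ofReal (wstar h * sNorm s h ^ ((a : Idx).r - (b : Idx).r))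

/-- `|||M|||_{c,w} = ‖Π‖_{c,w} + ‖Γ‖_{c,w}`. -/
def ModelData.norm (s : Fin d → ℝ) (ℓ : ℝ) (w wstar : Sp d → ℝ) (c : Idx) (M : ModelData d T) :
    ℝ≥0∞ :=
  M.piNorm ℓ w c + M.gamNorm s w wstar c

/-- Measurability in `x` of the Banach-valued functions entering the norms. -/
def ModelData.Measurable (M : ModelData d T) : Prop :=
  (∀ t a, AEStronglyMeasurable (M.pi t a) volume) ∧
    ∀ h : Sp d, h ≠ 0 → ∀ a b : A, (b : Idx).prec (a : Idx) →
      AEStronglyMeasurable (M.gam h a b) volume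

variable [∀ a, CompleteSpace (T a)]

/-- `M` is the data of a smooth model `(P, Γ)`. Each function `P_x τ` is assumed to belong to some
`L^p(w')` with a `G`-controlled weight `w'`, which gives a meaning to `Q_t(x, P_x τ)`. -/
def IsSmoothModel (s : Fin d → ℝ) (ℓ : ℝ) (G : Sp d → ℝ) (Q : ℝ → Sp d → Sp d → ℝ)
    (𝒯 : RIStructure A T) (w wstar : Sp d → ℝ) (M : ModelData d T) : Prop :=
  ∃ (P : Sp d → ∀ a : A, T a →L[ℝ] C(Sp d, ℝ))
    (Γ : Sp d → Sp d → ((⨁ a, T a) ≃ₗ[ℝ] (⨁ a, T a))),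
    (∀ x y, Γ x y ∈ 𝒯.group) ∧
    (∀ x y τ, glue (fun a => (P x a : T a →ₗ[ℝ] C(Sp d, ℝ))) (Γ x y τ) =
      glue (fun a => (P y a : T a →ₗ[ℝ] C(Sp d, ℝ))) τ) ∧
    (∀ x, Γ x x = 1) ∧
    (∀ x y z, Γ x y * Γ y z = Γ x z) ∧
    (∀ x a τ, ∃ (p : ℝ≥0∞) (w' wstar' : Sp d → ℝ), 1 ≤ p ∧ GControlled s ℓ G w' wstar' ∧
      MemWLp w' p (P x a τ)) ∧
    (∀ (t : Tm) a x τ, M.pi t a x τ = applyQ Q t (P x a τ) x) ∧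
    (∀ h : Sp d, h ≠ 0 → ∀ a b : A, (b : Idx).prec (a : Idx) → ∀ x (τ : T a),
      M.gam h a b x τ = (Γ (x + h) x (incl a τ)) b) ∧
    M.Measurable ∧
    ∀ c : Idx, M.norm s ℓ w wstar c < ∞

/-- `M` is a model, i.e. an element of the completion of the set of smooth models under the
pseudo-metrics `|||·;·|||_{c,w}` for all `c`. The map sending a smooth model to its data is isometric
for these pseudo-metrics into a complete space, so that the completion is the closure of its image.
(The pseudo-metrics are directed in `c`.) -/
def IsModel (s : Fin d → ℝ) (ℓ : ℝ) (G : Sp d → ℝ) (Q : ℝ → Sp d → Sp d → ℝ)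
    (𝒯 : RIStructure A T) (w wstar : Sp d → ℝ) (M : ModelData d T) : Prop :=
  M.Measurable ∧ ∀ (c : Idx) (ε : ℝ≥0∞), 0 < ε → ∃ S : ModelData d T,
    IsSmoothModel s ℓ G Q 𝒯 w wstar S ∧ (M.sub S).norm s ℓ w wstar c < ε

/-! ### Modelled distributions -/

/-- The component in `T_a` of `Δ^Γ_{x;h} f = f(x-h) - Γ_{(x-h)x} f(x)`. -/
def mdDelta (M : ModelData d T) (f : Sp d → ⨁ a, T a) (h x : Sp d) (a : A) : T a :=
  f (x - h) a - M.evalGam (-h) x (f x) a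

/-- `⦅f⦆_{c,v}`. -/
def mdSize (v : Sp d → ℝ) (c : Idx) (f : Sp d → ⨁ a, T a) : ℝ≥0∞ :=
  ⨆ (a : A) (_ : (a : Idx).prec c), wLp v (c.iOminus a) (fun x => f x a)

/-- The Hölder-type seminorm of a family `D h x a` of increments, which gives `‖f‖_{c,v}^Γ` and
`‖f¹;f²‖_{c,v}`. -/
def mdHolder (s : Fin d → ℝ) (v vstar : Sp d → ℝ) (c : Idx)
    (D : Sp d → Sp d → ∀ a : A, T a) : ℝ≥0∞ :=
  ⨆ (a : A) (_ : (a : Idx).prec c) (h : Sp d) (_ : h ≠ 0),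
    wLp v (c.iOminus a) (fun x => D h x a) /
      ENNReal.ofReal (vstar h * sNorm s h ^ (c.r - (a : Idx).r))

/-- `‖f‖_{c,v}^Γ`. -/
def mdSemi (s : Fin d → ℝ) (v vstar : Sp d → ℝ) (c : Idx) (M : ModelData d T)
    (f : Sp d → ⨁ a, T a) : ℝ≥0∞ :=
  mdHolder s v vstar c (mdDelta M f)

/-- `|||f|||_{c,v}^Γ`. -/
def mdNorm (s : Fin d → ℝ) (v vstar : Sp d → ℝ) (c : Idx) (M : ModelData d T)
    (f : Sp d → ⨁ a, T a) : ℝ≥0∞ :=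
  mdSize v c f + mdSemi s v vstar c M f

/-- `‖f¹;f²‖_{c,v}`. -/
def mdSemiDist (s : Fin d → ℝ) (v vstar : Sp d → ℝ) (c : Idx) (M₁ M₂ : ModelData d T)
    (f₁ f₂ : Sp d → ⨁ a, T a) : ℝ≥0∞ :=
  mdHolder s v vstar c (fun h x a => mdDelta M₁ f₁ h x a - mdDelta M₂ f₂ h x a)

/-- `|||f¹;f²|||_{c,v}`. -/
def mdDist (s : Fin d → ℝ) (v vstar : Sp d → ℝ) (c : Idx) (M₁ M₂ : ModelData d T)
    (f₁ f₂ : Sp d → ⨁ a, T a) : ℝ≥0∞ :=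
  mdSize v c (fun x => f₁ x - f₂ x) + mdSemiDist s v vstar c M₁ M₂ f₁ f₂

/-- `f ∈ D_v^c(Γ)`. -/
structure IsModelled (s : Fin d → ℝ) (v vstar : Sp d → ℝ) (c : Idx) (M : ModelData d T)
    (f : Sp d → ⨁ a, T a) : Prop where
  support : ∀ x (a : A), ¬ (a : Idx).prec c → f x a = 0
  measurable : ∀ a : A, AEStronglyMeasurable (fun x => f x a) volume
  size_lt_top : mdSize v c f < ∞
  semi_lt_top : mdSemi s v vstar c M f < ∞

/-! ### Reconstructions -/

/-- `Q_t(x,Λ) - Q_t(x,Π_x f(x))`. -/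
def recDefect (M : ModelData d T) (f : Sp d → ⨁ a, T a) (Λ : BesovElt d) (t : Tm) (x : Sp d) : ℝ :=
  Λ.eval t x - M.evalPi t x (f x)

/-- `sup_{0<t≤1} t^{-r(c)/ℓ} ‖D t‖_{L^{i(c)}(W)}`. -/
def recSup (ℓ : ℝ) (W : Sp d → ℝ) (c : Idx) (D : Tm → Sp d → ℝ) : ℝ≥0∞ :=
  ⨆ t : Tm, ENNReal.ofReal ((t : ℝ) ^ (-c.r / ℓ)) * wLp W c.i (D t)

/-- `Λ` is a reconstruction of `f` for `M` (with `W = w v`). -/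
def IsReconstruction (Q : ℝ → Sp d → Sp d → ℝ) (ℓ α₀ : ℝ) (W : Sp d → ℝ) (c : Idx)
    (M : ModelData d T) (f : Sp d → ⨁ a, T a) (Λ : BesovElt d) : Prop :=
  MemBesov Q ℓ α₀ c.i W Λ ∧ recSup ℓ W c (recDefect M f Λ) < ∞

end Structure

end RegInt

end

/-!
The reconstruction is obtained by sewing the germ `E_t(x) = Q_t(x, Π_x f(x))` along the semigroup.

Call a family `(Λ_t)` an orbit if `Λ_t = Q_{t-u} Λ_u` for `u < t` (`IsOrbit`); elements of the Besov
spaces are the same as orbits with a bound of the right order in `t` (`MemBesov.isOrbit`,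
`IsOrbit.exists_memBesov`). The germ is almost an orbit (`IsAlmostOrbit`): its defect
`E_t - Q_{t-u} E_u`, for `u` comparable to `t`, is of order `t^{r(c)/ℓ}`. As `r(c) > 0`, telescoping
over dyadic times shows that `Q_{t-2^{-n}} E_{2^{-n}}` converges to an orbit within `t^{r(c)/ℓ}` of
the germ, and that every orbit which stays close to the germ at this order satisfies the quantitative
bound (`IsAlmostOrbit.exists_isOrbit`, `IsOrbit.wLp_sub_le`). The latter applied to the zero germ
gives uniqueness. Applied to the difference of two germs it gives the Lipschitz estimate, and the
bound for one modelled distribution is the case where the second one vanishes, so that all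
estimates follow from `exists_orbit_bounds`.

The defect of the germ is estimated in `wLp_germ_defect_le`. For a smooth model,
`Q_{t-u} E_u - E_t` at `x` is the integral of `Q_{t-u}(x, x-h)` against the local increment
`Q_u(x-h, Π_{x-h} Δ_{x;h} f)` (`IsSmoothModel.exists_increment`), and the Hölder and Minkowski
inequalities together with the moments of `G` yield the order `t^{r(c)/ℓ}`.

A general model is only a limit of smooth ones, and its increments need not be jointly measurable, so
the estimate has to be obtained by approximation. A modelled distribution for the limit is not one
for the approximating models: at fixed `h` the increments converge on every superlevel set `{w ≥ δ}`,
with a rate involving `w^*(-h)`, which `G` does not control. The interchange of the limit with the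
integral in `h` is justified by a domination that is exponential in `h`: on `{w ≥ δ}` the operators
`Γ_{(x-h)x}` of a smooth model grow at most exponentially, as products of about `‖h‖` triangular
operators (`exists_gam_growth`), and the semigroup property alone gives the kernels exponential
moments of every order (`lintegral_supKernel_exp_lt_top`). Letting `δ → 0` removes the restriction.
-/

namespace RegInt

/-! ### The anisotropic size and integrability of kernels -/

section Size

variable {d : ℕ} {s : Fin d → ℝ}

lemma sNorm_nonneg (s : Fin d → ℝ) (x : Sp d) : 0 ≤ sNorm s x :=
  Finset.sum_nonneg fun _ _ => Real.rpow_nonneg (abs_nonneg _) _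

lemma sNorm_neg (s : Fin d → ℝ) (x : Sp d) : sNorm s (-x) = sNorm s x := by
  simp [sNorm]

lemma continuous_sNorm (hs : ∀ i, 1 ≤ s i) : Continuous (sNorm s) := by
  unfold sNorm
  refine continuous_finsetSum _ fun i _ => ?_
  exact (continuous_apply i).abs.rpow_const fun x => Or.inr (by have := hs i; positivity)

lemma sNorm_pos {x : Sp d} (hx : x ≠ 0) : 0 < sNorm s x := by
  obtain ⟨i, hi⟩ := Function.ne_iff.1 hx
  refine Finset.sum_pos' (fun _ _ => Real.rpow_nonneg (abs_nonneg _) _) ⟨i, Finset.mem_univ _, ?_⟩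
  exact Real.rpow_pos_of_pos (abs_pos.2 hi) _

lemma sNorm_add_le (hs : ∀ i, 1 ≤ s i) (x y : Sp d) :
    sNorm s (x + y) ≤ sNorm s x + sNorm s y := by
  unfold sNorm
  rw [← Finset.sum_add_distrib]
  refine Finset.sum_le_sum fun i _ => ?_
  have h1 : 0 ≤ 1 / s i := by have := hs i; positivity
  have h2 : 1 / s i ≤ 1 := by
    rw [div_le_one (by linarith [hs i])]; exact hs i
  calc |(x + y) i| ^ (1 / s i) ≤ (|x i| + |y i|) ^ (1 / s i) :=
        Real.rpow_le_rpow (abs_nonneg _) (abs_add_le _ _) h1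
    _ ≤ _ := Real.rpow_add_le_add_rpow (abs_nonneg _) (abs_nonneg _) h1 h2

lemma sNorm_dilate (hs : ∀ i, 1 ≤ s i) {ℓ t : ℝ} (ht : 0 < t) (x : Sp d) :
    sNorm s (fun i => t ^ (-(s i) / ℓ) * x i) = t ^ (-1 / ℓ) * sNorm s x := by
  unfold sNorm
  rw [Finset.mul_sum]
  refine Finset.sum_congr rfl fun i _ => ?_
  have h1 : s i ≠ 0 := by linarith [hs i]
  rw [abs_mul, abs_of_pos (Real.rpow_pos_of_pos ht _),
    Real.mul_rpow (Real.rpow_nonneg ht.le _) (abs_nonneg _), ← Real.rpow_mul ht.le]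
  congr 2
  field_simp

/-- The polynomially decaying profile of exponent `N`, rescaled anisotropically to time `t`. -/
noncomputable def bracket (s : Fin d → ℝ) (ℓ N t : ℝ) (z : Sp d) : ℝ :=
  t ^ (-(∑ i, s i) / ℓ) * (1 + t ^ (-1 / ℓ) * sNorm s z) ^ (-N)

lemma one_le_one_add (s : Fin d → ℝ) (ℓ : ℝ) {t : ℝ} (ht : 0 < t) (z : Sp d) :
    1 ≤ 1 + t ^ (-1 / ℓ) * sNorm s z := by
  have := mul_nonneg (Real.rpow_nonneg ht.le (-1 / ℓ)) (sNorm_nonneg s z)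
  linarith

lemma bracket_nonneg (s : Fin d → ℝ) (ℓ N : ℝ) {t : ℝ} (ht : 0 < t) (z : Sp d) :
    0 ≤ bracket s ℓ N t z :=
  mul_nonneg (Real.rpow_nonneg ht.le _)
    (Real.rpow_nonneg (zero_le_one.trans (one_le_one_add s ℓ ht z)) _)

lemma continuous_bracket (hs : ∀ i, 1 ≤ s i) (ℓ N : ℝ) {t : ℝ} (ht : 0 < t) :
    Continuous (bracket s ℓ N t) := by
  unfold bracket
  refine continuous_const.mul (Continuous.rpow_const ?_ fun z => Or.inl ?_)
  · exact continuous_const.add (continuous_const.mul (continuous_sNorm hs))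
  · have := one_le_one_add s ℓ ht z
    linarith

/-- The decay exponent `2|s|`, which is enough for integrability. -/
noncomputable def decayExp (s : Fin d → ℝ) : ℝ := 2 * ∑ i, s i

lemma decayExp_nonneg (hs : ∀ i, 1 ≤ s i) : 0 ≤ decayExp s :=
  mul_nonneg zero_le_two (Finset.sum_nonneg fun i _ => by linarith [hs i])

/-- The profile of exponent `2|s|` is dominated by a product of one-dimensional Cauchy densities,
whence its integrability, uniformly in time. -/
lemma bracket_le_prod (hs : ∀ i, 1 ≤ s i) (ℓ : ℝ) {t : ℝ} (ht : 0 < t) (z : Sp d) :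
    bracket s ℓ (decayExp s) t z ≤
      ∏ i, t ^ (-(s i) / ℓ) * (1 + (t ^ (-(s i) / ℓ) * z i) ^ 2)⁻¹ := by
  rw [Finset.prod_mul_distrib, bracket]
  have e1 : ∏ i, t ^ (-(s i) / ℓ) = t ^ (-(∑ i, s i) / ℓ) := by
    rw [← Real.rpow_sum_of_pos ht, ← Finset.sum_div, Finset.sum_neg_distrib]
  rw [e1]
  refine mul_le_mul_of_nonneg_left ?_ (Real.rpow_nonneg ht.le _)
  have hb := one_le_one_add s ℓ ht z
  set b := 1 + t ^ (-1 / ℓ) * sNorm s z with hbdef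
  have e2 : b ^ (-decayExp s) = ∏ i, (b ^ (2 * s i))⁻¹ := by
    rw [Finset.prod_inv_distrib, ← Real.rpow_sum_of_pos (by linarith), ← Finset.mul_sum,
      Real.rpow_neg (by linarith), decayExp]
  rw [e2]
  refine Finset.prod_le_prod (fun i _ => by positivity) fun i _ => ?_
  refine inv_anti₀ (by positivity) ?_
  have hsi := hs i
  set q := t ^ (-(s i) / ℓ) * z i with hq
  have h1 : |q| ^ (1 / s i) ≤ t ^ (-1 / ℓ) * sNorm s z := by
    rw [← sNorm_dilate hs ht]
    exact Finset.single_le_sum (f := fun i => |t ^ (-(s i) / ℓ) * z i| ^ (1 / s i))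
      (fun _ _ => Real.rpow_nonneg (abs_nonneg _) _) (Finset.mem_univ i)
  have h2 : (|q| ^ (1 / s i)) ^ (2 * s i) = q ^ 2 := by
    rw [← Real.rpow_mul (abs_nonneg _), show 1 / s i * (2 * s i) = (2 : ℕ) by
      push_cast; field_simp, Real.rpow_natCast, sq_abs]
  calc 1 + q ^ 2 = 1 ^ (2 * s i) + (|q| ^ (1 / s i)) ^ (2 * s i) := by rw [h2, Real.one_rpow]
    _ ≤ (1 + |q| ^ (1 / s i)) ^ (2 * s i) :=
        Real.add_rpow_le_rpow_add zero_le_one (by positivity) (by linarith)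
    _ ≤ b ^ (2 * s i) := Real.rpow_le_rpow (by positivity) (by rw [hbdef]; linarith) (by linarith)

lemma integrable_bracket (hs : ∀ i, 1 ≤ s i) (ℓ : ℝ) {t : ℝ} (ht : 0 < t) :
    Integrable (bracket s ℓ (decayExp s) t) := by
  have h1 : Integrable (fun z : Sp d => ∏ i, t ^ (-(s i) / ℓ) *
      (1 + (t ^ (-(s i) / ℓ) * z i) ^ 2)⁻¹) := by
    refine Integrable.fintype_prod (f := fun i (x : ℝ) => t ^ (-(s i) / ℓ) *
      (1 + (t ^ (-(s i) / ℓ) * x) ^ 2)⁻¹) fun i => ?_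
    exact (integrable_inv_one_add_sq.comp_mul_left' (Real.rpow_pos_of_pos ht _).ne').const_mul _
  refine h1.mono (continuous_bracket hs ℓ _ ht).aestronglyMeasurable (ae_of_all _ fun z => ?_)
  rw [Real.norm_of_nonneg (bracket_nonneg s ℓ _ ht z)]
  exact (bracket_le_prod hs ℓ ht z).trans (le_abs_self _)

lemma integral_bracket_le (hs : ∀ i, 1 ≤ s i) (ℓ : ℝ) {t : ℝ} (ht : 0 < t) :
    ∫ z, bracket s ℓ (decayExp s) t z ≤ Real.pi ^ d := by
  have h1 : ∀ i, Integrable (fun x : ℝ => t ^ (-(s i) / ℓ) *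
      (1 + (t ^ (-(s i) / ℓ) * x) ^ 2)⁻¹) := fun i =>
    (integrable_inv_one_add_sq.comp_mul_left' (Real.rpow_pos_of_pos ht _).ne').const_mul _
  calc ∫ z, bracket s ℓ (decayExp s) t z
      ≤ ∫ z : Sp d, ∏ i, t ^ (-(s i) / ℓ) * (1 + (t ^ (-(s i) / ℓ) * z i) ^ 2)⁻¹ :=
        integral_mono (integrable_bracket hs ℓ ht)
          (Integrable.fintype_prod (f := fun i (x : ℝ) => t ^ (-(s i) / ℓ) *
            (1 + (t ^ (-(s i) / ℓ) * x) ^ 2)⁻¹) h1) (bracket_le_prod hs ℓ ht)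
    _ = ∏ i : Fin d, ∫ x : ℝ, t ^ (-(s i) / ℓ) * (1 + (t ^ (-(s i) / ℓ) * x) ^ 2)⁻¹ :=
        integral_fintype_prod_volume_eq_prod (fun i (x : ℝ) => t ^ (-(s i) / ℓ) *
            (1 + (t ^ (-(s i) / ℓ) * x) ^ 2)⁻¹)
    _ = ∏ i : Fin d, Real.pi := by
        refine Finset.prod_congr rfl fun i _ => ?_
        have hp := Real.rpow_pos_of_pos ht (-(s i) / ℓ)
        rw [integral_const_mul, Measure.integral_comp_mul_left (fun x : ℝ => (1 + x ^ 2)⁻¹),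
          integral_univ_inv_one_add_sq, abs_of_pos (inv_pos.2 hp), smul_eq_mul, ← mul_assoc,
          mul_inv_cancel₀ hp.ne', one_mul]
    _ = Real.pi ^ d := by simp

lemma lintegral_bracket_le (hs : ∀ i, 1 ≤ s i) (ℓ : ℝ) {t : ℝ} (ht : 0 < t) :
    ∫⁻ z, ENNReal.ofReal (bracket s ℓ (decayExp s) t z) ≤ ENNReal.ofReal (Real.pi ^ d) := by
  rw [← ofReal_integral_eq_lintegral_ofReal (integrable_bracket hs ℓ ht)
    (ae_of_all _ fun z => bracket_nonneg s ℓ _ ht z)]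
  exact ENNReal.ofReal_le_ofReal (integral_bracket_le hs ℓ ht)

/-- A gain of `ρ` in the decay exponent pays for the factor `‖z‖^ρ` and produces `t^{ρ/ℓ}`. -/
lemma bracket_mul_sNorm_le (s : Fin d → ℝ) {ℓ N t ρ : ℝ} (ht : 0 < t) (hρ : 0 ≤ ρ)
    (z : Sp d) :
    bracket s ℓ (N + ρ) t z * sNorm s z ^ ρ ≤ t ^ (ρ / ℓ) * bracket s ℓ N t z := by
  unfold bracket
  have hb := one_le_one_add s ℓ ht z
  have hz := sNorm_nonneg s z
  set b := 1 + t ^ (-1 / ℓ) * sNorm s z with hbdef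
  have h1 : sNorm s z ^ ρ ≤ t ^ (ρ / ℓ) * b ^ ρ := by
    have : sNorm s z ≤ t ^ (1 / ℓ) * b := by
      have e : t ^ (1 / ℓ) * t ^ (-1 / ℓ) = 1 := by
        rw [← Real.rpow_add ht, ← add_div]; simp
      have : t ^ (1 / ℓ) * b = t ^ (1 / ℓ) + sNorm s z := by
        rw [hbdef, mul_add, ← mul_assoc, e]; ring
      have := Real.rpow_pos_of_pos ht (1 / ℓ)
      linarith
    calc sNorm s z ^ ρ ≤ (t ^ (1 / ℓ) * b) ^ ρ := Real.rpow_le_rpow hz this hρ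
      _ = t ^ (ρ / ℓ) * b ^ ρ := by
        rw [Real.mul_rpow (by positivity) (by linarith), ← Real.rpow_mul ht.le]
        congr 2; ring
  calc t ^ (-(∑ i, s i) / ℓ) * b ^ (-(N + ρ)) * sNorm s z ^ ρ
      ≤ t ^ (-(∑ i, s i) / ℓ) * b ^ (-(N + ρ)) * (t ^ (ρ / ℓ) * b ^ ρ) := by gcongr
    _ = t ^ (ρ / ℓ) * (t ^ (-(∑ i, s i) / ℓ) * (b ^ (-(N + ρ)) * b ^ ρ)) := by ring
    _ = _ := by
      rw [← Real.rpow_add (by linarith)]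
      congr 4; ring

lemma scaledG_nonneg {ℓ : ℝ} {G : Sp d → ℝ} (hG : ∀ x, 0 ≤ G x) {t : ℝ} (ht : 0 < t) (z : Sp d) :
    0 ≤ scaledG s ℓ G t z :=
  mul_nonneg (Real.rpow_nonneg ht.le _) (hG _)

/-- A `G`-controlled weight turns `G_t` into a kernel with arbitrary polynomial decay. -/
lemma GControlled.scaledG_mul_le {ℓ : ℝ} {G w wstar : Sp d → ℝ} (hs : ∀ i, 1 ≤ s i)
    (hG : ∀ x, 0 ≤ G x) (h : GControlled s ℓ G w wstar) (N : ℝ) :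
    ∃ C : ℝ, 0 < C ∧ ∀ t : ℝ, 0 < t → t ≤ 2 → ∀ z,
      scaledG s ℓ G t z * wstar z ≤ C * bracket s ℓ N t z := by
  -- the controls with exponents `0` and `n` give the decay `(1 + ‖x‖)^{-n}` in the variable
  -- `x = t^{-s/ℓ} z`
  obtain ⟨n, hn⟩ := exists_nat_ge N
  obtain ⟨C₀, h₀⟩ := h.controlled 0 2 two_pos
  obtain ⟨C₁, h₁⟩ := h.controlled n 2 two_pos
  refine ⟨2 ^ n * (|C₀| + |C₁|) + 1, by positivity, fun t ht ht2 z => ?_⟩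
  set x : Sp d := fun i => t ^ (-(s i) / ℓ) * z i with hx
  have hd : dilate s ℓ t x = z := by
    funext i
    simp only [dilate, hx]
    rw [← mul_assoc, ← Real.rpow_add ht, ← add_div]
    simp
  have k0 := h₀ t ht ht2 x
  have k1 := h₁ t ht ht2 x
  rw [hd] at k0 k1
  have e := sNorm_dilate (ℓ := ℓ) hs ht z
  have hb := one_le_one_add s ℓ ht z
  unfold bracket scaledG
  rw [← e] at hb ⊢
  change 1 ≤ 1 + sNorm s x at hb
  change t ^ (-(∑ i, s i) / ℓ) * G x * wstar z ≤ _ * (t ^ (-(∑ i, s i) / ℓ) *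
    (1 + sNorm s x) ^ (-N))
  have hx0 := sNorm_nonneg s x
  have hWG : 0 ≤ wstar z * G x := mul_nonneg (zero_le_one.trans (h.one_le_star z)) (hG x)
  have key : (1 + sNorm s x) ^ N * (wstar z * G x) ≤ 2 ^ n * (|C₀| + |C₁|) + 1 := by
    have a1 : (1 + sNorm s x) ^ N ≤ 2 ^ n * (1 + sNorm s x ^ n) := by
      calc (1 + sNorm s x) ^ N ≤ (1 + sNorm s x) ^ (n : ℝ) :=
            Real.rpow_le_rpow_of_exponent_le hb hn
        _ = (1 + sNorm s x) ^ n := Real.rpow_natCast _ _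
        _ ≤ (2 * max 1 (sNorm s x)) ^ n := by
            gcongr
            have := le_max_left 1 (sNorm s x)
            have := le_max_right 1 (sNorm s x)
            linarith
        _ = 2 ^ n * (max 1 (sNorm s x)) ^ n := mul_pow _ _ _
        _ ≤ _ := by
            gcongr
            rcases le_total 1 (sNorm s x) with h | h
            · rw [max_eq_right h]; linarith
            · rw [max_eq_left h]; simp; positivity
    calc _ ≤ 2 ^ n * (1 + sNorm s x ^ n) * (wstar z * G x) := by gcongr
      _ = 2 ^ n * (sNorm s x ^ 0 * wstar z * G x + sNorm s x ^ n * wstar z * G x) := by ring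
      _ ≤ 2 ^ n * (|C₀| + |C₁|) := by
          gcongr
          · exact k0.trans (le_abs_self _)
          · exact k1.trans (le_abs_self _)
      _ ≤ _ := by linarith
  have hpos : 0 < (1 + sNorm s x) ^ N := by positivity
  rw [Real.rpow_neg (by linarith)]
  calc _ = t ^ (-(∑ i, s i) / ℓ) * (((1 + sNorm s x) ^ N * (wstar z * G x)) *
        ((1 + sNorm s x) ^ N)⁻¹) := by field_simp
    _ ≤ t ^ (-(∑ i, s i) / ℓ) * ((2 ^ n * (|C₀| + |C₁|) + 1) * ((1 + sNorm s x) ^ N)⁻¹) := by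
        gcongr
    _ = _ := by ring

/-- Moments of `G_t` against the control function of a weight. -/
lemma GControlled.lintegral_scaledG_le {ℓ : ℝ} {G w wstar : Sp d → ℝ}
    (hs : ∀ i, 1 ≤ s i) (hG : ∀ x, 0 ≤ G x) (h : GControlled s ℓ G w wstar) {ρ : ℝ} (hρ : 0 ≤ ρ) :
    ∃ C : ℝ, 0 < C ∧ ∀ t : ℝ, 0 < t → t ≤ 2 →
      ∫⁻ z, ENNReal.ofReal (scaledG s ℓ G t z) * ENNReal.ofReal (wstar z * sNorm s z ^ ρ) ≤
        ENNReal.ofReal (C * t ^ (ρ / ℓ)) := by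
  obtain ⟨C, hC, hk⟩ := h.scaledG_mul_le hs hG (decayExp s + ρ)
  refine ⟨C * Real.pi ^ d, by positivity, fun t ht ht2 => ?_⟩
  calc _ ≤ ∫⁻ z, ENNReal.ofReal (C * t ^ (ρ / ℓ)) *
        ENNReal.ofReal (bracket s ℓ (decayExp s) t z) := by
        refine lintegral_mono fun z => ?_
        rw [← ENNReal.ofReal_mul (scaledG_nonneg hG ht z), ← ENNReal.ofReal_mul (by positivity)]
        refine ENNReal.ofReal_le_ofReal ?_
        have hz := sNorm_nonneg s z
        calc scaledG s ℓ G t z * (wstar z * sNorm s z ^ ρ)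
            = (scaledG s ℓ G t z * wstar z) * sNorm s z ^ ρ := by ring
          _ ≤ C * bracket s ℓ (decayExp s + ρ) t z * sNorm s z ^ ρ := by
              exact mul_le_mul_of_nonneg_right (hk t ht ht2 z) (Real.rpow_nonneg hz _)
          _ = C * (bracket s ℓ (decayExp s + ρ) t z * sNorm s z ^ ρ) := by ring
          _ ≤ C * (t ^ (ρ / ℓ) * bracket s ℓ (decayExp s) t z) := by
              exact mul_le_mul_of_nonneg_left (bracket_mul_sNorm_le s ht hρ z) hC.le
          _ = _ := by ring
    _ = ENNReal.ofReal (C * t ^ (ρ / ℓ)) *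
        ∫⁻ z, ENNReal.ofReal (bracket s ℓ (decayExp s) t z) :=
        lintegral_const_mul' _ _ ENNReal.ofReal_ne_top
    _ ≤ ENNReal.ofReal (C * t ^ (ρ / ℓ)) * ENNReal.ofReal (Real.pi ^ d) := by
        gcongr; exact lintegral_bracket_le hs ℓ ht
    _ = _ := by
        rw [← ENNReal.ofReal_mul (by positivity)]; congr 1; ring

end Size

/-! ### Minkowski's integral inequality -/

section Minkowski

variable {α β : Type*} [MeasurableSpace α] [MeasurableSpace β] {μ : Measure α} {ν : Measure β}

/-- Jensen's inequality in the form needed for the proof of Minkowski's inequality. -/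
lemma eLpNorm_lintegral_le_of_forall [SFinite μ] [IsFiniteMeasure ν] {p : ℝ≥0∞} (hp : 1 ≤ p)
    {U : α → β → ℝ≥0∞} (hUm : Measurable (Function.uncurry U)) {K : ℝ≥0∞}
    (hU : ∀ᵐ h ∂ν, eLpNorm (fun x => U x h) p μ ≤ K) :
    eLpNorm (fun x => ∫⁻ h, U x h ∂ν) p μ ≤ K * ν univ := by
  rcases eq_or_ne p ∞ with rfl | hpt
  · rw [eLpNorm_exponent_top]
    have h1 : ∀ᵐ h ∂ν, ∀ᵐ x ∂μ, U x h ≤ K := by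
      filter_upwards [hU] with h hh
      filter_upwards [enorm_ae_le_eLpNormEssSup (fun x => U x h) μ] with x hx
      exact le_trans hx (by simpa [eLpNorm_exponent_top] using hh)
    have h2 : ∀ᵐ x ∂μ, ∀ᵐ h ∂ν, U x h ≤ K :=
      (Measure.ae_ae_comm (p := fun x h => U x h ≤ K)
        (measurableSet_le hUm measurable_const)).2 h1
    refine essSup_le_of_ae_le _ ?_
    filter_upwards [h2] with x hx
    calc (∫⁻ h, U x h ∂ν) ≤ ∫⁻ _, K ∂ν := lintegral_mono_ae hx
      _ = _ := lintegral_const _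
  have hp0 : p ≠ 0 := (zero_lt_one.trans_le hp).ne'
  set q := p.toReal with hq
  have hq1 : 1 ≤ q := by
    rw [hq, ← ENNReal.toReal_one]; exact ENNReal.toReal_mono hpt hp
  have hq0 : 0 < q := by linarith
  rw [eLpNorm_eq_lintegral_rpow_enorm_toReal hp0 hpt]
  rw [← hq]
  -- Jensen's inequality in `h`, followed by Tonelli's theorem
  have hm : ∀ x, (∫⁻ h, U x h ∂ν) ^ q ≤ ν univ ^ (q - 1) * ∫⁻ h, U x h ^ q ∂ν := by
    intro x
    have := eLpNorm'_le_eLpNorm'_mul_rpow_measure_univ (μ := ν) (f := fun h => U x h)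
      zero_lt_one hq1 (hUm.comp measurable_prodMk_left).aestronglyMeasurable
    simp only [eLpNorm'_eq_lintegral_enorm, enorm_eq_self, ENNReal.rpow_one, div_one] at this
    calc (∫⁻ h, U x h ∂ν) ^ q ≤ ((∫⁻ h, U x h ^ q ∂ν) ^ (1 / q) * ν univ ^ (1 - 1 / q)) ^ q := by
          gcongr
      _ = (∫⁻ h, U x h ^ q ∂ν) * ν univ ^ (q - 1) := by
          rw [ENNReal.mul_rpow_of_nonneg _ _ hq0.le, ← ENNReal.rpow_mul, ← ENNReal.rpow_mul]
          congr 1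
          · rw [one_div, inv_mul_cancel₀ hq0.ne', ENNReal.rpow_one]
          · congr 1; field_simp
      _ = _ := mul_comm _ _
  have hint : ∀ᵐ h ∂ν, ∫⁻ x, U x h ^ q ∂μ ≤ K ^ q := by
    filter_upwards [hU] with h hh
    rw [eLpNorm_eq_lintegral_rpow_enorm_toReal hp0 hpt, ← hq] at hh
    simp only [enorm_eq_self] at hh
    rw [one_div] at hh
    exact (ENNReal.rpow_inv_le_iff hq0).1 hh
  have hUq : Measurable (Function.uncurry fun x h => U x h ^ q) := hUm.pow_const q
  calc (∫⁻ x, ‖∫⁻ h, U x h ∂ν‖ₑ ^ q ∂μ) ^ (1 / q)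
      ≤ (∫⁻ x, ν univ ^ (q - 1) * ∫⁻ h, U x h ^ q ∂ν ∂μ) ^ (1 / q) := by
        gcongr with x
        simpa using hm x
    _ = (ν univ ^ (q - 1) * ∫⁻ h, ∫⁻ x, U x h ^ q ∂μ ∂ν) ^ (1 / q) := by
        rw [lintegral_const_mul (ν univ ^ (q - 1)) (f := fun x => ∫⁻ h, U x h ^ q ∂ν)
          hUq.lintegral_prod_right', lintegral_lintegral_swap hUq.aemeasurable]
    _ ≤ (ν univ ^ (q - 1) * ∫⁻ _, K ^ q ∂ν) ^ (1 / q) := by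
        gcongr 1
        gcongr 1
        exact lintegral_mono_ae hint
    _ = ((K * ν univ) ^ q) ^ (1 / q) := by
        rw [lintegral_const, ENNReal.mul_rpow_of_nonneg _ _ hq0.le]
        congr 1
        rw [mul_left_comm]
        congr 1
        nth_rewrite 2 [← ENNReal.rpow_one (ν univ)]
        rw [← ENNReal.rpow_add_of_nonneg _ _ (by linarith) zero_le_one]
        congr 1; ring
    _ = K * ν univ := by
        rw [← ENNReal.rpow_mul, mul_one_div_cancel hq0.ne', ENNReal.rpow_one]

/-- Minkowski's integral inequality: if `U(·,h)` has norm at most `K β(h)` for almost every `h`,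
then `∫ κ(h) U(·,h) dh` has norm at most `K ∫ κ β`. -/
lemma eLpNorm_lintegral_mul_le [SFinite μ] [SFinite ν] {p : ℝ≥0∞} (hp : 1 ≤ p)
    {κ b : β → ℝ≥0∞} (hκ : Measurable κ) (hb : Measurable b)
    (hb' : ∀ᵐ h ∂ν, b h ≠ ∞) (hfin : ∫⁻ h, κ h * b h ∂ν ≠ ∞)
    {U : α → β → ℝ≥0∞} (hUm : AEMeasurable (Function.uncurry U) (μ.prod ν)) {K : ℝ≥0∞}
    (hU : ∀ᵐ h ∂ν, eLpNorm (fun x => U x h) p μ ≤ K * b h) :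
    eLpNorm (fun x => ∫⁻ h, κ h * U x h ∂ν) p μ ≤ K * ∫⁻ h, κ h * b h ∂ν := by
  set U' : α → β → ℝ≥0∞ := fun x h => hUm.mk _ (x, h) with hU'
  have hU'm : Measurable (Function.uncurry U') := hUm.measurable_mk
  have hae : ∀ᵐ z ∂(μ.prod ν), U z.1 z.2 = U' z.1 z.2 := hUm.ae_eq_mk
  have hae1 : ∀ᵐ x ∂μ, ∀ᵐ h ∂ν, U x h = U' x h := Measure.ae_ae_of_ae_prod hae
  have hae2 : ∀ᵐ h ∂ν, ∀ᵐ x ∂μ, U x h = U' x h :=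
    Measure.ae_ae_of_ae_prod (μ := ν) (ν := μ) (p := fun z => U z.2 z.1 = U' z.2 z.1)
      (Measure.measurePreserving_swap.quasiMeasurePreserving.ae hae)
  -- after normalising `U` by `b` this is the case of the finite measure `κ b dν`
  set ν' := ν.withDensity (fun h => κ h * b h) with hν'
  have hν'u : ν' univ = ∫⁻ h, κ h * b h ∂ν := by
    rw [hν', withDensity_apply _ MeasurableSet.univ, setLIntegral_univ]
  have : IsFiniteMeasure ν' := ⟨by rw [hν'u]; exact hfin.lt_top⟩
  have hac : ν' ≪ ν := withDensity_absolutelyContinuous _ _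
  have hVm : Measurable (Function.uncurry fun x h => U' x h / b h) :=
    hU'm.div (hb.comp measurable_snd)
  -- where `b` vanishes, so does `U`
  have hzero : ∀ᵐ x ∂μ, ∀ᵐ h ∂ν, b h = 0 → U' x h = 0 := by
    have hset : MeasurableSet {z : α × β | b z.2 = 0 → U' z.1 z.2 = 0} := by
      simp only [imp_iff_not_or]
      exact (measurableSet_eq_fun (hb.comp measurable_snd) measurable_const).compl.union
        (measurableSet_eq_fun hU'm measurable_const)
    refine (Measure.ae_ae_comm (p := fun x h => b h = 0 → U' x h = 0) hset).2 ?_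
    filter_upwards [hU, hae2] with h hh hxe
    by_cases hbh : b h = 0
    · rw [hbh, mul_zero, eLpNorm_congr_ae hxe] at hh
      have h1 := (eLpNorm_eq_zero_iff (hU'm.comp measurable_prodMk_right).aestronglyMeasurable
        (zero_lt_one.trans_le hp).ne').1 (le_antisymm hh zero_le)
      filter_upwards [h1] with x hx _ using hx
    · exact ae_of_all _ fun x hx => absurd hx hbh
  have key := eLpNorm_lintegral_le_of_forall (μ := μ) (ν := ν') hp hVm (K := K) ?_
  · rw [hν'u] at key
    refine le_trans (le_of_eq (eLpNorm_congr_ae ?_)) key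
    filter_upwards [hae1, hzero] with x hx hx0
    have hVx : Measurable fun h => U' x h / b h := hVm.comp measurable_prodMk_left
    have e := lintegral_withDensity_eq_lintegral_mul ν (hκ.mul hb) hVx
    refine Eq.trans ?_ e.symm
    refine lintegral_congr_ae ?_
    filter_upwards [hx, hx0, hb'] with h hh hh0 hbh
    simp only [Pi.mul_apply, hh]
    by_cases hb0 : b h = 0
    · rw [hh0 hb0, hb0]; simp
    · rw [mul_assoc, ENNReal.mul_div_cancel hb0 hbh]
  · refine hac.ae_le ?_
    filter_upwards [hU, hae2] with h hh hxe
    rw [eLpNorm_congr_ae hxe] at hh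
    rcases eq_or_ne (b h) 0 with hb0 | hb0
    · have h1 := (eLpNorm_eq_zero_iff (hU'm.comp measurable_prodMk_right).aestronglyMeasurable
        (zero_lt_one.trans_le hp).ne').1 (le_antisymm (hh.trans_eq (by rw [hb0, mul_zero]))
        zero_le)
      have h2 : (fun x => U' x h / b h) =ᵐ[μ] fun _ => 0 := by
        filter_upwards [h1] with x hx
        have : U' x h = 0 := hx
        rw [this, ENNReal.zero_div]
      rw [eLpNorm_congr_ae h2]
      simp
    have hcinv : (b h)⁻¹ ≠ ∞ := ENNReal.inv_ne_top.2 hb0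
    lift (b h)⁻¹ to NNReal using hcinv with c hc
    have h3 : eLpNorm (fun x => U' x h / b h) p μ ≤ c • eLpNorm (fun x => U' x h) p μ := by
      refine eLpNorm_le_nnreal_smul_eLpNorm_of_ae_le_mul' (ae_of_all _ fun x => ?_) p
      simp only [enorm_eq_self, div_eq_mul_inv, ← hc]
      rw [mul_comm]
    refine h3.trans ?_
    rw [ENNReal.smul_def, hc, smul_eq_mul, mul_comm, ← div_eq_mul_inv]
    exact ENNReal.div_le_of_le_mul hh

end Minkowski

/-! ### Weighted norms -/

section WeightedNorm

variable {d : ℕ} {X : Type*} [NormedAddCommGroup X] [NormedSpace ℝ X] {w : Sp d → ℝ} {p : ℝ≥0∞}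

lemma wLp_congr_ae {f g : Sp d → X} (h : f =ᵐ[volume] g) : wLp w p f = wLp w p g := by
  refine eLpNorm_congr_ae ?_
  filter_upwards [h] with x hx
  rw [hx]

lemma wLp_add_le (hw : Measurable w) (hp : 1 ≤ p) {f g : Sp d → X}
    (hf : AEStronglyMeasurable f volume) (hg : AEStronglyMeasurable g volume) :
    wLp w p (fun x => f x + g x) ≤ wLp w p f + wLp w p g := by
  have h := eLpNorm_add_le (μ := volume) (f := fun x => w x • f x) (g := fun x => w x • g x)
    (hw.aestronglyMeasurable.smul hf) (hw.aestronglyMeasurable.smul hg) hp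
  refine le_trans (le_of_eq ?_) h
  unfold wLp
  congr 1
  funext x
  simp [smul_add]

lemma wLp_mono_ae {Y : Type*} [NormedAddCommGroup Y] [NormedSpace ℝ Y] {w' : Sp d → ℝ}
    {f : Sp d → X} {g : Sp d → Y} (h : ∀ᵐ x, ‖w x • f x‖ ≤ ‖w' x • g x‖) :
    wLp w p f ≤ wLp w' p g :=
  eLpNorm_mono_ae h

lemma wLp_neg (f : Sp d → X) : wLp w p (fun x => -f x) = wLp w p f := by
  refine le_antisymm (wLp_mono_ae (ae_of_all _ fun x => ?_)) (wLp_mono_ae (ae_of_all _ fun x => ?_))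
    <;> simp [norm_smul]

lemma wLp_sub_comm (f g : Sp d → X) :
    wLp w p (fun x => f x - g x) = wLp w p (fun x => g x - f x) := by
  rw [← wLp_neg]
  simp

lemma wLp_sub_le (hw : Measurable w) (hp : 1 ≤ p) {f g : Sp d → X}
    (hf : AEStronglyMeasurable f volume) (hg : AEStronglyMeasurable g volume) :
    wLp w p (fun x => f x - g x) ≤ wLp w p f + wLp w p g := by
  have := wLp_add_le hw hp hf hg.neg
  simp only [Pi.neg_apply, ← sub_eq_add_neg] at this
  exact this.trans_eq (by rw [← wLp_neg g]; rfl)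

lemma wLp_sub_le_add (hw : Measurable w) (hp : 1 ≤ p) {f g k : Sp d → X}
    (hf : AEStronglyMeasurable f volume) (hg : AEStronglyMeasurable g volume)
    (hk : AEStronglyMeasurable k volume) :
    wLp w p (fun x => f x - k x) ≤ wLp w p (fun x => f x - g x) + wLp w p (fun x => g x - k x) := by
  have := wLp_add_le hw hp (hf.sub hg) (hg.sub hk)
  simp only [Pi.sub_apply, sub_add_sub_cancel] at this
  exact this

lemma wLp_sum_le {ι : Type*} (hw : Measurable w) (hp : 1 ≤ p) (B : Finset ι) {f : ι → Sp d → X}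
    (hf : ∀ i ∈ B, AEStronglyMeasurable (f i) volume) :
    wLp w p (fun x => ∑ i ∈ B, f i x) ≤ ∑ i ∈ B, wLp w p (f i) := by
  have h := eLpNorm_sum_le (μ := volume) (p := p) (s := B) (f := fun i x => w x • f i x)
    (fun i hi => hw.aestronglyMeasurable.smul (hf i hi)) hp
  refine le_trans (le_of_eq ?_) h
  unfold wLp
  congr 1
  funext x
  simp [Finset.smul_sum]

lemma wLp_zero : wLp w p (fun _ : Sp d => (0 : X)) = 0 := by
  simp [wLp]

lemma ae_eq_of_wLp_sub_eq_zero (hw : Measurable w) (hw0 : ∀ x, 0 < w x) (hp : 1 ≤ p)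
    {f g : Sp d → X} (hf : AEStronglyMeasurable f volume) (hg : AEStronglyMeasurable g volume)
    (h : wLp w p (fun x => f x - g x) = 0) : f =ᵐ[volume] g := by
  have h1 := (eLpNorm_eq_zero_iff (hw.aestronglyMeasurable.smul (hf.sub hg))
    (zero_lt_one.trans_le hp).ne').1 h
  filter_upwards [h1] with x hx
  have : w x • (f x - g x) = 0 := hx
  exact sub_eq_zero.1 ((smul_eq_zero.1 this).resolve_left (hw0 x).ne')

lemma MemWLp.sub (hw : Measurable w) (hp : 1 ≤ p) {f g : Sp d → ℝ} (hf : MemWLp w p f)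
    (hg : MemWLp w p g) : MemWLp w p (fun x => f x - g x) :=
  ⟨hf.1.sub hg.1, (wLp_sub_le hw hp hf.1 hg.1).trans_lt (ENNReal.add_lt_top.2 ⟨hf.2, hg.2⟩)⟩

end WeightedNorm

/-! ### The semigroup on weighted spaces -/

section Semigroup

variable {d : ℕ} {s : Fin d → ℝ} {ℓ : ℝ} {G : Sp d → ℝ} {Q : ℝ → Sp d → Sp d → ℝ}
  {W Wstar : Sp d → ℝ} {p : ℝ≥0∞}

lemma GControlled.measurable_weight (hW : GControlled s ℓ G W Wstar) : Measurable W :=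
  hW.continuous_weight.measurable

lemma GControlled.weight_le (hW : GControlled s ℓ G W Wstar) (x y : Sp d) :
    W x ≤ Wstar (x - y) * W y := by
  simpa using hW.moderate (x - y) y

/-- An integral operator whose kernel is dominated, up to the control function, by a convolution
kernel `κ` is bounded on the weighted space. -/
lemma wLp_integral_le (hW : GControlled s ℓ G W Wstar) (hp : 1 ≤ p) {q : Sp d → Sp d → ℝ}
    {κ : Sp d → ℝ} (hκ : Measurable κ) (hq : ∀ x y, |q x y| * Wstar (x - y) ≤ κ (x - y))
    (hfin : ∫⁻ z, ENNReal.ofReal (κ z) ≠ ∞) {f : Sp d → ℝ} (hf : AEStronglyMeasurable f volume) :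
    wLp W p (fun x => ∫ y, q x y * f y) ≤ (∫⁻ z, ENNReal.ofReal (κ z)) * wLp W p f := by
  set g : Sp d → ℝ := fun y => W y * f y with hg
  have hgm : AEStronglyMeasurable g volume := hW.continuous_weight.aestronglyMeasurable.mul hf
  have hκ' : Measurable fun z => ENNReal.ofReal (κ z) := hκ.ennreal_ofReal
  have hUm : AEMeasurable (Function.uncurry fun (x h : Sp d) => ‖g (x - h)‖ₑ)
      (volume.prod volume) := by
    have h1 : AEStronglyMeasurable (fun z : Sp d × Sp d => g (z.1 - z.2))
        (volume.prod volume) :=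
      hgm.comp_quasiMeasurePreserving
        (quasiMeasurePreserving_sub_of_right_invariant volume volume)
    exact h1.aemeasurable.enorm
  have hU : ∀ h : Sp d, eLpNorm (fun x => ‖g (x - h)‖ₑ) p volume = wLp W p f := fun h => by
    have e := eLpNorm_comp_measurePreserving (p := p) hgm
      (measurePreserving_sub_right (volume : Measure (Sp d)) h)
    have e' : eLpNorm (fun x => ‖g (x - h)‖ₑ) p volume = eLpNorm (g ∘ fun x => x - h) p volume :=
      eLpNorm_enorm (g ∘ fun x => x - h)
    rw [e', e]
    rfl
  have key := eLpNorm_lintegral_mul_le (μ := (volume : Measure (Sp d)))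
    (ν := (volume : Measure (Sp d))) hp hκ' (b := fun _ => 1) measurable_const
    (ae_of_all _ fun _ => ENNReal.one_ne_top) (by simpa using hfin) hUm
    (K := wLp W p f) (ae_of_all _ fun h => by rw [hU, mul_one])
  simp only [mul_one] at key
  rw [mul_comm]
  refine le_trans ?_ key
  refine eLpNorm_mono_enorm fun x => ?_
  rw [enorm_eq_self]
  calc ‖W x • ∫ y, q x y * f y‖ₑ = ‖∫ y, W x * (q x y * f y)‖ₑ := by
        rw [integral_const_mul, smul_eq_mul]
    _ ≤ ∫⁻ y, ‖W x * (q x y * f y)‖ₑ := enorm_integral_le_lintegral_enorm _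
    _ ≤ ∫⁻ y, ENNReal.ofReal (κ (x - y)) * ‖g y‖ₑ := by
        refine lintegral_mono fun y => ?_
        rw [← ofReal_norm, ← ofReal_norm, ← ENNReal.ofReal_mul'
          (norm_nonneg _)]
        refine ENNReal.ofReal_le_ofReal ?_
        rw [hg, norm_mul, norm_mul, norm_mul, Real.norm_of_nonneg (hW.weight_pos x).le,
          Real.norm_of_nonneg (hW.weight_pos y).le]
        have h1 := hW.weight_le x y
        have h2 := hq x y
        have h3 := hW.weight_pos y
        rw [Real.norm_eq_abs (q x y)]
        calc W x * (|q x y| * ‖f y‖) ≤ (Wstar (x - y) * W y) * (|q x y| * ‖f y‖) := by gcongr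
          _ = (|q x y| * Wstar (x - y)) * (W y * ‖f y‖) := by ring
          _ ≤ _ := by gcongr
    _ = ∫⁻ h, ENNReal.ofReal (κ h) * ‖g (x - h)‖ₑ := by
        rw [← lintegral_sub_left_eq_self _ x]
        simp

lemma kernel_bound (hs : ∀ i, 1 ≤ s i) (hG : ∀ x, 0 ≤ G x) (hQ : IsGTypeSemigroup s ℓ G Q)
    (hW : GControlled s ℓ G W Wstar) (N : ℝ) :
    ∃ C : ℝ, 0 < C ∧ ∀ t : ℝ, 0 < t → t ≤ 2 → ∀ x y,
      |Q t x y| * Wstar (x - y) ≤ C * bracket s ℓ N t (x - y) := by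
  obtain ⟨C, hC, h⟩ := hW.scaledG_mul_le hs hG N
  obtain ⟨C', hC', h'⟩ := hQ.upper
  refine ⟨C' * C, by positivity, fun t ht ht2 x y => ?_⟩
  have h0 := zero_le_one.trans (hW.one_le_star (x - y))
  calc |Q t x y| * Wstar (x - y) ≤ C' * scaledG s ℓ G t (x - y) * Wstar (x - y) :=
        mul_le_mul_of_nonneg_right (h' t ht x y) h0
    _ = C' * (scaledG s ℓ G t (x - y) * Wstar (x - y)) := by ring
    _ ≤ C' * (C * bracket s ℓ N t (x - y)) :=
        mul_le_mul_of_nonneg_left (h t ht ht2 _) hC'.le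
    _ = _ := by ring

/-- The rescaled profiles at comparable times are comparable. -/
lemma bracket_le_bracket (hs : ∀ i, 1 ≤ s i) (hℓ : 0 < ℓ) {N : ℝ} (hN : 0 ≤ N) {t u : ℝ}
    (ht : 0 < t) (htu : t ≤ u) (hut : u ≤ 2 * t) (z : Sp d) :
    bracket s ℓ N u z ≤ 2 ^ (N / ℓ) * bracket s ℓ N t z := by
  have hu : 0 < u := ht.trans_le htu
  have hz := sNorm_nonneg s z
  have hS : 0 ≤ ∑ i, s i := Finset.sum_nonneg fun i _ => by linarith [hs i]
  have hbt := one_le_one_add s ℓ ht z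
  have hbu := one_le_one_add s ℓ hu z
  unfold bracket
  have h1 : u ^ (-(∑ i, s i) / ℓ) ≤ t ^ (-(∑ i, s i) / ℓ) :=
    Real.rpow_le_rpow_of_nonpos ht htu (div_nonpos_of_nonpos_of_nonneg (by linarith) hℓ.le)
  have h2 : t ^ (-1 / ℓ) ≤ 2 ^ (1 / ℓ) * u ^ (-1 / ℓ) := by
    have e : (2 : ℝ) ^ (1 / ℓ) * (2 * t) ^ (-1 / ℓ) = t ^ (-1 / ℓ) := by
      rw [Real.mul_rpow two_pos.le ht.le, ← mul_assoc, ← Real.rpow_add two_pos, ← add_div]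
      simp
    rw [← e]
    gcongr 1
    exact Real.rpow_le_rpow_of_nonpos hu hut
      (div_nonpos_of_nonpos_of_nonneg (by linarith) hℓ.le)
  have h21 : (1 : ℝ) ≤ 2 ^ (1 / ℓ) := Real.one_le_rpow one_le_two (by positivity)
  have h3 : 1 + t ^ (-1 / ℓ) * sNorm s z ≤ 2 ^ (1 / ℓ) * (1 + u ^ (-1 / ℓ) * sNorm s z) := by
    calc 1 + t ^ (-1 / ℓ) * sNorm s z ≤ 2 ^ (1 / ℓ) + 2 ^ (1 / ℓ) * u ^ (-1 / ℓ) * sNorm s z := by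
          gcongr
      _ = _ := by ring
  have h4 : (1 + u ^ (-1 / ℓ) * sNorm s z) ^ (-N) ≤
      2 ^ (N / ℓ) * (1 + t ^ (-1 / ℓ) * sNorm s z) ^ (-N) := by
    have := Real.rpow_le_rpow_of_nonpos (by linarith) h3 (neg_nonpos.2 hN)
    rw [Real.mul_rpow (by positivity) (by linarith), ← Real.rpow_mul two_pos.le] at this
    calc (1 + u ^ (-1 / ℓ) * sNorm s z) ^ (-N)
        = 2 ^ (N / ℓ) * (2 ^ (1 / ℓ * -N) * (1 + u ^ (-1 / ℓ) * sNorm s z) ^ (-N)) := by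
          rw [← mul_assoc, ← Real.rpow_add two_pos]
          rw [show N / ℓ + 1 / ℓ * -N = 0 by ring, Real.rpow_zero, one_mul]
      _ ≤ _ := by gcongr
  calc _ ≤ t ^ (-(∑ i, s i) / ℓ) * (2 ^ (N / ℓ) * (1 + t ^ (-1 / ℓ) * sNorm s z) ^ (-N)) := by
        gcongr
    _ = _ := by ring

/-- Time regularity of the kernel, from the bound on its time derivative. -/
lemma kernel_sub_bound (hs : ∀ i, 1 ≤ s i) (hℓ : 0 < ℓ) (hG : ∀ x, 0 ≤ G x)
    (hQ : IsGTypeSemigroup s ℓ G Q) (hW : GControlled s ℓ G W Wstar) {N : ℝ} (hN : 0 ≤ N) :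
    ∃ C : ℝ, 0 < C ∧ ∀ t u : ℝ, 0 < t → 0 ≤ u → u ≤ t → t + u ≤ 2 → ∀ x y,
      |Q (t + u) x y - Q t x y| * Wstar (x - y) ≤ C * (u / t) * bracket s ℓ N t (x - y) := by
  obtain ⟨C, hC, h⟩ := hW.scaledG_mul_le hs hG N
  obtain ⟨C', hC', h'⟩ := hQ.time_derivative
  refine ⟨C' * C * 2 ^ (N / ℓ), by positivity, fun t u ht hu hut htu x y => ?_⟩
  have hW1 := hW.one_le_star (x - y)
  have hb := bracket_nonneg s ℓ N ht (x - y)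
  have hder : ∀ r ∈ Icc t (t + u), ‖deriv (fun t' => Q t' x y) r‖ ≤
      C' * C * 2 ^ (N / ℓ) * t⁻¹ * bracket s ℓ N t (x - y) / Wstar (x - y) := by
    intro r hr
    have hr0 : 0 < r := ht.trans_le hr.1
    rw [Real.norm_eq_abs, le_div_iff₀ (by linarith)]
    calc _ ≤ C' * r⁻¹ * scaledG s ℓ G r (x - y) * Wstar (x - y) := by
          gcongr; exact (h' r hr0 x y).2
      _ = C' * r⁻¹ * (scaledG s ℓ G r (x - y) * Wstar (x - y)) := by ring
      _ ≤ C' * t⁻¹ * (C * (2 ^ (N / ℓ) * bracket s ℓ N t (x - y))) := by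
          have h1 : r⁻¹ ≤ t⁻¹ := inv_anti₀ ht hr.1
          have h2 := h r hr0 (hr.2.trans htu) (x - y)
          have h3 := bracket_le_bracket hs hℓ hN ht hr.1 (by linarith [hr.2]) (x - y)
          have h4 := scaledG_nonneg (s := s) (ℓ := ℓ) hG hr0 (x - y)
          refine mul_le_mul (by gcongr) (h2.trans (by gcongr)) (by positivity) (by positivity)
      _ = _ := by ring
  -- mean value inequality in time
  have mv := (convex_Icc t (t + u)).norm_image_sub_le_of_norm_deriv_le
    (f := fun t' => Q t' x y) (fun r hr => (h' r (ht.trans_le hr.1) x y).1) hder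
    (left_mem_Icc.2 (by linarith)) (right_mem_Icc.2 (by linarith))
  rw [Real.norm_eq_abs, add_sub_cancel_left, Real.norm_of_nonneg hu] at mv
  calc _ ≤ (C' * C * 2 ^ (N / ℓ) * t⁻¹ * bracket s ℓ N t (x - y) / Wstar (x - y) * u) *
        Wstar (x - y) := by gcongr
    _ = _ := by field_simp

lemma lintegral_const_mul_bracket_le (hs : ∀ i, 1 ≤ s i) {t : ℝ} (ht : 0 < t) {C : ℝ}
    (hC : 0 ≤ C) :
    ∫⁻ z, ENNReal.ofReal (C * bracket s ℓ (decayExp s) t z) ≤ ENNReal.ofReal (C * Real.pi ^ d) := by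
  simp_rw [ENNReal.ofReal_mul hC]
  rw [lintegral_const_mul' _ _ ENNReal.ofReal_ne_top]
  gcongr
  exact lintegral_bracket_le hs ℓ ht

/-- The operators `Q_t` are uniformly bounded on weighted spaces. -/
lemma wLp_applyQ_le (hs : ∀ i, 1 ≤ s i) (hG : ∀ x, 0 ≤ G x) (hQ : IsGTypeSemigroup s ℓ G Q)
    (hW : GControlled s ℓ G W Wstar) :
    ∃ C : ℝ, 0 < C ∧ ∀ (p : ℝ≥0∞), 1 ≤ p → ∀ t : ℝ, 0 < t → t ≤ 2 → ∀ f : Sp d → ℝ,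
      AEStronglyMeasurable f volume →
        wLp W p (fun x => ∫ y, |Q t x y| * f y) ≤ ENNReal.ofReal C * wLp W p f ∧
        wLp W p (applyQ Q t f) ≤ ENNReal.ofReal C * wLp W p f := by
  obtain ⟨C, hC, h⟩ := kernel_bound hs hG hQ hW (decayExp s)
  refine ⟨C * Real.pi ^ d, by positivity, fun p hp t ht ht2 f hf => ?_⟩
  have hκ := ((continuous_bracket hs ℓ (decayExp s) ht).const_mul C).measurable
  have hle := lintegral_const_mul_bracket_le (ℓ := ℓ) hs ht hC.le
  have hfin := (hle.trans_lt ENNReal.ofReal_lt_top).ne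
  constructor
  · refine (wLp_integral_le hW hp hκ (fun x y => ?_) hfin hf).trans (by gcongr)
    rw [abs_abs]; exact h t ht ht2 x y
  · exact (wLp_integral_le hW hp hκ (fun x y => h t ht ht2 x y) hfin hf).trans (by gcongr)

/-- Pointwise domination of the kernel, which gives a meaning to `Q_t f` at every point. -/
lemma kernel_dominated (hs : ∀ i, 1 ≤ s i) (hG : ∀ x, 0 ≤ G x) (hQ : IsGTypeSemigroup s ℓ G Q)
    (hW : GControlled s ℓ G W Wstar) {t : ℝ} (ht : 0 < t) (ht2 : t ≤ 2) :
    ∃ B : Sp d → ℝ, Continuous B ∧ ∀ x y,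
      |Q t x y| ≤ B x * (bracket s ℓ (decayExp s) 1 y * W y) := by
  obtain ⟨C, hC, h⟩ := kernel_bound hs hG hQ hW (decayExp s)
  have hN := decayExp_nonneg hs
  set N := decayExp s with hNdef
  set m : ℝ := min 1 (t ^ (-1 / ℓ)) with hm
  have hm0 : 0 < m := lt_min one_pos (Real.rpow_pos_of_pos ht _)
  refine ⟨fun x => (W x)⁻¹ * (C * t ^ (-(∑ i, s i) / ℓ) * m ^ (-N) * (1 + sNorm s x) ^ N),
    ?_, fun x y => ?_⟩
  · refine (hW.continuous_weight.inv₀ fun x => (hW.weight_pos x).ne').mul (continuous_const.mul ?_)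
    exact (continuous_const.add (continuous_sNorm hs)).rpow_const fun x => Or.inr hN
  have hx0 := sNorm_nonneg s x
  have hy0 := sNorm_nonneg s y
  have hz0 := sNorm_nonneg s (x - y)
  have h1 : 1 + sNorm s y ≤ (1 + sNorm s x) * (1 + sNorm s (x - y)) := by
    have := sNorm_add_le hs x (-(x - y))
    rw [sNorm_neg] at this
    have e : x + -(x - y) = y := by abel
    rw [e] at this
    nlinarith
  have h2 : m * (1 + sNorm s (x - y)) ≤ 1 + t ^ (-1 / ℓ) * sNorm s (x - y) := by
    have a1 : m ≤ 1 := min_le_left _ _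
    have a2 : m ≤ t ^ (-1 / ℓ) := min_le_right _ _
    nlinarith
  have h3 : (1 + t ^ (-1 / ℓ) * sNorm s (x - y)) ^ (-N) ≤
      m ^ (-N) * (1 + sNorm s x) ^ N * (1 + sNorm s y) ^ (-N) := by
    have hpos : 0 < (1 + sNorm s x) := by linarith
    have h4 : m * ((1 + sNorm s x)⁻¹ * (1 + sNorm s y)) ≤
        1 + t ^ (-1 / ℓ) * sNorm s (x - y) := by
      refine le_trans ?_ h2
      gcongr
      rw [inv_mul_le_iff₀ hpos]; exact h1
    refine (Real.rpow_le_rpow_of_nonpos (by positivity) h4 (neg_nonpos.2 hN)).trans (le_of_eq ?_)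
    rw [Real.mul_rpow hm0.le (by positivity), Real.mul_rpow (by positivity) (by positivity),
      Real.inv_rpow hpos.le, Real.rpow_neg hpos.le, inv_inv]
    ring
  have hb1 : bracket s ℓ N 1 y = (1 + sNorm s y) ^ (-N) := by simp [bracket]
  rw [hb1]
  have hk := h t ht ht2 x y
  have hWx := hW.weight_pos x
  have hWy := hW.weight_pos y
  have hxy := hW.weight_le x y
  have htS := Real.rpow_pos_of_pos ht (-(∑ i, s i) / ℓ)
  calc |Q t x y| = (W x)⁻¹ * (W x * |Q t x y|) := by field_simp
    _ ≤ (W x)⁻¹ * ((Wstar (x - y) * W y) * |Q t x y|) := by gcongr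
    _ = (W x)⁻¹ * ((|Q t x y| * Wstar (x - y)) * W y) := by ring
    _ ≤ (W x)⁻¹ * ((C * (t ^ (-(∑ i, s i) / ℓ) *
          (m ^ (-N) * (1 + sNorm s x) ^ N * (1 + sNorm s y) ^ (-N)))) * W y) := by
        refine mul_le_mul_of_nonneg_left (mul_le_mul_of_nonneg_right (hk.trans ?_) hWy.le)
          (inv_pos.2 hWx).le
        unfold bracket
        gcongr
    _ = _ := by ring

/-- Functions in a weighted space are integrable against the polynomial profile. -/
lemma MemWLp.integrable_bracket (hs : ∀ i, 1 ≤ s i) (hW : GControlled s ℓ G W Wstar)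
    (hp : 1 ≤ p) {f : Sp d → ℝ} (hf : MemWLp W p f) :
    Integrable (fun y => bracket s ℓ (decayExp s) 1 y * W y * f y) := by
  have hb := RegInt.integrable_bracket hs ℓ one_pos
  have hbc := continuous_bracket hs ℓ (decayExp s) one_pos
  have hgm : AEStronglyMeasurable (fun y => W y * f y) volume :=
    hW.continuous_weight.aestronglyMeasurable.mul hf.1
  have hm : AEStronglyMeasurable (fun y => bracket s ℓ (decayExp s) 1 y * W y * f y) volume :=
    (hbc.mul hW.continuous_weight).aestronglyMeasurable.mul hf.1
  have hb1 : ∀ y, bracket s ℓ (decayExp s) 1 y ≤ 1 := fun y => by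
    simp only [bracket, Real.one_rpow, one_mul]
    exact Real.rpow_le_one_of_one_le_of_nonpos (by linarith [sNorm_nonneg s y])
      (neg_nonpos.2 (decayExp_nonneg hs))
  have hb0 := fun y => bracket_nonneg s ℓ (decayExp s) one_pos y
  have hL : MemLp (fun y => W y * f y) p volume := ⟨hgm, hf.2⟩
  -- for `p < ∞` use `r ≤ 1 + r ^ p` for `r = |W f|`, the profile being bounded and integrable
  rcases eq_or_ne p ∞ with rfl | hpt
  · have h1 : ∀ᵐ y, ‖W y * f y‖ ≤ (eLpNormEssSup (fun y => W y * f y) volume).toReal := by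
      have hfin : eLpNormEssSup (fun y => W y * f y) volume ≠ ∞ := by
        have := hL.2.ne; rwa [eLpNorm_exponent_top] at this
      filter_upwards [enorm_ae_le_eLpNormEssSup (fun y => W y * f y) volume] with y hy
      rw [← toReal_enorm]
      exact ENNReal.toReal_mono hfin hy
    refine (hb.mul_const (eLpNormEssSup (fun y => W y * f y) volume).toReal).mono' hm ?_
    filter_upwards [h1] with y hy
    rw [mul_assoc, norm_mul, Real.norm_of_nonneg (hb0 y)]
    exact mul_le_mul_of_nonneg_left hy (hb0 y)
  · have hp0 : p ≠ 0 := (zero_lt_one.trans_le hp).ne'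
    have h1 := hL.integrable_norm_rpow hp0 hpt
    have hq1 : 1 ≤ p.toReal := by
      rw [← ENNReal.toReal_one]; exact ENNReal.toReal_mono hpt hp
    refine (hb.add h1).mono' hm (ae_of_all _ fun y => ?_)
    rw [mul_assoc, norm_mul, Real.norm_of_nonneg (hb0 y), Pi.add_apply]
    rcases le_total ‖W y * f y‖ 1 with h | h
    · have := mul_le_mul_of_nonneg_left h (hb0 y)
      have h2 : 0 ≤ ‖W y * f y‖ ^ p.toReal := by positivity
      linarith
    · have h2 : ‖W y * f y‖ ≤ ‖W y * f y‖ ^ p.toReal := by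
        simpa using Real.rpow_le_rpow_of_exponent_le h hq1
      have := mul_le_mul_of_nonneg_right (hb1 y) (norm_nonneg (W y * f y))
      linarith [hb0 y]

lemma integrable_kernel_mul (hs : ∀ i, 1 ≤ s i) (hG : ∀ x, 0 ≤ G x)
    (hQ : IsGTypeSemigroup s ℓ G Q) (hW : GControlled s ℓ G W Wstar) (hp : 1 ≤ p)
    {f : Sp d → ℝ} (hf : MemWLp W p f) {t : ℝ} (ht : 0 < t) (ht2 : t ≤ 2) (x : Sp d) :
    Integrable (fun y => Q t x y * f y) := by
  obtain ⟨B, -, hB⟩ := kernel_dominated hs hG hQ hW ht ht2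
  refine ((hf.integrable_bracket hs hW hp).norm.const_mul (B x)).mono' ?_
    (ae_of_all _ fun y => ?_)
  · exact ((hQ.continuous_kernel t ht).comp (Continuous.prodMk_right x)).aestronglyMeasurable.mul
      hf.1
  · rw [norm_mul, norm_mul, ← mul_assoc, Real.norm_of_nonneg (mul_nonneg
      (bracket_nonneg s ℓ _ one_pos y) (hW.weight_pos y).le), Real.norm_eq_abs (Q t x y)]
    exact mul_le_mul_of_nonneg_right (hB x y) (norm_nonneg _)

lemma continuous_applyQ (hs : ∀ i, 1 ≤ s i) (hG : ∀ x, 0 ≤ G x)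
    (hQ : IsGTypeSemigroup s ℓ G Q) (hW : GControlled s ℓ G W Wstar) (hp : 1 ≤ p)
    {f : Sp d → ℝ} (hf : MemWLp W p f) {t : ℝ} (ht : 0 < t) (ht2 : t ≤ 2) :
    Continuous (applyQ Q t f) := by
  obtain ⟨B, hBc, hB⟩ := kernel_dominated hs hG hQ hW ht ht2
  refine continuous_iff_continuousAt.2 fun x₀ => ?_
  refine continuousAt_of_dominated (bound := fun y => (B x₀ + 1) *
    ‖bracket s ℓ (decayExp s) 1 y * W y * f y‖) (Eventually.of_forall fun x => ?_) ?_
    ((hf.integrable_bracket hs hW hp).norm.const_mul _) (ae_of_all _ fun y => ?_)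
  · exact (integrable_kernel_mul hs hG hQ hW hp hf ht ht2 x).1
  · have : ∀ᶠ x in 𝓝 x₀, B x < B x₀ + 1 :=
      hBc.continuousAt.eventually_lt continuousAt_const (by linarith)
    filter_upwards [this] with x hx
    refine ae_of_all _ fun y => ?_
    have h0 := mul_nonneg (bracket_nonneg s ℓ (decayExp s) one_pos y) (hW.weight_pos y).le
    rw [norm_mul, norm_mul, ← mul_assoc, Real.norm_of_nonneg h0, Real.norm_eq_abs (Q t x y)]
    refine mul_le_mul_of_nonneg_right ((hB x y).trans ?_) (norm_nonneg _)
    exact mul_le_mul_of_nonneg_right hx.le h0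
  · exact (((hQ.continuous_kernel t ht).comp (Continuous.prodMk_left y)).mul
      continuous_const).continuousAt

lemma MemWLp.applyQ (hs : ∀ i, 1 ≤ s i) (hG : ∀ x, 0 ≤ G x)
    (hQ : IsGTypeSemigroup s ℓ G Q) (hW : GControlled s ℓ G W Wstar) (hp : 1 ≤ p)
    {f : Sp d → ℝ} (hf : MemWLp W p f) {t : ℝ} (ht : 0 < t) (ht2 : t ≤ 2) :
    MemWLp W p (applyQ Q t f) := by
  obtain ⟨C, hC, h⟩ := wLp_applyQ_le hs hG hQ hW
  exact ⟨(continuous_applyQ hs hG hQ hW hp hf ht ht2).aestronglyMeasurable,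
    (h p hp t ht ht2 f hf.1).2.trans_lt (ENNReal.mul_lt_top ENNReal.ofReal_lt_top hf.2)⟩

/-- The semigroup property on weighted spaces. -/
lemma applyQ_applyQ (hs : ∀ i, 1 ≤ s i) (hG : ∀ x, 0 ≤ G x)
    (hQ : IsGTypeSemigroup s ℓ G Q) (hW : GControlled s ℓ G W Wstar) (hp : 1 ≤ p)
    {f : Sp d → ℝ} (hf : MemWLp W p f) {t u : ℝ} (ht : 0 < t) (hu : 0 < u) (htu : t + u ≤ 2) :
    applyQ Q t (applyQ Q u f) = applyQ Q (t + u) f := by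
  funext x
  obtain ⟨C, hC, hop⟩ := wLp_applyQ_le hs hG hQ hW
  -- Fubini's theorem applies since `|Q_u| |f|` is integrated to a function in the weighted space
  have hfn : MemWLp W p (fun y => |f y|) := by
    refine ⟨hf.1.norm, lt_of_eq_of_lt ?_ hf.2⟩
    refine le_antisymm (wLp_mono_ae (ae_of_all _ fun x => ?_))
      (wLp_mono_ae (ae_of_all _ fun x => ?_)) <;> simp
  have hQm : Measurable (fun z : Sp d × Sp d => Q u z.1 z.2) :=
    (hQ.continuous_kernel u hu).measurable
  have habs : MemWLp W p (fun z => ∫ y, |Q u z y| * |f y|) := by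
    refine ⟨?_, (hop p hp u hu (by linarith) _ hfn.1).1.trans_lt
      (ENNReal.mul_lt_top ENNReal.ofReal_lt_top hfn.2)⟩
    have : AEStronglyMeasurable (fun z : Sp d × Sp d => |Q u z.1 z.2| * |f z.2|)
        (volume.prod volume) :=
      hQm.aestronglyMeasurable.norm.mul hfn.1.comp_snd
    exact this.integral_prod_right'
  have hint : Integrable (fun z : Sp d × Sp d => Q t x z.1 * (Q u z.1 z.2 * f z.2))
      (volume.prod volume) := by
    have hm : AEStronglyMeasurable (fun z : Sp d × Sp d => Q t x z.1 * (Q u z.1 z.2 * f z.2))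
        (volume.prod volume) :=
      ((hQ.continuous_kernel t ht).comp
        ((Continuous.prodMk_right x).comp continuous_fst)).aestronglyMeasurable.mul
        (hQm.aestronglyMeasurable.mul hf.1.comp_snd)
    refine (integrable_prod_iff hm).2 ⟨ae_of_all _ fun z => ?_, ?_⟩
    · exact (integrable_kernel_mul hs hG hQ hW hp hf hu (by linarith) z).const_mul (Q t x z)
    · have := (integrable_kernel_mul hs hG hQ hW hp habs ht (by linarith) x).norm
      refine this.congr (ae_of_all _ fun z => ?_)
      simp only [norm_mul, Real.norm_eq_abs]
      rw [integral_const_mul, abs_of_nonneg (a := ∫ y, |Q u z y| * |f y|)]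
      exact integral_nonneg fun y => by positivity
  calc applyQ Q t (applyQ Q u f) x = ∫ z, ∫ y, Q t x z * (Q u z y * f y) := by
        simp only [applyQ, integral_const_mul]
    _ = ∫ y, ∫ z, Q t x z * (Q u z y * f y) := integral_integral_swap hint
    _ = ∫ y, Q (t + u) x y * f y := by
        refine integral_congr_ae (ae_of_all _ fun y => ?_)
        have := hQ.semigroup u (t + u) hu (by linarith) x y
        rw [add_sub_cancel_right] at this
        simp only [← mul_assoc]
        rw [integral_mul_const, this]

lemma applyQ_congr_ae {t : ℝ} {f g : Sp d → ℝ} (h : f =ᵐ[volume] g) :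
    applyQ Q t f = applyQ Q t g := by
  funext x
  refine integral_congr_ae ?_
  filter_upwards [h] with y hy
  rw [hy]

lemma applyQ_sub (hs : ∀ i, 1 ≤ s i) (hG : ∀ x, 0 ≤ G x)
    (hQ : IsGTypeSemigroup s ℓ G Q) (hW : GControlled s ℓ G W Wstar) (hp : 1 ≤ p)
    {f g : Sp d → ℝ} (hf : MemWLp W p f) (hg : MemWLp W p g) {t : ℝ} (ht : 0 < t) (ht2 : t ≤ 2) :
    applyQ Q t (fun x => f x - g x) = fun x => applyQ Q t f x - applyQ Q t g x := by
  funext x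
  simp only [applyQ, mul_sub]
  exact integral_sub (integrable_kernel_mul hs hG hQ hW hp hf ht ht2 x)
    (integrable_kernel_mul hs hG hQ hW hp hg ht ht2 x)

/-- Time regularity of the semigroup on weighted spaces. -/
lemma wLp_applyQ_sub_le (hs : ∀ i, 1 ≤ s i) (hℓ : 0 < ℓ) (hG : ∀ x, 0 ≤ G x)
    (hQ : IsGTypeSemigroup s ℓ G Q) (hW : GControlled s ℓ G W Wstar) :
    ∃ C : ℝ, 0 < C ∧ ∀ (p : ℝ≥0∞), 1 ≤ p → ∀ t u : ℝ, 0 < t → 0 ≤ u → u ≤ t → t + u ≤ 2 →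
      ∀ f : Sp d → ℝ, MemWLp W p f →
        wLp W p (fun x => applyQ Q (t + u) f x - applyQ Q t f x) ≤
          ENNReal.ofReal (C * (u / t)) * wLp W p f := by
  obtain ⟨C, hC, h⟩ := kernel_sub_bound hs hℓ hG hQ hW (decayExp_nonneg hs)
  refine ⟨C * Real.pi ^ d, by positivity, fun p hp t u ht hu hut htu f hf => ?_⟩
  have hκ := ((continuous_bracket hs ℓ (decayExp s) ht).const_mul (C * (u / t))).measurable
  have hle := lintegral_const_mul_bracket_le (ℓ := ℓ) hs ht (C := C * (u / t)) (by positivity)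
  have hfin := (hle.trans_lt ENNReal.ofReal_lt_top).ne
  have key := wLp_integral_le hW hp hκ (q := fun x y => Q (t + u) x y - Q t x y)
    (fun x y => h t u ht hu hut htu x y) hfin hf.1
  have e : (fun x => applyQ Q (t + u) f x - applyQ Q t f x) =
      fun x => ∫ y, (Q (t + u) x y - Q t x y) * f y := by
    funext x
    simp only [applyQ, sub_mul]
    exact (integral_sub (integrable_kernel_mul hs hG hQ hW hp hf (by linarith) htu x)
      (integrable_kernel_mul hs hG hQ hW hp hf ht (by linarith) x)).symm
  rw [e]
  refine key.trans ?_
  gcongr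
  refine hle.trans (le_of_eq ?_)
  congr 1
  ring

end Semigroup

/-! ### Sewing of families of approximations -/

section Sewing

variable {d : ℕ} {s : Fin d → ℝ} {ℓ : ℝ} {G : Sp d → ℝ} {Q : ℝ → Sp d → Sp d → ℝ}
  {W Wstar : Sp d → ℝ} {p : ℝ≥0∞}

/-- Completeness of weighted spaces, for sequences with geometrically small increments. -/
lemma exists_limit_of_geometric (hW : Measurable W) (hW0 : ∀ x, 0 < W x) (hp : 1 ≤ p)
    {g : ℕ → Sp d → ℝ} (hg : ∀ n, MemWLp W p (g n)) {K r : ℝ≥0∞} (hK : K ≠ ∞) (hr : r < 1)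
    (h : ∀ n, wLp W p (fun x => g n x - g (n + 1) x) ≤ K * r ^ n) :
    ∃ g' : Sp d → ℝ, MemWLp W p g' ∧
      Tendsto (fun n => wLp W p (fun x => g n x - g' x)) atTop (𝓝 0) := by
  have : Fact (1 ≤ p) := ⟨hp⟩
  have hL : ∀ n, MemLp (fun x => W x * g n x) p volume := fun n =>
    ⟨hW.aestronglyMeasurable.mul (hg n).1, (hg n).2⟩
  set F : ℕ → Lp ℝ p (volume : Measure (Sp d)) := fun n => (hL n).toLp with hF
  have hcau : CauchySeq F := by
    refine cauchySeq_of_edist_le_geometric r K hr hK fun n => ?_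
    rw [hF]
    simp only [Lp.edist_toLp_toLp]
    refine le_trans (le_of_eq ?_) (h n)
    unfold wLp
    congr 1
    funext x
    simp [mul_sub]
  obtain ⟨L, hLim⟩ := cauchySeq_tendsto_of_complete hcau
  refine ⟨fun x => (W x)⁻¹ * L x, ⟨?_, ?_⟩, ?_⟩
  · exact hW.inv.aestronglyMeasurable.mul (Lp.aestronglyMeasurable L)
  · have : wLp W p (fun x => (W x)⁻¹ * L x) = eLpNorm L p volume := by
      unfold wLp
      congr 1
      funext x
      rw [smul_eq_mul, ← mul_assoc, mul_inv_cancel₀ (hW0 x).ne', one_mul]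
    rw [this]
    exact Lp.eLpNorm_lt_top L
  · have h1 := tendsto_iff_edist_tendsto_0.1 hLim
    refine h1.congr fun n => ?_
    rw [Lp.edist_def]
    refine eLpNorm_congr_ae ?_
    filter_upwards [(hL n).coeFn_toLp] with x hx
    simp only [hF, Pi.sub_apply, hx, smul_eq_mul]
    rw [mul_sub, ← mul_assoc, mul_inv_cancel₀ (hW0 x).ne', one_mul]

/-- A family of functions behaves like `t ↦ Q_t Λ` on `(0,1]`: it lies in the weighted space and
is compatible with the semigroup. -/
structure IsOrbit (Q : ℝ → Sp d → Sp d → ℝ) (W : Sp d → ℝ) (p : ℝ≥0∞) (Λ : ℝ → Sp d → ℝ) :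
    Prop where
  mem : ∀ t, 0 < t → t ≤ 1 → MemWLp W p (Λ t)
  semigroup : ∀ u t, 0 < u → u < t → t ≤ 1 → Λ t =ᵐ[volume] applyQ Q (t - u) (Λ u)

/-- A family `E` is almost an orbit of the semigroup, with an error of order `t^θ`, where the
defect is tested on times `u` comparable to `t`. -/
structure IsAlmostOrbit (Q : ℝ → Sp d → Sp d → ℝ) (W : Sp d → ℝ) (p : ℝ≥0∞) (θ : ℝ) (K : ℝ≥0∞)
    (E : ℝ → Sp d → ℝ) : Prop where
  mem : ∀ t, 0 < t → t ≤ 1 → MemWLp W p (E t)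
  defect : ∀ t u, 0 < t → t ≤ 1 → t / 4 ≤ u → u ≤ t / 2 →
    wLp W p (fun x => E t x - applyQ Q (t - u) (E u) x) ≤ ENNReal.ofReal (t ^ θ) * K

lemma half_pow_rpow (θ : ℝ) (n : ℕ) : (((1 / 2 : ℝ) ^ n) ^ θ) = ((1 / 2 : ℝ) ^ θ) ^ n := by
  rw [← Real.rpow_natCast, ← Real.rpow_natCast, ← Real.rpow_mul (by norm_num),
    ← Real.rpow_mul (by norm_num), mul_comm]

/-- The approximations `Q_{t-2^{-n}} E_{2^{-n}}` of an almost orbit have geometrically small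
increments and stay within `t^θ` of `E_t`. -/
lemma IsAlmostOrbit.telescope (hs : ∀ i, 1 ≤ s i) (hG : ∀ x, 0 ≤ G x)
    (hQ : IsGTypeSemigroup s ℓ G Q) (hW : GControlled s ℓ G W Wstar) {θ : ℝ} (hθ : 0 < θ) :
    ∃ C : ℝ, 0 < C ∧ ∀ (p : ℝ≥0∞), 1 ≤ p → ∀ (K : ℝ≥0∞) (E : ℝ → Sp d → ℝ),
      IsAlmostOrbit Q W p θ K E → ∀ t, 0 < t → t ≤ 1 → ∃ m : ℕ, (1 / 2 : ℝ) ^ m < t ∧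
        (∀ n, m ≤ n →
          wLp W p (fun x => applyQ Q (t - (1 / 2) ^ n) (E ((1 / 2) ^ n)) x -
            applyQ Q (t - (1 / 2) ^ (n + 1)) (E ((1 / 2) ^ (n + 1))) x) ≤
            ENNReal.ofReal (C * ((1 / 2) ^ θ) ^ n) * K) ∧
        ∀ n, m ≤ n → wLp W p (fun x => applyQ Q (t - (1 / 2) ^ n) (E ((1 / 2) ^ n)) x - E t x) ≤
          ENNReal.ofReal (C * t ^ θ) * K := by
  obtain ⟨C, hC, hop⟩ := wLp_applyQ_le hs hG hQ hW
  set r : ℝ := (1 / 2 : ℝ) ^ θ with hr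
  have hr0 : 0 < r := by positivity
  have hr1 : r < 1 := Real.rpow_lt_one (by norm_num) (by norm_num) hθ
  have hr1' : 0 < 1 - r := by linarith
  refine ⟨1 + C + C / (1 - r), by positivity, fun p hp K E hE t ht ht1 => ?_⟩
  -- choose `m` with `t / 4 ≤ 2^{-m} < t / 2`, so that the defect of `E` at `(t, 2^{-m})` is controlled
  obtain ⟨m', hm1, hm2⟩ := exists_nat_pow_near_of_lt_one (x := t / 2) (y := (1 / 2 : ℝ))
    (by linarith) (by linarith) (by norm_num) (by norm_num)
  set m := m' + 1 with hm
  have hm2' : t / 4 ≤ (1 / 2 : ℝ) ^ m := by rw [hm, pow_succ]; linarith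
  have hmt : (1 / 2 : ℝ) ^ m < t := by linarith
  have hpow : ∀ n, m ≤ n → (1 / 2 : ℝ) ^ n < t := fun n hn =>
    (pow_le_pow_of_le_one (by norm_num) (by norm_num) hn).trans_lt hmt
  have hpos : ∀ n : ℕ, 0 < (1 / 2 : ℝ) ^ n := fun n => by positivity
  have hmemE : ∀ n, m ≤ n → MemWLp W p (E ((1 / 2) ^ n)) := fun n hn =>
    hE.mem _ (hpos n) ((hpow n hn).le.trans ht1)
  have hmemA : ∀ n, m ≤ n → MemWLp W p (applyQ Q (t - (1 / 2) ^ n) (E ((1 / 2) ^ n))) :=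
    fun n hn => (hmemE n hn).applyQ hs hG hQ hW hp (by linarith [hpow n hn])
      (by linarith [hpos n])
  have hstep : ∀ n, m ≤ n →
      wLp W p (fun x => applyQ Q (t - (1 / 2) ^ n) (E ((1 / 2) ^ n)) x -
        applyQ Q (t - (1 / 2) ^ (n + 1)) (E ((1 / 2) ^ (n + 1))) x) ≤
        ENNReal.ofReal (C * r ^ n) * K := by
    intro n hn
    have e1 : (1 / 2 : ℝ) ^ (n + 1) = (1 / 2) ^ n / 2 := by rw [pow_succ]; ring
    have h0 := hpos n
    have hnt := hpow n hn
    have hmem' := hmemE (n + 1) (by omega)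
    have hQE := hmem'.applyQ hs hG hQ hW hp (t := (1 / 2) ^ n - (1 / 2) ^ (n + 1))
      (by rw [e1]; linarith) (by rw [e1]; linarith)
    have e2 : applyQ Q (t - (1 / 2) ^ (n + 1)) (E ((1 / 2) ^ (n + 1))) =
        applyQ Q (t - (1 / 2) ^ n)
          (applyQ Q ((1 / 2) ^ n - (1 / 2) ^ (n + 1)) (E ((1 / 2) ^ (n + 1)))) := by
      rw [applyQ_applyQ hs hG hQ hW hp hmem' (by linarith) (by rw [e1]; linarith)
        (by rw [e1]; linarith)]
      congr 1; ring
    have e3 := applyQ_sub hs hG hQ hW hp (hmemE n hn) hQE (t := t - (1 / 2) ^ n) (by linarith)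
      (by linarith)
    rw [e2, ← e3]
    refine ((hop p hp _ (by linarith) (by linarith) _ ((hmemE n hn).1.sub hQE.1)).2).trans ?_
    rw [ENNReal.ofReal_mul hC.le, mul_assoc]
    gcongr
    rw [← half_pow_rpow]
    exact hE.defect _ _ h0 (by linarith) (by rw [e1]; linarith) (by rw [e1])
  -- summation of the geometric series of increments
  have hsum : ∀ k : ℕ, wLp W p (fun x => applyQ Q (t - (1 / 2) ^ (m + k))
      (E ((1 / 2) ^ (m + k))) x - E t x) ≤
        ENNReal.ofReal (t ^ θ + C * r ^ m * ((1 - r ^ k) / (1 - r))) * K := by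
    intro k
    induction k with
    | zero =>
      rw [wLp_sub_comm]
      simpa using hE.defect t ((1 / 2) ^ m) ht ht1 hm2' hm1.le
    | succ k ih =>
      have h1 := wLp_sub_le_add hW.measurable_weight hp (hmemA (m + (k + 1)) (by omega)).1
        (hmemA (m + k) (by omega)).1 (hE.mem t ht ht1).1
      refine h1.trans ?_
      have h2 := hstep (m + k) (by omega)
      rw [wLp_sub_comm] at h2
      refine (add_le_add h2 ih).trans ?_
      have hk : 0 ≤ (1 - r ^ k) / (1 - r) :=
        div_nonneg (by linarith [pow_le_one₀ (n := k) hr0.le hr1.le]) hr1'.le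
      rw [← add_mul, ← ENNReal.ofReal_add (by positivity) (by positivity)]
      refine mul_le_mul_left (ENNReal.ofReal_le_ofReal (le_of_eq ?_)) K
      rw [pow_add, pow_succ]
      field_simp
      ring
  refine ⟨m, hmt, fun n hn => (hstep n hn).trans ?_, fun n hn => ?_⟩
  · gcongr
    have : 0 ≤ C / (1 - r) := by positivity
    linarith
  · obtain ⟨k, rfl⟩ := Nat.exists_eq_add_of_le hn
    refine (hsum k).trans ?_
    gcongr
    have h1 : r ^ m ≤ t ^ θ := by
      rw [← half_pow_rpow]
      exact Real.rpow_le_rpow (by positivity) hmt.le hθ.le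
    have h2 : (1 - r ^ k) / (1 - r) ≤ 1 / (1 - r) := by
      gcongr
      linarith [pow_pos hr0 k]
    have h3 : 0 < t ^ θ := Real.rpow_pos_of_pos ht _
    have hk : 0 ≤ (1 - r ^ k) / (1 - r) :=
      div_nonneg (by linarith [pow_le_one₀ (n := k) hr0.le hr1.le]) hr1'.le
    calc t ^ θ + C * r ^ m * ((1 - r ^ k) / (1 - r)) ≤ t ^ θ + C * t ^ θ * (1 / (1 - r)) := by
          gcongr
      _ ≤ t ^ θ + C * t ^ θ * (1 / (1 - r)) + C * t ^ θ := by
          have : 0 ≤ C * t ^ θ := by positivity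
          linarith
      _ = _ := by ring

/-- Passage to the limit in a norm bound. -/
lemma wLp_sub_le_of_tendsto (hW : Measurable W) (hp : 1 ≤ p) {a : ℕ → Sp d → ℝ} {L e : Sp d → ℝ}
    {m : ℕ} {B : ℝ≥0∞} (ha : ∀ n, m ≤ n → AEStronglyMeasurable (a n) volume)
    (hL : AEStronglyMeasurable L volume) (he : AEStronglyMeasurable e volume)
    (hb : ∀ n, m ≤ n → wLp W p (fun x => a n x - e x) ≤ B)
    (ht : Tendsto (fun n => wLp W p (fun x => a n x - L x)) atTop (𝓝 0)) :
    wLp W p (fun x => L x - e x) ≤ B := by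
  have h1 : Tendsto (fun n => wLp W p (fun x => a n x - L x) + B) atTop (𝓝 (0 + B)) :=
    ht.add tendsto_const_nhds
  rw [zero_add] at h1
  refine ge_of_tendsto h1 ?_
  filter_upwards [eventually_ge_atTop m] with n hn
  refine (wLp_sub_le_add hW hp hL (ha n hn) he).trans ?_
  rw [wLp_sub_comm]
  gcongr
  exact hb n hn

/-- The reconstruction bound for an arbitrary orbit that is known to stay close to `E`. The bound
`B` only enters qualitatively. -/
lemma IsOrbit.wLp_sub_le (hs : ∀ i, 1 ≤ s i) (hG : ∀ x, 0 ≤ G x)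
    (hQ : IsGTypeSemigroup s ℓ G Q) (hW : GControlled s ℓ G W Wstar) {θ : ℝ} (hθ : 0 < θ) :
    ∃ C : ℝ, 0 < C ∧ ∀ (p : ℝ≥0∞), 1 ≤ p → ∀ (K B : ℝ≥0∞) (E Λ : ℝ → Sp d → ℝ),
      IsAlmostOrbit Q W p θ K E → IsOrbit Q W p Λ → B ≠ ∞ →
      (∀ t, 0 < t → t ≤ 1 → wLp W p (fun x => Λ t x - E t x) ≤ ENNReal.ofReal (t ^ θ) * B) →
      ∀ t, 0 < t → t ≤ 1 →
        wLp W p (fun x => Λ t x - E t x) ≤ ENNReal.ofReal (C * t ^ θ) * K := by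
  obtain ⟨C, hC, htel⟩ := IsAlmostOrbit.telescope hs hG hQ hW hθ
  obtain ⟨C', hC', hop⟩ := wLp_applyQ_le hs hG hQ hW
  refine ⟨C, hC, fun p hp K B E Λ hE hΛ hB hclose t ht ht1 => ?_⟩
  obtain ⟨m, hmt, -, hm⟩ := htel p hp K E hE t ht ht1
  have hpow : ∀ n, m ≤ n → (1 / 2 : ℝ) ^ n < t := fun n hn =>
    (pow_le_pow_of_le_one (by norm_num) (by norm_num) hn).trans_lt hmt
  have hpos : ∀ n : ℕ, 0 < (1 / 2 : ℝ) ^ n := fun n => by positivity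
  have hmemE : ∀ n, m ≤ n → MemWLp W p (E ((1 / 2) ^ n)) := fun n hn =>
    hE.mem _ (hpos n) ((hpow n hn).le.trans ht1)
  refine wLp_sub_le_of_tendsto hW.measurable_weight hp (m := m)
    (a := fun n => applyQ Q (t - (1 / 2) ^ n) (E ((1 / 2) ^ n)))
    (fun n hn => ((hmemE n hn).applyQ hs hG hQ hW hp (by linarith [hpow n hn])
      (by linarith [hpos n])).1) (hΛ.mem t ht ht1).1 (hE.mem t ht ht1).1 hm ?_
  -- `Q_{t-2^{-n}} E_{2^{-n}}` converges to `Λ_t`, since `Λ_t = Q_{t-2^{-n}} Λ_{2^{-n}}` and `θ > 0`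
  have hlim : Tendsto (fun n : ℕ => ENNReal.ofReal (C' * ((1 / 2) ^ θ) ^ n) * B) atTop (𝓝 0) := by
    have h1 : Tendsto (fun n : ℕ => C' * ((1 / 2 : ℝ) ^ θ) ^ n) atTop (𝓝 (C' * 0)) :=
      (tendsto_pow_atTop_nhds_zero_of_lt_one (by positivity)
        (Real.rpow_lt_one (by norm_num) (by norm_num) hθ)).const_mul _
    rw [mul_zero] at h1
    have h2 := ENNReal.Tendsto.mul_const (b := B) (ENNReal.tendsto_ofReal h1) (Or.inr hB)
    simpa using h2
  refine tendsto_of_tendsto_of_tendsto_of_le_of_le' tendsto_const_nhds hlim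
    (Eventually.of_forall fun _ => zero_le) ?_
  filter_upwards [eventually_ge_atTop m] with n hn
  have hn0 := hpos n
  have hnt := hpow n hn
  have hΛn := hΛ.mem _ hn0 (hnt.le.trans ht1)
  have e : wLp W p (fun x => applyQ Q (t - (1 / 2) ^ n) (E ((1 / 2) ^ n)) x - Λ t x) =
      wLp W p (applyQ Q (t - (1 / 2) ^ n) (fun x => Λ ((1 / 2) ^ n) x - E ((1 / 2) ^ n) x)) := by
    rw [applyQ_sub hs hG hQ hW hp hΛn (hmemE n hn) (by linarith) (by linarith), wLp_sub_comm]
    refine wLp_congr_ae ?_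
    filter_upwards [hΛ.semigroup _ t hn0 hnt ht1] with x hx
    rw [hx]
  rw [e]
  refine (hop p hp _ (by linarith) (by linarith) _ (hΛn.1.sub (hmemE n hn).1)).2.trans ?_
  rw [ENNReal.ofReal_mul hC'.le, mul_assoc, ← half_pow_rpow]
  gcongr
  exact hclose _ hn0 (hnt.le.trans ht1)

/-- Every almost orbit is close to an orbit. -/
lemma IsAlmostOrbit.exists_isOrbit (hs : ∀ i, 1 ≤ s i) (hG : ∀ x, 0 ≤ G x)
    (hQ : IsGTypeSemigroup s ℓ G Q) (hW : GControlled s ℓ G W Wstar) {θ : ℝ} (hθ : 0 < θ)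
    (hp : 1 ≤ p) {K : ℝ≥0∞} (hK : K ≠ ∞) {E : ℝ → Sp d → ℝ} (hE : IsAlmostOrbit Q W p θ K E) :
    ∃ (Λ : ℝ → Sp d → ℝ) (B : ℝ≥0∞), B ≠ ∞ ∧ IsOrbit Q W p Λ ∧
      ∀ t, 0 < t → t ≤ 1 → wLp W p (fun x => Λ t x - E t x) ≤ ENNReal.ofReal (t ^ θ) * B := by
  obtain ⟨C, hC, htel⟩ := IsAlmostOrbit.telescope hs hG hQ hW hθ
  obtain ⟨C', hC', hop⟩ := wLp_applyQ_le hs hG hQ hW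
  have hpos : ∀ n : ℕ, 0 < (1 / 2 : ℝ) ^ n := fun n => by positivity
  set r : ℝ := (1 / 2 : ℝ) ^ θ with hr
  have hr0 : 0 < r := by positivity
  have hr1 : r < 1 := Real.rpow_lt_one (by norm_num) (by norm_num) hθ
  set a : ℝ → ℕ → Sp d → ℝ := fun t n => applyQ Q (t - (1 / 2) ^ n) (E ((1 / 2) ^ n)) with ha
  have hmem : ∀ t, 0 < t → t ≤ 1 → ∀ n : ℕ, (1 / 2 : ℝ) ^ n < t →
      MemWLp W p (E ((1 / 2) ^ n)) ∧ MemWLp W p (a t n) := fun t ht ht1 n hn => by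
    have h1 := hE.mem _ (hpos n) (hn.le.trans ht1)
    exact ⟨h1, h1.applyQ hs hG hQ hW hp (by linarith) (by linarith [hpos n])⟩
  have hex : ∀ t, 0 < t → t ≤ 1 → ∃ g : Sp d → ℝ, MemWLp W p g ∧
      wLp W p (fun x => g x - E t x) ≤ ENNReal.ofReal (C * t ^ θ) * K ∧
      Tendsto (fun n => wLp W p (fun x => a t n x - g x)) atTop (𝓝 0) := by
    intro t ht ht1
    obtain ⟨m, hmt, hstep, hbound⟩ := htel p hp K E hE t ht ht1
    have hpow : ∀ n, m ≤ n → (1 / 2 : ℝ) ^ n < t := fun n hn =>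
      (pow_le_pow_of_le_one (by norm_num) (by norm_num) hn).trans_lt hmt
    obtain ⟨g, hg, hlim⟩ := exists_limit_of_geometric hW.measurable_weight hW.weight_pos hp
      (g := fun k => a t (k + m)) (fun k => (hmem t ht ht1 _ (hpow _ (by omega))).2)
      (K := ENNReal.ofReal (C * r ^ m) * K) (r := ENNReal.ofReal r)
      (ENNReal.mul_ne_top ENNReal.ofReal_ne_top hK) (by
        rw [← ENNReal.ofReal_one]
        exact (ENNReal.ofReal_lt_ofReal_iff one_pos).2 hr1) (fun k => by
        have h1 := hstep (k + m) (by omega)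
        rw [show k + 1 + m = k + m + 1 by omega]
        refine h1.trans (le_of_eq ?_)
        rw [← ENNReal.ofReal_pow hr0.le, mul_right_comm, ← ENNReal.ofReal_mul (by positivity)]
        congr 2
        rw [pow_add]; ring)
    have hlim' : Tendsto (fun n => wLp W p (fun x => a t n x - g x)) atTop (𝓝 0) :=
      (tendsto_add_atTop_iff_nat m).1 hlim
    refine ⟨g, hg, ?_, hlim'⟩
    exact wLp_sub_le_of_tendsto hW.measurable_weight hp (m := m) (a := a t)
      (fun n hn => (hmem t ht ht1 n (hpow n hn)).2.1) hg.1 (hE.mem t ht ht1).1 hbound hlim'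
  choose! Λ hΛm hΛb hΛl using hex
  refine ⟨Λ, ENNReal.ofReal C * K, ENNReal.mul_ne_top ENNReal.ofReal_ne_top hK, ⟨hΛm, ?_⟩,
    fun t ht ht1 => (hΛb t ht ht1).trans (le_of_eq ?_)⟩
  · intro u t hu hut ht1
    have ht := hu.trans hut
    have hQΛ := (hΛm u hu (hut.le.trans ht1)).applyQ hs hG hQ hW hp (t := t - u) (by linarith)
      (by linarith)
    refine ae_eq_of_wLp_sub_eq_zero hW.measurable_weight hW.weight_pos hp (hΛm t ht ht1).1
      hQΛ.1 (le_antisymm ?_ zero_le)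
    obtain ⟨m, hm⟩ := exists_pow_lt_of_lt_one hu (show (1 / 2 : ℝ) < 1 by norm_num)
    have hpow : ∀ n, m ≤ n → (1 / 2 : ℝ) ^ n < u := fun n hn =>
      (pow_le_pow_of_le_one (by norm_num) (by norm_num) hn).trans_lt hm
    have hlimB : Tendsto (fun n => wLp W p (fun x => a t n x - Λ t x) +
        ENNReal.ofReal C' * wLp W p (fun x => a u n x - Λ u x)) atTop (𝓝 0) := by
      have h2 := ENNReal.Tendsto.const_mul (hΛl u hu (hut.le.trans ht1))
        (Or.inr (ENNReal.ofReal_ne_top (r := C')))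
      simpa using (hΛl t ht ht1).add h2
    refine ge_of_tendsto hlimB ?_
    filter_upwards [eventually_ge_atTop m] with n hn
    have hnu := hpow n hn
    have hn0 := hpos n
    have hau := (hmem u hu (hut.le.trans ht1) n hnu)
    have e : a t n = applyQ Q (t - u) (a u n) := by
      simp only [ha]
      rw [applyQ_applyQ hs hG hQ hW hp hau.1 (by linarith) (by linarith) (by linarith)]
      congr 1; ring
    refine (wLp_sub_le_add hW.measurable_weight hp (hΛm t ht ht1).1
      (hmem t ht ht1 n (hnu.trans hut)).2.1 hQΛ.1).trans ?_
    rw [wLp_sub_comm]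
    gcongr
    rw [e, ← applyQ_sub hs hG hQ hW hp hau.2 (hΛm u hu (hut.le.trans ht1)) (by linarith)
      (by linarith)]
    exact (hop p hp _ (by linarith) (by linarith) _
      (hau.2.1.sub (hΛm u hu (hut.le.trans ht1)).1)).2
  · rw [mul_comm C, ENNReal.ofReal_mul (by positivity), mul_assoc]

lemma exists_pos_forall_ofReal_mul_lt {K ε : ℝ≥0∞} (hK : K ≠ ∞) (hε : 0 < ε) :
    ∃ a : ℝ, 0 < a ∧ ∀ y ≤ a, ENNReal.ofReal y * K < ε := by
  have h1 : Tendsto (fun y : ℝ => ENNReal.ofReal y * K) (𝓝 0) (𝓝 0) := by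
    have := ENNReal.Tendsto.mul_const (b := K)
      ((ENNReal.continuous_ofReal.tendsto 0)) (Or.inr hK)
    simpa using this
  obtain ⟨a, ha, h⟩ := Metric.eventually_nhds_iff.1 (h1.eventually_lt_const hε)
  refine ⟨a / 2, by positivity, fun y hy => ?_⟩
  refine lt_of_le_of_lt (b := ENNReal.ofReal (a / 2) * K) (by gcongr) (h ?_)
  simp [abs_of_pos ha]
  exact ha

/-- An orbit of regularity `α` lies in the completions of the continuous functions of all lower
regularities: it is approximated by `Q_δ Λ_δ` as `δ → 0`. -/
lemma IsOrbit.exists_approx (hs : ∀ i, 1 ≤ s i) (hℓ : 0 < ℓ) (hG : ∀ x, 0 ≤ G x)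
    (hQ : IsGTypeSemigroup s ℓ G Q) (hW : GControlled s ℓ G W Wstar) (hp : 1 ≤ p)
    {Λ : ℝ → Sp d → ℝ} (hΛ : IsOrbit Q W p Λ) {α β : ℝ} (hβα : β < α) (hβ : β ≤ 0) {K : ℝ≥0∞}
    (hK : K ≠ ∞)
    (hb : ∀ t, 0 < t → t ≤ 1 → wLp W p (Λ t) ≤ ENNReal.ofReal (t ^ (α / ℓ)) * K)
    {ε : ℝ≥0∞} (hε : 0 < ε) :
    ∃ f : Sp d → ℝ, MemWLpc W p f ∧
      besovNorm ℓ β p W (fun t x => Λ t x - applyQ Q t f x) < ε := by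
  obtain ⟨C, hC, hop⟩ := wLp_applyQ_le hs hG hQ hW
  obtain ⟨C', hC', hreg⟩ := wLp_applyQ_sub_le hs hℓ hG hQ hW
  obtain ⟨a, ha, hsmall⟩ := exists_pos_forall_ofReal_mul_lt hK (ENNReal.half_pos hε.ne')
  set γ := (α - β) / ℓ with hγ
  have hγ0 : 0 < γ := div_pos (by linarith) hℓ
  -- small times `t ≤ η` are controlled by the gap between the regularities
  obtain ⟨η, hη0, hη1, hηa⟩ : ∃ η : ℝ, 0 < η ∧ η ≤ 1 ∧ (1 + C) * η ^ γ ≤ a := by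
    refine ⟨min 1 ((a / (1 + C)) ^ (1 / γ)), lt_min one_pos (by positivity), min_le_left _ _, ?_⟩
    have h1 : (min 1 ((a / (1 + C)) ^ (1 / γ))) ^ γ ≤ a / (1 + C) := by
      refine (Real.rpow_le_rpow (le_min zero_le_one (by positivity)) (min_le_right _ _)
        hγ0.le).trans (le_of_eq ?_)
      rw [← Real.rpow_mul (by positivity), one_div_mul_cancel hγ0.ne', Real.rpow_one]
    calc _ ≤ (1 + C) * (a / (1 + C)) := by gcongr
      _ = a := by field_simp
  set H := (η / 2) ^ (α / ℓ) with hH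
  have hH0 : 0 < H := by positivity
  obtain ⟨δ, hδ0, hδη, hδa⟩ : ∃ δ : ℝ, 0 < δ ∧ 2 * δ ≤ η / 2 ∧ C' * (2 * δ / (η / 2)) * H ≤ a := by
    refine ⟨min (η / 4) (a * η / (4 * C' * H)), lt_min (by positivity) (by positivity), ?_, ?_⟩
    · have := min_le_left (η / 4) (a * η / (4 * C' * H)); linarith
    · have := min_le_right (η / 4) (a * η / (4 * C' * H))
      calc _ ≤ C' * (2 * (a * η / (4 * C' * H)) / (η / 2)) * H := by gcongr
        _ = a := by field_simp; norm_num
  have hδ1 : δ ≤ 1 := by linarith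
  have hmδ := hΛ.mem δ hδ0 hδ1
  have hfm : MemWLp W p (applyQ Q δ (Λ δ)) := hmδ.applyQ hs hG hQ hW hp hδ0 (by linarith)
  have hfc := continuous_applyQ hs hG hQ hW hp hmδ hδ0 (by linarith)
  refine ⟨applyQ Q δ (Λ δ), ⟨hfm, fun e he => ⟨_, hfc, hfm.2, ?_⟩⟩, ?_⟩
  · simpa [wLp_zero] using he
  -- with `f = Q_δ Λ_δ` one has `Q_t f = Q_{2δ} Λ_t`, both for `t ≥ δ` and for `t < δ`
  have hkey : ∀ t, 0 < t → t ≤ 1 → applyQ Q t (applyQ Q δ (Λ δ)) = applyQ Q (2 * δ) (Λ t) := by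
    intro t ht ht1
    rw [applyQ_applyQ hs hG hQ hW hp hmδ ht hδ0 (by linarith)]
    rcases lt_trichotomy δ t with h | h | h
    · rw [applyQ_congr_ae (hΛ.semigroup δ t hδ0 h ht1),
        applyQ_applyQ hs hG hQ hW hp hmδ (by linarith) (by linarith) (by linarith)]
      congr 1; ring
    · rw [h]; congr 1; ring
    · rw [applyQ_congr_ae (hΛ.semigroup t δ ht h hδ1),
        applyQ_applyQ hs hG hQ hW hp (hΛ.mem t ht ht1) (by linarith) (by linarith)
          (by linarith)]
      congr 1; ring
  set M : ℝ≥0∞ := ENNReal.ofReal a * K with hM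
  have hMlt : M < ε / 2 := hsmall a le_rfl
  have hlarge : ∀ t, η ≤ t → t ≤ 1 →
      wLp W p (fun x => Λ t x - applyQ Q t (applyQ Q δ (Λ δ)) x) ≤ M := by
    intro t hηt ht1
    have ht : 0 < t := by linarith
    have hmη := hΛ.mem (η / 2) (by linarith) (by linarith)
    have hsg := hΛ.semigroup (η / 2) t (by linarith) (by linarith) ht1
    rw [hkey t ht ht1, applyQ_congr_ae hsg, applyQ_applyQ hs hG hQ hW hp hmη (by linarith)
      (by linarith) (by linarith), wLp_sub_comm]
    have e : wLp W p (fun x => applyQ Q (2 * δ + (t - η / 2)) (Λ (η / 2)) x - Λ t x) =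
        wLp W p (fun x => applyQ Q ((t - η / 2) + 2 * δ) (Λ (η / 2)) x -
          applyQ Q (t - η / 2) (Λ (η / 2)) x) := by
      rw [add_comm (2 * δ)]
      refine wLp_congr_ae ?_
      filter_upwards [hsg] with x hx
      rw [hx]
    rw [e]
    refine (hreg p hp (t - η / 2) (2 * δ) (by linarith) (by linarith) (by linarith) (by linarith)
      _ hmη).trans ?_
    have hbη := hb (η / 2) (by linarith) (by linarith)
    calc _ ≤ ENNReal.ofReal (C' * (2 * δ / (η / 2))) * (ENNReal.ofReal H * K) := by
          gcongr
          linarith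
      _ = ENNReal.ofReal (C' * (2 * δ / (η / 2)) * H) * K := by
          rw [← mul_assoc, ← ENNReal.ofReal_mul (by positivity)]
      _ ≤ M := by rw [hM]; gcongr
  have hall : ∀ t, 0 < t → t ≤ 1 → ENNReal.ofReal (t ^ (-β / ℓ)) *
      wLp W p (fun x => Λ t x - applyQ Q t (applyQ Q δ (Λ δ)) x) ≤ M := by
    intro t ht ht1
    rcases le_total η t with h | h
    · have h1 : t ^ (-β / ℓ) ≤ 1 :=
        Real.rpow_le_one ht.le ht1 (div_nonneg (by linarith) hℓ.le)
      calc _ ≤ 1 * M := by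
            gcongr
            · exact (ENNReal.ofReal_le_ofReal h1).trans_eq ENNReal.ofReal_one
            · exact hlarge t h ht1
        _ = M := one_mul _
    · have hmt := hΛ.mem t ht ht1
      rw [hkey t ht ht1]
      have h1 := RegInt.wLp_sub_le hW.measurable_weight hp hmt.1
        (hmt.applyQ hs hG hQ hW hp (t := 2 * δ) (by linarith) (by linarith)).1
      have h2 := (hop p hp (2 * δ) (by linarith) (by linarith) (Λ t) hmt.1).2
      calc _ ≤ ENNReal.ofReal (t ^ (-β / ℓ)) *
            (wLp W p (Λ t) + ENNReal.ofReal C * wLp W p (Λ t)) := by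
            gcongr
            exact h1.trans (by gcongr)
        _ = ENNReal.ofReal (t ^ (-β / ℓ)) * (ENNReal.ofReal (1 + C) * wLp W p (Λ t)) := by
            rw [ENNReal.ofReal_add zero_le_one hC.le, ENNReal.ofReal_one, add_mul, one_mul]
        _ ≤ ENNReal.ofReal (t ^ (-β / ℓ)) *
            (ENNReal.ofReal (1 + C) * (ENNReal.ofReal (t ^ (α / ℓ)) * K)) := by
            gcongr
            exact hb t ht ht1
        _ = ENNReal.ofReal ((1 + C) * t ^ γ) * K := by
            rw [← mul_assoc, ← mul_assoc, ← ENNReal.ofReal_mul (by positivity),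
              ← ENNReal.ofReal_mul (by positivity)]
            congr 2
            rw [mul_right_comm, ← Real.rpow_add ht, hγ, mul_comm]
            congr 2; ring
        _ ≤ M := by
            rw [hM]
            gcongr
            refine le_trans ?_ hηa
            gcongr
  have hone := hlarge 1 hη1 le_rfl
  calc besovNorm ℓ β p W (fun t x => Λ t x - applyQ Q t (applyQ Q δ (Λ δ)) x) ≤ M + M := by
        refine add_le_add hone (iSup_le fun t => hall t t.2.1 t.2.2)
    _ < ε / 2 + ε / 2 := ENNReal.add_lt_add hMlt hMlt
    _ = ε := ENNReal.add_halves ε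

end Sewing

/-! ### Exponential moments of the semigroup kernels -/

section ExpMoments

variable {d : ℕ} {s : Fin d → ℝ} {ℓ : ℝ} {G : Sp d → ℝ} {Q : ℝ → Sp d → Sp d → ℝ}
  {W Wstar : Sp d → ℝ}

/-- The smallest convolution kernel dominating the kernel `Q_t`. -/
noncomputable def supKernel (Q : ℝ → Sp d → Sp d → ℝ) (t : ℝ) (h : Sp d) : ℝ≥0∞ :=
  ⨆ x, ‖Q t x (x - h)‖ₑ

lemma enorm_le_supKernel (t : ℝ) (x y : Sp d) : ‖Q t x y‖ₑ ≤ supKernel Q t (x - y) := by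
  have := le_iSup (fun x' => ‖Q t x' (x' - (x - y))‖ₑ) x
  simp only [sub_sub_cancel] at this
  exact this

lemma measurable_supKernel (hQ : IsGTypeSemigroup s ℓ G Q) {t : ℝ} (ht : 0 < t) :
    Measurable (supKernel Q t) := by
  refine LowerSemicontinuous.measurable (lowerSemicontinuous_iSup fun x => ?_)
  refine Continuous.lowerSemicontinuous ?_
  exact ((hQ.continuous_kernel t ht).comp
    (continuous_const.prodMk (continuous_const.sub continuous_id))).enorm

lemma supKernel_le (hQ : IsGTypeSemigroup s ℓ G Q) :
    ∃ C : ℝ, 0 < C ∧ ∀ t : ℝ, 0 < t → ∀ h,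
      supKernel Q t h ≤ ENNReal.ofReal C * ENNReal.ofReal (scaledG s ℓ G t h) := by
  obtain ⟨C, hC, hu⟩ := hQ.upper
  refine ⟨C, hC, fun t ht h => iSup_le fun x => ?_⟩
  rw [← ENNReal.ofReal_mul hC.le, ← ofReal_norm, Real.norm_eq_abs]
  have := hu t ht x (x - h)
  rw [sub_sub_cancel] at this
  exact ENNReal.ofReal_le_ofReal this

/-- The dominating kernels are submultiplicative for the convolution. -/
lemma supKernel_le_conv (hQ : IsGTypeSemigroup s ℓ G Q) {t : ℝ} (ht : 0 < t) (h : Sp d) :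
    supKernel Q t h ≤ ∫⁻ k, supKernel Q (t / 2) k * supKernel Q (t / 2) (h - k) := by
  refine iSup_le fun x => ?_
  have e := hQ.semigroup (t / 2) t (by linarith) (by linarith) x (x - h)
  rw [sub_half] at e
  rw [← e]
  calc _ ≤ ∫⁻ z, ‖Q (t / 2) x z * Q (t / 2) z (x - h)‖ₑ := enorm_integral_le_lintegral_enorm _
    _ ≤ ∫⁻ z, supKernel Q (t / 2) (x - z) * supKernel Q (t / 2) (h - (x - z)) := by
        refine lintegral_mono fun z => ?_
        rw [enorm_mul]
        gcongr
        · exact enorm_le_supKernel _ _ _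
        · refine (enorm_le_supKernel _ _ _).trans (le_of_eq ?_)
          congr 1; abel
    _ = _ := lintegral_sub_left_eq_self
      (fun k => supKernel Q (t / 2) k * supKernel Q (t / 2) (h - k)) x

lemma lintegral_conv {F H : Sp d → ℝ≥0∞} (hF : Measurable F) (hH : Measurable H) :
    ∫⁻ h, ∫⁻ k, F k * H (h - k) = (∫⁻ k, F k) * ∫⁻ k, H k := by
  rw [lintegral_lintegral_swap]
  · calc _ = ∫⁻ k, F k * ∫⁻ h, H h := by
          refine lintegral_congr fun k => ?_
          have hk : Measurable fun h : Sp d => H (h - k) := hH.comp (measurable_id.sub_const k)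
          rw [lintegral_const_mul (F k) hk, lintegral_sub_right_eq_self H k]
      _ = _ := lintegral_mul_const _ hF
  · exact ((hF.comp measurable_snd).mul
      (hH.comp (measurable_fst.sub measurable_snd))).aemeasurable

/-- The `n`-th moment of the dominating kernel. -/
noncomputable def kernelMoment (Q : ℝ → Sp d → Sp d → ℝ) (t : ℝ) (n : ℕ) : ℝ≥0∞ :=
  ∫⁻ h, supKernel Q t h * ‖h‖ₑ ^ n

lemma kernelMoment_le_sum (hQ : IsGTypeSemigroup s ℓ G Q) {t : ℝ} (ht : 0 < t) (n : ℕ) :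
    kernelMoment Q t n ≤ ∑ j ∈ Finset.range (n + 1),
      kernelMoment Q (t / 2) j * kernelMoment Q (t / 2) (n - j) * (n.choose j : ℝ≥0∞) := by
  have ht2 : 0 < t / 2 := by linarith
  have hm := measurable_supKernel hQ ht2
  have hmn : ∀ j : ℕ, Measurable fun h : Sp d => supKernel Q (t / 2) h * ‖h‖ₑ ^ j := fun j =>
    hm.mul (measurable_enorm.pow_const j)
  have hmn2 : ∀ j i : ℕ, Measurable fun z : Sp d × Sp d =>
      (supKernel Q (t / 2) z.2 * ‖z.2‖ₑ ^ j) *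
        (supKernel Q (t / 2) (z.1 - z.2) * ‖z.1 - z.2‖ₑ ^ i) := fun j i =>
    ((hmn j).comp measurable_snd).mul ((hmn i).comp (measurable_fst.sub measurable_snd))
  calc kernelMoment Q t n
      ≤ ∫⁻ h, ∫⁻ k, ∑ j ∈ Finset.range (n + 1), ((supKernel Q (t / 2) k * ‖k‖ₑ ^ j) *
          (supKernel Q (t / 2) (h - k) * ‖h - k‖ₑ ^ (n - j))) * (n.choose j : ℝ≥0∞) := by
        refine lintegral_mono fun h => ?_
        have h1 := mul_le_mul_left (supKernel_le_conv hQ ht h) (‖h‖ₑ ^ n)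
        refine h1.trans ?_
        have hk : Measurable fun k : Sp d => supKernel Q (t / 2) k * supKernel Q (t / 2) (h - k) :=
          hm.mul (hm.comp (measurable_const.sub measurable_id))
        rw [← lintegral_mul_const _ hk]
        refine lintegral_mono fun k => ?_
        have h2 : ‖h‖ₑ ^ n ≤ (‖k‖ₑ + ‖h - k‖ₑ) ^ n := by
          gcongr
          calc ‖h‖ₑ = ‖k + (h - k)‖ₑ := by rw [add_sub_cancel]
            _ ≤ _ := enorm_add_le _ _
        refine (mul_le_mul_right h2 _).trans (le_of_eq ?_)
        rw [add_pow, Finset.mul_sum]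
        refine Finset.sum_congr rfl fun j _ => ?_
        ring
    _ = ∑ j ∈ Finset.range (n + 1), kernelMoment Q (t / 2) j * kernelMoment Q (t / 2) (n - j) *
          (n.choose j : ℝ≥0∞) := by
        have hs1 : ∀ (j : ℕ) (h : Sp d), Measurable fun k : Sp d =>
            (supKernel Q (t / 2) k * ‖k‖ₑ ^ j) *
              (supKernel Q (t / 2) (h - k) * ‖h - k‖ₑ ^ (n - j)) := fun j h =>
          (hmn j).mul ((hmn (n - j)).comp (measurable_const.sub measurable_id))
        have hs2 : ∀ j : ℕ, Measurable fun h : Sp d => ∫⁻ k,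
            (supKernel Q (t / 2) k * ‖k‖ₑ ^ j) *
              (supKernel Q (t / 2) (h - k) * ‖h - k‖ₑ ^ (n - j)) := fun j =>
          (hmn2 j (n - j)).lintegral_prod_right'
        have e1 : ∀ h : Sp d, ∫⁻ k, ∑ j ∈ Finset.range (n + 1), ((supKernel Q (t / 2) k * ‖k‖ₑ ^ j) *
            (supKernel Q (t / 2) (h - k) * ‖h - k‖ₑ ^ (n - j))) * (n.choose j : ℝ≥0∞) =
            ∑ j ∈ Finset.range (n + 1), (∫⁻ k, (supKernel Q (t / 2) k * ‖k‖ₑ ^ j) *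
            (supKernel Q (t / 2) (h - k) * ‖h - k‖ₑ ^ (n - j))) * (n.choose j : ℝ≥0∞) := by
          intro h
          rw [lintegral_finsetSum _ fun j _ => (hs1 j h).mul_const _]
          exact Finset.sum_congr rfl fun j _ => lintegral_mul_const _ (hs1 j h)
        simp_rw [e1]
        rw [lintegral_finsetSum _ fun j _ => (hs2 j).mul_const _]
        refine Finset.sum_congr rfl fun j _ => ?_
        rw [lintegral_mul_const _ (hs2 j), lintegral_conv (hmn j) (hmn (n - j))]
        rfl

/-- Moments scale as `t^{n/ℓ}` for small times. -/
lemma kernelMoment_le (hs : ∀ i, 1 ≤ s i) (hℓ : 0 < ℓ) (hG : ∀ x, 0 ≤ G x)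
    (hQ : IsGTypeSemigroup s ℓ G Q) (hW : GControlled s ℓ G W Wstar) (n : ℕ) :
    ∃ C : ℝ, 0 < C ∧ ∀ t : ℝ, 0 < t → t ≤ 1 →
      kernelMoment Q t n ≤ ENNReal.ofReal (C * t ^ ((n : ℝ) / ℓ)) := by
  obtain ⟨C, hC, hsup⟩ := supKernel_le hQ
  set S := ∑ i, s i with hS
  have hS0 : 0 ≤ S := Finset.sum_nonneg fun i _ => by linarith [hs i]
  obtain ⟨C', hC', hG'⟩ := hW.scaledG_mul_le hs hG (decayExp s + n * S)
  refine ⟨C * C' * Real.pi ^ d, by positivity, fun t ht ht1 => ?_⟩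
  -- since `s_i ≥ 1` and `t ≤ 1`, the usual norm is controlled by a power `|s|` of the profile and
  -- yields a full factor `t^{1/ℓ}`
  have hnorm : ∀ z : Sp d, ‖z‖ ≤ t ^ (1 / ℓ) * (1 + t ^ (-1 / ℓ) * sNorm s z) ^ S := by
    intro z
    have hb := one_le_one_add s ℓ ht z
    refine (pi_norm_le_iff_of_nonneg (by positivity)).2 fun i => ?_
    have hsi := hs i
    have hle : s i ≤ S := Finset.single_le_sum (f := s) (fun j _ => by linarith [hs j])
      (Finset.mem_univ i)
    have hz := sNorm_nonneg s z
    have h1 : |z i| ^ (1 / s i) ≤ sNorm s z :=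
      Finset.single_le_sum (f := fun i => |z i| ^ (1 / s i))
        (fun _ _ => Real.rpow_nonneg (abs_nonneg _) _) (Finset.mem_univ i)
    have h2 : |z i| = (|z i| ^ (1 / s i)) ^ s i := by
      rw [← Real.rpow_mul (abs_nonneg _), one_div_mul_cancel (by linarith), Real.rpow_one]
    have h3 : sNorm s z = t ^ (1 / ℓ) * (t ^ (-1 / ℓ) * sNorm s z) := by
      rw [← mul_assoc, ← Real.rpow_add ht, ← add_div]; simp
    have h4 : (t ^ (1 / ℓ)) ^ s i ≤ t ^ (1 / ℓ) := by
      have : t ^ (1 / ℓ) ≤ 1 := Real.rpow_le_one ht.le ht1 (by positivity)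
      calc _ ≤ (t ^ (1 / ℓ)) ^ (1 : ℝ) :=
            Real.rpow_le_rpow_of_exponent_ge (by positivity) this hsi
        _ = _ := Real.rpow_one _
    have h5 : (t ^ (-1 / ℓ) * sNorm s z) ^ s i ≤ (1 + t ^ (-1 / ℓ) * sNorm s z) ^ S :=
      (Real.rpow_le_rpow (by positivity) (by linarith) (by linarith)).trans
        (Real.rpow_le_rpow_of_exponent_le hb hle)
    rw [Real.norm_eq_abs, h2]
    calc (|z i| ^ (1 / s i)) ^ s i ≤ (sNorm s z) ^ s i :=
          Real.rpow_le_rpow (by positivity) h1 (by linarith)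
      _ = (t ^ (1 / ℓ)) ^ s i * (t ^ (-1 / ℓ) * sNorm s z) ^ s i := by
          conv_lhs => rw [h3]
          exact Real.mul_rpow (by positivity) (by positivity)
      _ ≤ _ := by gcongr
  have hpt : ∀ z : Sp d, supKernel Q t z * ‖z‖ₑ ^ n ≤
      ENNReal.ofReal (C * C' * t ^ ((n : ℝ) / ℓ)) *
        ENNReal.ofReal (bracket s ℓ (decayExp s) t z) := by
    intro z
    have hb := one_le_one_add s ℓ ht z
    have hg := scaledG_nonneg (s := s) (ℓ := ℓ) hG ht z
    refine (mul_le_mul_left (hsup t ht z) _).trans ?_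
    rw [← ofReal_norm, ← ENNReal.ofReal_pow (norm_nonneg _), ← ENNReal.ofReal_mul hC.le,
      ← ENNReal.ofReal_mul (by positivity), ← ENNReal.ofReal_mul (by positivity)]
    refine ENNReal.ofReal_le_ofReal ?_
    have h1 : scaledG s ℓ G t z ≤ C' * bracket s ℓ (decayExp s + n * S) t z := by
      refine le_trans ?_ (hG' t ht (by linarith) z)
      exact le_mul_of_one_le_right hg (hW.one_le_star z)
    have h2 : ‖z‖ ^ n ≤ t ^ ((n : ℝ) / ℓ) * (1 + t ^ (-1 / ℓ) * sNorm s z) ^ (n * S) := by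
      refine (pow_le_pow_left₀ (norm_nonneg _) (hnorm z) n).trans (le_of_eq ?_)
      rw [mul_pow, ← Real.rpow_natCast, ← Real.rpow_natCast, ← Real.rpow_mul ht.le,
        ← Real.rpow_mul (by linarith)]
      congr 2 <;> ring
    have h3 := bracket_nonneg s ℓ (decayExp s + n * S) ht z
    calc C * scaledG s ℓ G t z * ‖z‖ ^ n
        ≤ C * (C' * bracket s ℓ (decayExp s + n * S) t z) *
          (t ^ ((n : ℝ) / ℓ) * (1 + t ^ (-1 / ℓ) * sNorm s z) ^ (n * S)) := by
          refine mul_le_mul ?_ h2 (by positivity) (by positivity)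
          exact mul_le_mul_of_nonneg_left h1 hC.le
      _ = C * C' * t ^ ((n : ℝ) / ℓ) * (t ^ (-(∑ i, s i) / ℓ) *
          ((1 + t ^ (-1 / ℓ) * sNorm s z) ^ (-(decayExp s + n * S)) *
            (1 + t ^ (-1 / ℓ) * sNorm s z) ^ (n * S))) := by
          unfold bracket; ring
      _ = _ := by
          rw [← Real.rpow_add (by linarith)]
          unfold bracket
          congr 4; ring
  calc kernelMoment Q t n ≤ ∫⁻ z, ENNReal.ofReal (C * C' * t ^ ((n : ℝ) / ℓ)) *
        ENNReal.ofReal (bracket s ℓ (decayExp s) t z) := lintegral_mono hpt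
    _ = ENNReal.ofReal (C * C' * t ^ ((n : ℝ) / ℓ)) *
        ∫⁻ z, ENNReal.ofReal (bracket s ℓ (decayExp s) t z) :=
        lintegral_const_mul' _ _ ENNReal.ofReal_ne_top
    _ ≤ ENNReal.ofReal (C * C' * t ^ ((n : ℝ) / ℓ)) * ENNReal.ofReal (Real.pi ^ d) := by
        gcongr; exact lintegral_bracket_le hs ℓ ht
    _ = _ := by
        rw [← ENNReal.ofReal_mul (by positivity)]; congr 1; ring

/-- A convolution-type recursion with a geometrically small factor forces geometric growth. -/
lemma exists_geometric_bound {c : ℕ → ℝ} (hc : ∀ n, 0 ≤ c n) {q : ℝ} (hq0 : 0 < q) (hq1 : q < 1)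
    (h : ∀ n, c n ≤ q ^ n * ∑ j ∈ Finset.range (n + 1), c j * c (n - j)) :
    ∃ r : ℝ, 1 ≤ r ∧ ∀ n, 1 ≤ n → c n ≤ r ^ n := by
  have hlim1 : Tendsto (fun n : ℕ => 2 * c 0 * q ^ n) atTop (𝓝 (2 * c 0 * 0)) :=
    (tendsto_pow_atTop_nhds_zero_of_lt_one hq0.le hq1).const_mul _
  have hlim2 : Tendsto (fun n : ℕ => 2 * ((n : ℝ) * q ^ n)) atTop (𝓝 (2 * 0)) :=
    (tendsto_self_mul_const_pow_of_lt_one hq0.le hq1).const_mul _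
  rw [mul_zero] at hlim1 hlim2
  obtain ⟨n₁, hn₁⟩ := eventually_atTop.1 ((hlim1.eventually_lt_const one_half_pos).and
    (hlim2.eventually_lt_const one_pos))
  set r : ℝ := 1 + ∑ j ∈ Finset.range n₁, c j with hr
  have hr1 : 1 ≤ r := by
    have := Finset.sum_nonneg fun j (_ : j ∈ Finset.range n₁) => hc j
    linarith
  refine ⟨r, hr1, fun n => ?_⟩
  induction n using Nat.strong_induction_on with
  | _ n ih =>
    intro hn
    rcases lt_or_ge n n₁ with hlt | hge
    · have h1 : c n ≤ ∑ j ∈ Finset.range n₁, c j :=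
        Finset.single_le_sum (fun j _ => hc j) (Finset.mem_range.2 hlt)
      calc c n ≤ r := by linarith
        _ = r ^ 1 := (pow_one r).symm
        _ ≤ r ^ n := pow_le_pow_right₀ hr1 hn
    · obtain ⟨m, rfl⟩ : ∃ m, n = m + 1 := ⟨n - 1, by omega⟩
      obtain ⟨a1, a2⟩ := hn₁ (m + 1) hge
      have hrec := h (m + 1)
      -- split off the terms `j = 0` and `j = n`, which contain `c n` itself
      rw [Finset.sum_range_succ, Finset.sum_range_succ'] at hrec
      simp only [Nat.sub_zero, Nat.sub_self] at hrec
      have hmid : ∑ j ∈ Finset.range m, c (j + 1) * c (m + 1 - (j + 1)) ≤ m * r ^ (m + 1) := by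
        calc _ ≤ ∑ j ∈ Finset.range m, r ^ (m + 1) := by
              refine Finset.sum_le_sum fun j hj => ?_
              have hj' := Finset.mem_range.1 hj
              calc c (j + 1) * c (m + 1 - (j + 1)) ≤ r ^ (j + 1) * r ^ (m + 1 - (j + 1)) := by
                    refine mul_le_mul (ih _ (by omega) (by omega)) (ih _ (by omega) (by omega))
                      (hc _) (by positivity)
                _ = r ^ (m + 1) := by rw [← pow_add]; congr 1; omega
          _ = _ := by simp
      have hq := pow_pos hq0 (m + 1)
      have hcn := hc (m + 1)
      have hrp : 0 < r ^ (m + 1) := by positivity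
      have b1 : q ^ (m + 1) * (∑ j ∈ Finset.range m, c (j + 1) * c (m + 1 - (j + 1))) ≤
          q ^ (m + 1) * (m * r ^ (m + 1)) := by gcongr
      have b2 : 2 * c 0 * q ^ (m + 1) * c (m + 1) ≤ 1 / 2 * c (m + 1) := by gcongr
      push_cast at a2
      have b3 : 2 * (((m : ℝ) + 1) * q ^ (m + 1)) * r ^ (m + 1) ≤ 1 * r ^ (m + 1) := by gcongr
      have b4 : 0 ≤ q ^ (m + 1) * r ^ (m + 1) := by positivity
      nlinarith

/-- The kernels have a small exponential moment on their natural scale. The moments satisfy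
`C_n ≤ 2^{-n/ℓ} ∑ binom(n,j) C_j C_{n-j}` by the semigroup property, and the terms `j = 0, n` can be
absorbed for large `n`, so that `C_n` grows at most like `n! r^n`. -/
lemma exists_exp_moment (hs : ∀ i, 1 ≤ s i) (hℓ : 0 < ℓ) (hG : ∀ x, 0 ≤ G x)
    (hQ : IsGTypeSemigroup s ℓ G Q) (hW : GControlled s ℓ G W Wstar) :
    ∃ (ε : ℝ) (B : ℝ≥0∞), 0 < ε ∧ B ≠ ∞ ∧ ∀ t : ℝ, 0 < t → t ≤ 1 →
      ∫⁻ h, supKernel Q t h * ENNReal.ofReal (Real.exp (ε * t ^ (-1 / ℓ) * ‖h‖)) ≤ B := by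
  set Cn : ℕ → ℝ≥0∞ := fun n =>
    ⨆ t : Tm, ENNReal.ofReal ((t : ℝ) ^ (-(n : ℝ) / ℓ)) * kernelMoment Q t n with hCn
  have hfin : ∀ n, Cn n ≠ ∞ := by
    intro n
    obtain ⟨C, hC, h⟩ := kernelMoment_le hs hℓ hG hQ hW n
    refine ((iSup_le fun t => ?_ : Cn n ≤ ENNReal.ofReal C).trans_lt ENNReal.ofReal_lt_top).ne
    have ht : 0 < (t : ℝ) := t.2.1
    refine (mul_le_mul_right (h t ht t.2.2) _).trans (le_of_eq ?_)
    rw [← ENNReal.ofReal_mul (by positivity), mul_left_comm, ← Real.rpow_add ht, ← add_div]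
    simp
  have hmom : ∀ (t : ℝ), 0 < t → t ≤ 1 → ∀ n,
      kernelMoment Q t n ≤ ENNReal.ofReal (t ^ ((n : ℝ) / ℓ)) * Cn n := by
    intro t ht ht1 n
    have h1 := le_iSup (fun t : Tm =>
      ENNReal.ofReal ((t : ℝ) ^ (-(n : ℝ) / ℓ)) * kernelMoment Q t n) ⟨t, ht, ht1⟩
    calc kernelMoment Q t n = ENNReal.ofReal (t ^ ((n : ℝ) / ℓ)) *
          (ENNReal.ofReal (t ^ (-(n : ℝ) / ℓ)) * kernelMoment Q t n) := by
          rw [← mul_assoc, ← ENNReal.ofReal_mul (by positivity), ← Real.rpow_add ht, ← add_div]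
          simp
      _ ≤ _ := by gcongr
  -- the recursion for the scaled moments; the factor comes from the scaling of the moments at `t / 2`
  have hrec : ∀ n, Cn n ≤ ENNReal.ofReal ((1 / 2) ^ ((n : ℝ) / ℓ)) *
      ∑ j ∈ Finset.range (n + 1), Cn j * Cn (n - j) * (n.choose j : ℝ≥0∞) := by
    intro n
    refine iSup_le fun t => ?_
    have ht : 0 < (t : ℝ) := t.2.1
    have ht1 := t.2.2
    refine (mul_le_mul_right (kernelMoment_le_sum hQ ht n) _).trans ?_
    rw [Finset.mul_sum, Finset.mul_sum]
    refine Finset.sum_le_sum fun j hj => ?_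
    have hjn : j ≤ n := by have := Finset.mem_range.1 hj; omega
    have h1 := hmom ((t : ℝ) / 2) (by linarith) (by linarith) j
    have h2 := hmom ((t : ℝ) / 2) (by linarith) (by linarith) (n - j)
    calc _ ≤ ENNReal.ofReal ((t : ℝ) ^ (-(n : ℝ) / ℓ)) *
          ((ENNReal.ofReal (((t : ℝ) / 2) ^ ((j : ℝ) / ℓ)) * Cn j) *
          (ENNReal.ofReal (((t : ℝ) / 2) ^ (((n - j : ℕ) : ℝ) / ℓ)) * Cn (n - j)) *
            (n.choose j : ℝ≥0∞)) := by gcongr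
      _ = (ENNReal.ofReal ((t : ℝ) ^ (-(n : ℝ) / ℓ)) *
          (ENNReal.ofReal (((t : ℝ) / 2) ^ ((j : ℝ) / ℓ)) *
          ENNReal.ofReal (((t : ℝ) / 2) ^ (((n - j : ℕ) : ℝ) / ℓ)))) *
            (Cn j * Cn (n - j) * (n.choose j : ℝ≥0∞)) := by ring
      _ = _ := by
          congr 1
          rw [← ENNReal.ofReal_mul (by positivity), ← ENNReal.ofReal_mul (by positivity)]
          congr 1
          rw [← Real.rpow_add (by positivity), Nat.cast_sub hjn, ← add_div,
            add_sub_cancel, div_eq_mul_one_div (t : ℝ) 2, Real.mul_rpow ht.le (by norm_num),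
            ← mul_assoc, ← Real.rpow_add ht, ← add_div]
          simp
  -- dividing by `n!` removes the binomial coefficients
  set c : ℕ → ℝ := fun n => (Cn n).toReal / n.factorial with hc
  have hc0 : ∀ n, 0 ≤ c n := fun n => by positivity
  have hq0 : (0 : ℝ) < (1 / 2) ^ (1 / ℓ) := by positivity
  have hq1 : ((1 / 2 : ℝ)) ^ (1 / ℓ) < 1 :=
    Real.rpow_lt_one (by norm_num) (by norm_num) (by positivity)
  obtain ⟨r, hr1, hr⟩ := exists_geometric_bound hc0 hq0 hq1 (fun n => by
    have h1 := ENNReal.toReal_mono (ENNReal.mul_ne_top ENNReal.ofReal_ne_top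
      (ENNReal.sum_ne_top.2 fun j _ => ENNReal.mul_ne_top (ENNReal.mul_ne_top (hfin j)
        (hfin (n - j))) (ENNReal.natCast_ne_top _))) (hrec n)
    rw [ENNReal.toReal_mul, ENNReal.toReal_ofReal (by positivity), ENNReal.toReal_sum
      (fun j _ => ENNReal.mul_ne_top (ENNReal.mul_ne_top (hfin j)
        (hfin (n - j))) (ENNReal.natCast_ne_top _))] at h1
    have hnf : (0 : ℝ) < n.factorial := by exact_mod_cast n.factorial_pos
    rw [hc]
    simp only
    rw [div_le_iff₀ hnf]
    refine h1.trans (le_of_eq ?_)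
    rw [← Real.rpow_natCast, ← Real.rpow_mul (by norm_num), mul_assoc, Finset.sum_mul]
    congr 1
    · congr 1; ring
    · refine Finset.sum_congr rfl fun j hj => ?_
      have hjn : j ≤ n := by have := Finset.mem_range.1 hj; omega
      have e : (n.factorial : ℝ) = n.choose j * j.factorial * (n - j).factorial := by
        exact_mod_cast (Nat.choose_mul_factorial_mul_factorial hjn).symm
      have hj1 : (j.factorial : ℝ) ≠ 0 := by exact_mod_cast j.factorial_ne_zero
      have hj2 : ((n - j).factorial : ℝ) ≠ 0 := by exact_mod_cast (n - j).factorial_ne_zero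
      rw [ENNReal.toReal_mul, ENNReal.toReal_mul, ENNReal.toReal_natCast, e]
      field_simp)
  set ε : ℝ := (2 * r)⁻¹ with hε
  have hε0 : 0 < ε := by positivity
  have hbound : ∀ n, ENNReal.ofReal (ε ^ n * c n) ≤
      ENNReal.ofReal (c 0 + 1) * ENNReal.ofReal (1 / 2) ^ n := by
    intro n
    rw [← ENNReal.ofReal_pow (by norm_num), ← ENNReal.ofReal_mul (by linarith [hc0 0])]
    refine ENNReal.ofReal_le_ofReal ?_
    rcases Nat.eq_zero_or_pos n with rfl | hn
    · simp
    · calc ε ^ n * c n ≤ ε ^ n * r ^ n := by gcongr; exact hr n hn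
        _ = (1 / 2) ^ n := by rw [← mul_pow, hε]; congr 1; field_simp
        _ ≤ (c 0 + 1) * (1 / 2) ^ n :=
          le_mul_of_one_le_left (by positivity) (by linarith [hc0 0])
  refine ⟨ε, ∑' n, ENNReal.ofReal (ε ^ n * c n), hε0, ?_, fun t ht ht1 => ?_⟩
  · refine ((ENNReal.tsum_le_tsum hbound).trans_lt ?_).ne
    rw [ENNReal.tsum_mul_left, ENNReal.tsum_geometric]
    refine ENNReal.mul_lt_top ENNReal.ofReal_lt_top ?_
    rw [ENNReal.inv_lt_top, tsub_pos_iff_lt, ← ENNReal.ofReal_one]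
    exact (ENNReal.ofReal_lt_ofReal_iff one_pos).2 (by norm_num)
  · have hm := measurable_supKernel hQ ht
    -- expansion of the exponential into moments
    have hexp : ∀ h : Sp d, supKernel Q t h * ENNReal.ofReal (Real.exp (ε * t ^ (-1 / ℓ) * ‖h‖)) =
        ∑' n : ℕ, ENNReal.ofReal ((ε * t ^ (-1 / ℓ)) ^ n / n.factorial) *
          (supKernel Q t h * ‖h‖ₑ ^ n) := by
      intro h
      have h0 : 0 ≤ ε * t ^ (-1 / ℓ) * ‖h‖ := by positivity
      have hs := NormedSpace.expSeries_div_hasSum_exp (ε * t ^ (-1 / ℓ) * ‖h‖)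
      rw [← Real.exp_eq_exp_ℝ] at hs
      rw [← hs.tsum_eq, ENNReal.ofReal_tsum_of_nonneg
        (fun n => by positivity) hs.summable, ← ENNReal.tsum_mul_left]
      refine tsum_congr fun n => ?_
      rw [mul_pow, mul_div_right_comm, ENNReal.ofReal_mul (by positivity), ← ofReal_norm,
        ← ENNReal.ofReal_pow (norm_nonneg _)]
      ring
    simp_rw [hexp]
    have hmn : ∀ n : ℕ, Measurable fun h : Sp d => supKernel Q t h * ‖h‖ₑ ^ n := fun n =>
      hm.mul (measurable_enorm.pow_const n)
    rw [lintegral_tsum fun n => ((hmn n).const_mul _).aemeasurable]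
    refine ENNReal.tsum_le_tsum fun n => ?_
    rw [lintegral_const_mul _ (hmn n)]
    have hnf : (0 : ℝ) < n.factorial := by exact_mod_cast n.factorial_pos
    calc _ ≤ ENNReal.ofReal ((ε * t ^ (-1 / ℓ)) ^ n / n.factorial) *
          (ENNReal.ofReal (t ^ ((n : ℝ) / ℓ)) * ENNReal.ofReal (Cn n).toReal) := by
          gcongr
          rw [ENNReal.ofReal_toReal (hfin n)]
          exact hmom t ht ht1 n
      _ = _ := by
          rw [← ENNReal.ofReal_mul (by positivity), ← ENNReal.ofReal_mul (by positivity)]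
          congr 1
          rw [mul_pow, ← Real.rpow_natCast (t ^ (-1 / ℓ)), ← Real.rpow_mul ht.le, hc]
          have : t ^ (-1 / ℓ * (n : ℝ)) * t ^ ((n : ℝ) / ℓ) = 1 := by
            rw [← Real.rpow_add ht]
            rw [show -1 / ℓ * (n : ℝ) + n / ℓ = 0 by ring, Real.rpow_zero]
          calc _ = ε ^ n * (t ^ (-1 / ℓ * (n : ℝ)) * t ^ ((n : ℝ) / ℓ)) * (Cn n).toReal /
                n.factorial := by ring
            _ = _ := by rw [this]; ring

/-- The kernels of a `G`-type semigroup have exponential moments of every order. This is a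
consequence of the semigroup property: the function `G` itself may decay much more slowly. -/
lemma lintegral_supKernel_exp_lt_top (hs : ∀ i, 1 ≤ s i) (hℓ : 0 < ℓ) (hG : ∀ x, 0 ≤ G x)
    (hQ : IsGTypeSemigroup s ℓ G Q) (hW : GControlled s ℓ G W Wstar) (r : ℝ) {t : ℝ}
    (ht : 0 < t) (ht1 : t ≤ 1) :
    ∫⁻ h, supKernel Q t h * ENNReal.ofReal (Real.exp (r * ‖h‖)) < ∞ := by
  obtain ⟨ε, B, hε, hB, h⟩ := exists_exp_moment hs hℓ hG hQ hW
  -- each halving of the time improves the exponent on the natural scale by the factor `2^{1/ℓ}`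
  have hdouble : ∀ (k : ℕ) (t : ℝ), 0 < t → t ≤ 1 → ∫⁻ h, supKernel Q t h *
      ENNReal.ofReal (Real.exp (ε * (2 ^ (1 / ℓ)) ^ k * t ^ (-1 / ℓ) * ‖h‖)) ≤ B ^ (2 ^ k) := by
    intro k
    induction k with
    | zero => intro t ht ht1; simpa using h t ht ht1
    | succ k ih =>
      intro t ht ht1
      have ht2 : 0 < t / 2 := by linarith
      have h1 := ih (t / 2) ht2 (by linarith)
      set a : ℝ := ε * (2 ^ (1 / ℓ)) ^ (k + 1) * t ^ (-1 / ℓ) with ha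
      have e : ε * (2 ^ (1 / ℓ)) ^ k * (t / 2) ^ (-1 / ℓ) = a := by
        have : (2 : ℝ)⁻¹ ^ (-1 / ℓ) = 2 ^ (1 / ℓ) := by
          rw [Real.inv_rpow two_pos.le, ← Real.rpow_neg two_pos.le]
          congr 1; ring
        rw [ha, div_eq_mul_inv t 2, Real.mul_rpow ht.le (by norm_num), this, pow_succ]
        ring
      rw [e] at h1
      have ha0 : 0 ≤ a := by positivity
      have hm := measurable_supKernel hQ ht2
      have hme : Measurable fun h : Sp d => ENNReal.ofReal (Real.exp (a * ‖h‖)) := by fun_prop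
      have hF := hm.mul hme
      calc _ ≤ ∫⁻ h, ∫⁻ k, (supKernel Q (t / 2) k * ENNReal.ofReal (Real.exp (a * ‖k‖))) *
            (supKernel Q (t / 2) (h - k) * ENNReal.ofReal (Real.exp (a * ‖h - k‖))) := by
            refine lintegral_mono fun h => ?_
            refine (mul_le_mul_left (supKernel_le_conv hQ ht h) _).trans ?_
            have hk : Measurable fun k : Sp d =>
                supKernel Q (t / 2) k * supKernel Q (t / 2) (h - k) :=
              hm.mul (hm.comp (measurable_const.sub measurable_id))
            rw [← lintegral_mul_const _ hk]
            refine lintegral_mono fun k => ?_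
            have h2 : ENNReal.ofReal (Real.exp (a * ‖h‖)) ≤
                ENNReal.ofReal (Real.exp (a * ‖k‖)) * ENNReal.ofReal (Real.exp (a * ‖h - k‖)) := by
              rw [← ENNReal.ofReal_mul (Real.exp_pos _).le, ← Real.exp_add, ← mul_add]
              gcongr
              calc ‖h‖ = ‖k + (h - k)‖ := by rw [add_sub_cancel]
                _ ≤ _ := norm_add_le _ _
            refine (mul_le_mul_right h2 _).trans (le_of_eq ?_)
            ring
        _ = (∫⁻ h, supKernel Q (t / 2) h * ENNReal.ofReal (Real.exp (a * ‖h‖))) *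
            ∫⁻ h, supKernel Q (t / 2) h * ENNReal.ofReal (Real.exp (a * ‖h‖)) :=
            lintegral_conv hF hF
        _ ≤ B ^ (2 ^ k) * B ^ (2 ^ k) := by gcongr
        _ = _ := by rw [← pow_add]; congr 1; ring
  have h2 : 1 < (2 : ℝ) ^ (1 / ℓ) := Real.one_lt_rpow one_lt_two (by positivity)
  obtain ⟨k, hk⟩ := pow_unbounded_of_one_lt (r / ε) h2
  refine lt_of_le_of_lt ?_ ((hdouble k t ht ht1).trans_lt (ENNReal.pow_lt_top hB.lt_top))
  gcongr
  have h3 : 1 ≤ t ^ (-1 / ℓ) :=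
    Real.one_le_rpow_of_pos_of_le_one_of_nonpos ht ht1
      (div_nonpos_of_nonpos_of_nonneg (by norm_num) hℓ.le)
  calc r = ε * (r / ε) := by field_simp
    _ ≤ ε * (2 ^ (1 / ℓ)) ^ k := by gcongr
    _ ≤ _ := le_mul_of_one_le_right (by positivity) h3

end ExpMoments

/-! ### Hölder's inequality and translations for weighted norms -/

section WeightedHolder

variable {d : ℕ} {X Y : Type*} [NormedAddCommGroup X] [NormedSpace ℝ X] [NormedAddCommGroup Y]
  [NormedSpace ℝ Y] {w v : Sp d → ℝ} {p q r : ℝ≥0∞}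

lemma aestronglyMeasurable_clm_apply {L : Sp d → X →L[ℝ] Y} {g : Sp d → X}
    (hL : AEStronglyMeasurable L volume) (hg : AEStronglyMeasurable g volume) :
    AEStronglyMeasurable (fun x => L x (g x)) volume :=
  isBoundedBilinearMap_apply.continuous.comp_aestronglyMeasurable (hL.prodMk hg)

lemma wLp_clm_apply_le [hpqr : ENNReal.HolderTriple p q r] (hw : Measurable w) (hv : Measurable v)
    {L : Sp d → X →L[ℝ] Y} {g : Sp d → X}
    (hL : AEStronglyMeasurable L volume) (hg : AEStronglyMeasurable g volume) :
    wLp (fun x => w x * v x) r (fun x => L x (g x)) ≤ wLp w p L * wLp v q g := by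
  have h := eLpNorm_le_eLpNorm_mul_eLpNorm_of_nnnorm (μ := volume) (p := p) (q := q) (r := r)
    (hw.aestronglyMeasurable.smul hL) (hv.aestronglyMeasurable.smul hg)
    (fun (L : X →L[ℝ] Y) x => L x) 1
    (ae_of_all _ fun x => by rw [one_mul]; exact ContinuousLinearMap.le_opNNNorm _ _)
  rw [ENNReal.coe_one, one_mul] at h
  refine le_trans (le_of_eq ?_) h
  unfold wLp
  congr 1
  funext x
  simp [smul_smul, mul_comm]

lemma wLp_clm_comp_le {Z : Type*} [NormedAddCommGroup Z] [NormedSpace ℝ Z]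
    [hpqr : ENNReal.HolderTriple p q r] (hw : Measurable w) (hv : Measurable v)
    {L : Sp d → Y →L[ℝ] Z} {K : Sp d → X →L[ℝ] Y}
    (hL : AEStronglyMeasurable L volume) (hK : AEStronglyMeasurable K volume) :
    wLp (fun x => w x * v x) r (fun x => (L x).comp (K x)) ≤ wLp w p L * wLp v q K := by
  have h := eLpNorm_le_eLpNorm_mul_eLpNorm_of_nnnorm (μ := volume) (p := p) (q := q) (r := r)
    (hw.aestronglyMeasurable.smul hL) (hv.aestronglyMeasurable.smul hK)
    (fun (L : Y →L[ℝ] Z) (K : X →L[ℝ] Y) => L.comp K) 1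
    (ae_of_all _ fun x => by rw [one_mul]; exact ContinuousLinearMap.opNorm_comp_le _ _)
  rw [ENNReal.coe_one, one_mul] at h
  refine le_trans (le_of_eq ?_) h
  unfold wLp
  congr 1
  funext x
  simp [smul_smul, mul_comm]

lemma quasiMeasurePreserving_sub_const (h : Sp d) :
    Measure.QuasiMeasurePreserving (fun x : Sp d => x - h) volume volume :=
  (measurePreserving_sub_right volume h).quasiMeasurePreserving

/-- A translate of `g` is controlled in the space with weight `w'` by `g` in the space with weight
`w`, if the weights are comparable along the translation. -/
lemma wLp_comp_sub_le {w' : Sp d → ℝ} {h : Sp d} {K : ℝ} (hK : 0 ≤ K) (hw : ∀ x, 0 ≤ w x)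
    (hw' : ∀ x, |w' x| ≤ K * w (x - h)) {g : Sp d → X} (hwm : Measurable w)
    (hg : AEStronglyMeasurable g volume) :
    wLp w' p (fun x => g (x - h)) ≤ ENNReal.ofReal K * wLp w p g := by
  have h1 : wLp w' p (fun x => g (x - h)) ≤
      eLpNorm (fun x => K • (w (x - h) • g (x - h))) p volume := by
    refine eLpNorm_mono_ae (ae_of_all _ fun x => ?_)
    rw [norm_smul, norm_smul, norm_smul, ← mul_assoc, Real.norm_eq_abs, Real.norm_eq_abs,
      Real.norm_eq_abs, abs_of_nonneg hK, abs_of_nonneg (hw _)]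
    exact mul_le_mul_of_nonneg_right (hw' x) (norm_nonneg _)
  refine h1.trans (le_of_eq ?_)
  have h2 := eLpNorm_const_smul (μ := volume) (p := p) K (fun x => w (x - h) • g (x - h))
  have h3 : eLpNorm (fun x => w (x - h) • g (x - h)) p volume = wLp w p g :=
    eLpNorm_comp_measurePreserving (f := fun x : Sp d => x - h) (g := fun x => w x • g x)
      (hwm.aestronglyMeasurable.smul hg) (measurePreserving_sub_right volume h)
  rw [h3, ← ofReal_norm, Real.norm_eq_abs, abs_of_nonneg hK] at h2
  exact h2

lemma GControlled.wLp_comp_sub_le {s : Fin d → ℝ} {ℓ : ℝ} {G : Sp d → ℝ} {W Wstar : Sp d → ℝ}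
    (hW : GControlled s ℓ G W Wstar) {g : Sp d → X} (hg : AEStronglyMeasurable g volume)
    (h : Sp d) :
    wLp W p (fun x => g (x - h)) ≤ ENNReal.ofReal (Wstar h) * wLp W p g := by
  refine RegInt.wLp_comp_sub_le (zero_le_one.trans (hW.one_le_star h))
    (fun x => (hW.weight_pos x).le) (fun x => ?_) hW.measurable_weight hg
  rw [abs_of_nonneg (hW.weight_pos x).le]
  simpa using hW.weight_le x (x - h)

end WeightedHolder

/-! ### Arithmetic of the index set -/

section Index

lemma Idx.prec.trans {a b c : Idx} (h₁ : a.prec b) (h₂ : b.prec c) : a.prec c :=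
  ⟨h₁.1.trans h₂.1, h₂.2.trans h₁.2⟩

lemma Idx.prec.ne {a b : Idx} (h : a.prec b) : a ≠ b := by
  rintro rfl
  exact lt_irrefl _ h.1

lemma Idx.holderTriple_of_prec {a c : Idx} (h : a.prec c) :
    ENNReal.HolderTriple a.i (c.iOminus a) c.i := by
  refine ⟨?_⟩
  rw [Idx.iOminus, inv_inv]
  exact add_tsub_cancel_of_le (ENNReal.inv_le_inv.2 h.2)

lemma Idx.holderTriple_iOminus {a b c : Idx} (h₁ : b.prec a) (h₂ : a.prec c) :
    ENNReal.HolderTriple (a.iOminus b) (c.iOminus a) (c.iOminus b) := by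
  refine ⟨?_⟩
  simp only [Idx.iOminus, inv_inv]
  have h1 := ENNReal.inv_le_inv.2 h₁.2
  have h2 := ENNReal.inv_le_inv.2 h₂.2
  rw [add_comm]
  exact tsub_add_tsub_cancel h2 h1

lemma Idx.one_le_iOminus (a b : Idx) : 1 ≤ a.iOminus b := by
  rw [Idx.iOminus, ENNReal.one_le_inv]
  exact tsub_le_self.trans (ENNReal.inv_le_one.2 a.one_le)

end Index

/-! ### The model space -/

section ModelSpace

variable {A : Set Idx} {T : A → Type*} [∀ a, NormedAddCommGroup (T a)] [∀ a, NormedSpace ℝ (T a)]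

lemma incl_apply_self (a : A) (τ : T a) : incl a τ a = τ := by
  classical
  unfold incl
  convert DirectSum.lof_apply ℝ a τ

lemma incl_apply_of_ne {a b : A} (h : b ≠ a) (τ : T a) : incl a τ b = 0 := by
  classical
  unfold incl
  exact DirectSum.of_eq_of_ne _ _ _ h

lemma glue_incl {F : Type*} [AddCommGroup F] [Module ℝ F] (φ : ∀ a, T a →ₗ[ℝ] F) (a : A)
    (τ : T a) : glue φ (incl a τ) = φ a τ := by
  classical
  unfold glue incl
  exact DirectSum.toModule_lof ℝ a τ

lemma eq_sum_incl {B : Finset A} {τ : ⨁ a, T a} (h : ∀ a, a ∉ B → τ a = 0) :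
    τ = ∑ a ∈ B, incl a (τ a) := by
  refine DFinsupp.ext fun b => ?_
  have e : (∑ a ∈ B, incl a (τ a)) b = ∑ a ∈ B, incl a (τ a) b :=
    DFinsupp.finsetSum_apply _ _ _
  rw [e]
  by_cases hb : b ∈ B
  · rw [Finset.sum_eq_single_of_mem b hb fun a _ hab => incl_apply_of_ne hab.symm _,
      incl_apply_self]
  · rw [Finset.sum_eq_zero fun a ha => incl_apply_of_ne (by rintro rfl; exact hb ha) _]
    exact h b hb

lemma glue_eq_sum {F : Type*} [AddCommGroup F] [Module ℝ F] (φ : ∀ a, T a →ₗ[ℝ] F) {B : Finset A}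
    {τ : ⨁ a, T a} (h : ∀ a, a ∉ B → τ a = 0) : glue φ τ = ∑ a ∈ B, φ a (τ a) := by
  conv_lhs => rw [eq_sum_incl h]
  rw [map_sum]
  exact Finset.sum_congr rfl fun a _ => glue_incl φ a _

lemma linearMap_ext_incl {F : Type*} [AddCommGroup F] [Module ℝ F] {φ ψ : (⨁ a, T a) →ₗ[ℝ] F}
    (h : ∀ a τ, φ (incl a τ) = ψ (incl a τ)) : φ = ψ := by
  classical
  refine DirectSum.linearMap_ext ℝ fun a => ?_
  ext τ
  have := h a τ
  unfold incl at this
  rw [LinearMap.comp_apply, LinearMap.comp_apply]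
  convert this

variable [∀ a, CompleteSpace (T a)]

/-- The finite set of indices below `c`. -/
noncomputable def RIStructure.below (𝒯 : RIStructure A T) (c : Idx) : Finset A :=
  ((𝒯.finite_below c).preimage (f := ((↑) : A → Idx)) Subtype.val_injective.injOn).toFinset

lemma RIStructure.mem_below (𝒯 : RIStructure A T) {c : Idx} {a : A} :
    a ∈ 𝒯.below c ↔ (a : Idx).prec c := by
  simp [RIStructure.below]

lemma RIStructure.group_apply (𝒯 : RIStructure A T) {g : (⨁ a, T a) ≃ₗ[ℝ] (⨁ a, T a)}
    (hg : g ∈ 𝒯.group) {b : A} (φ : ∀ a, T a →ₗ[ℝ] T b)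
    (h : ∀ a : A, (b : Idx).prec a → ∀ τ : T a, φ a τ = g (incl a τ) b)
    (h' : ∀ a : A, ¬ (b : Idx).prec a → φ a = 0) (σ : ⨁ a, T a) :
    g σ b = σ b + glue φ σ := by
  classical
  have key : (DirectSum.component ℝ A T b).comp (g : (⨁ a, T a) →ₗ[ℝ] (⨁ a, T a)) =
      DirectSum.component ℝ A T b + glue φ := by
    refine linearMap_ext_incl fun a τ => ?_
    simp only [LinearMap.comp_apply, LinearMap.add_apply, glue_incl, LinearEquiv.coe_coe]
    rw [← DirectSum.apply_eq_component, ← DirectSum.apply_eq_component]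
    by_cases hb : (b : Idx).prec a
    · rw [h a hb, incl_apply_of_ne (fun e => hb.ne (by rw [e])), zero_add]
    · rw [h' a hb, LinearMap.zero_apply, add_zero]
      by_contra hne
      refine hb (𝒯.triangular g hg a τ b fun h0 => hne ?_)
      have : (g (incl a τ) - incl a τ) b = g (incl a τ) b - incl a τ b := DFinsupp.sub_apply _ _ _
      rw [this] at h0
      exact sub_eq_zero.1 h0
  have := LinearMap.congr_fun key σ
  exact this

end ModelSpace

/-! ### Components of models and of modelled distributions -/

section Components

variable {d : ℕ} {s : Fin d → ℝ} {ℓ : ℝ} {A : Set Idx} {T : A → Type*}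
  [∀ a, NormedAddCommGroup (T a)] [∀ a, NormedSpace ℝ (T a)]
  {w wstar v vstar : Sp d → ℝ} {c : Idx}

lemma ModelData.evalPi_eq_sum (M : ModelData d T) (t : Tm) (x : Sp d) {B : Finset A}
    {τ : ⨁ a, T a} (h : ∀ a, a ∉ B → τ a = 0) :
    M.evalPi t x τ = ∑ a ∈ B, M.pi t a x (τ a) :=
  glue_eq_sum _ h

lemma ModelData.evalPi_sub (M S : ModelData d T) {B : Finset A} {τ : ⨁ a, T a}
    (hτ : ∀ a, a ∉ B → τ a = 0) (t : Tm) (x : Sp d) :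
    (M.sub S).evalPi t x τ = M.evalPi t x τ - S.evalPi t x τ := by
  rw [M.evalPi_eq_sum t x hτ, S.evalPi_eq_sum t x hτ, ModelData.evalPi_eq_sum _ t x hτ,
    ← Finset.sum_sub_distrib]
  rfl

open scoped Classical in
lemma ModelData.evalGam_eq_sum (M : ModelData d T) (h x : Sp d) (b : A) {B : Finset A}
    {τ : ⨁ a, T a} (hτ : ∀ a, a ∉ B → τ a = 0) :
    M.evalGam h x τ b = τ b + ∑ a ∈ B with (b : Idx).prec (a : A), M.gam h a b x (τ a) := by
  unfold ModelData.evalGam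
  rw [glue_eq_sum _ hτ, Finset.sum_filter]
  congr 1
  refine Finset.sum_congr rfl fun a _ => ?_
  split_ifs <;> rfl

lemma ModelData.aestronglyMeasurable_evalPi {M : ModelData d T} (hM : M.Measurable) (t : Tm)
    {B : Finset A} {f : Sp d → ⨁ a, T a} (hf : ∀ x a, a ∉ B → f x a = 0)
    (hfm : ∀ a, AEStronglyMeasurable (fun x => f x a) volume) :
    AEStronglyMeasurable (fun x => M.evalPi t x (f x)) volume := by
  simp_rw [fun x => M.evalPi_eq_sum t x (hf x)]
  exact Finset.aestronglyMeasurable_fun_sum _ fun a _ =>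
    aestronglyMeasurable_clm_apply (hM.1 t a) (hfm a)

lemma ModelData.Measurable.sub {M₁ M₂ : ModelData d T} (h₁ : M₁.Measurable)
    (h₂ : M₂.Measurable) : (M₁.sub M₂).Measurable :=
  ⟨fun t a => (h₁.1 t a).sub (h₂.1 t a), fun h hh a b hab => (h₁.2 h hh a b hab).sub
    (h₂.2 h hh a b hab)⟩

lemma aestronglyMeasurable_evalGam {M : ModelData d T} (hM : M.Measurable) {h : Sp d} (hh : h ≠ 0)
    {B : Finset A} {f : Sp d → ⨁ a, T a} (hf : ∀ x a, a ∉ B → f x a = 0)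
    (hfm : ∀ a, AEStronglyMeasurable (fun x => f x a) volume) (b : A) :
    AEStronglyMeasurable (fun x => M.evalGam h x (f x) b) volume := by
  classical
  simp_rw [fun x => M.evalGam_eq_sum h x b (hf x)]
  refine (hfm b).add (Finset.aestronglyMeasurable_fun_sum _ fun a ha => ?_)
  exact aestronglyMeasurable_clm_apply (hM.2 h hh a b (Finset.mem_filter.1 ha).2) (hfm a)

lemma aestronglyMeasurable_comp_sub {X : Type*} [TopologicalSpace X] {g : Sp d → X}
    (hg : AEStronglyMeasurable g volume) (h : Sp d) :
    AEStronglyMeasurable (fun x => g (x - h)) volume :=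
  hg.comp_quasiMeasurePreserving (quasiMeasurePreserving_sub_const h)

lemma aestronglyMeasurable_mdDelta {M : ModelData d T} (hM : M.Measurable) {h : Sp d} (hh : h ≠ 0)
    {B : Finset A} {f : Sp d → ⨁ a, T a} (hf : ∀ x a, a ∉ B → f x a = 0)
    (hfm : ∀ a, AEStronglyMeasurable (fun x => f x a) volume) (b : A) :
    AEStronglyMeasurable (fun x => mdDelta M f h x b) volume :=
  (aestronglyMeasurable_comp_sub (hfm b) h).sub
    (aestronglyMeasurable_evalGam hM (neg_ne_zero.2 hh) hf hfm b)

open scoped Classical in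
lemma mdDelta_sub_mdDelta (M S : ModelData d T) {B : Finset A} {f : Sp d → ⨁ a, T a}
    (hf : ∀ x a, a ∉ B → f x a = 0) (h x : Sp d) (b : A) :
    mdDelta M f h x b - mdDelta S f h x b =
      ∑ a ∈ B with (b : Idx).prec (a : A), (S.sub M).gam (-h) a b x (f x a) := by
  unfold mdDelta
  rw [M.evalGam_eq_sum _ _ _ (hf x), S.evalGam_eq_sum _ _ _ (hf x)]
  have : ∑ a ∈ B with (b : Idx).prec (a : A), (S.sub M).gam (-h) a b x (f x a) =
      ∑ a ∈ B with (b : Idx).prec (a : A), S.gam (-h) a b x (f x a) -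
      ∑ a ∈ B with (b : Idx).prec (a : A), M.gam (-h) a b x (f x a) := by
    rw [← Finset.sum_sub_distrib]
    rfl
  rw [this]
  abel

lemma IsModelled.eq_zero [∀ a, CompleteSpace (T a)] {𝒯 : RIStructure A T} {M : ModelData d T}
    {f : Sp d → ⨁ a, T a}
    (hf : IsModelled s v vstar c M f) (x : Sp d) (a : A) (ha : a ∉ 𝒯.below c) : f x a = 0 :=
  hf.support x a fun h => ha (𝒯.mem_below.2 h)

lemma le_ofReal_rpow_mul {t : ℝ} (ht : 0 < t) {ρ : ℝ} {X Y : ℝ≥0∞}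
    (h : ENNReal.ofReal (t ^ (-ρ / ℓ)) * X ≤ Y) : X ≤ ENNReal.ofReal (t ^ (ρ / ℓ)) * Y := by
  calc X = ENNReal.ofReal (t ^ (ρ / ℓ)) * (ENNReal.ofReal (t ^ (-ρ / ℓ)) * X) := by
        rw [← mul_assoc, ← ENNReal.ofReal_mul (by positivity), ← Real.rpow_add ht, ← add_div]
        simp
    _ ≤ _ := by gcongr

lemma ofReal_rpow_mul_le {t : ℝ} (ht : 0 < t) {ρ : ℝ} {X Y : ℝ≥0∞}
    (h : X ≤ ENNReal.ofReal (t ^ (ρ / ℓ)) * Y) : ENNReal.ofReal (t ^ (-ρ / ℓ)) * X ≤ Y := by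
  calc ENNReal.ofReal (t ^ (-ρ / ℓ)) * X ≤
        ENNReal.ofReal (t ^ (-ρ / ℓ)) * (ENNReal.ofReal (t ^ (ρ / ℓ)) * Y) := by gcongr
    _ = Y := by
        rw [← mul_assoc, ← ENNReal.ofReal_mul (by positivity), ← Real.rpow_add ht, ← add_div]
        simp

lemma ModelData.wLp_pi_le (M : ModelData d T) {a : A} (ha : (a : Idx).prec c) (t : Tm) :
    wLp w (a : Idx).i (M.pi t a) ≤
      ENNReal.ofReal ((t : ℝ) ^ ((a : Idx).r / ℓ)) * M.piNorm ℓ w c :=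
  le_ofReal_rpow_mul t.2.1 (le_iSup_of_le a (le_iSup_of_le ha (le_iSup_of_le t le_rfl)))

lemma ofReal_mul_sNorm_ne_zero {ws : Sp d → ℝ} (hws : ∀ x, 1 ≤ ws x) {h : Sp d} (hh : h ≠ 0)
    (ρ : ℝ) : ENNReal.ofReal (ws h * sNorm s h ^ ρ) ≠ 0 := by
  have h1 := hws h
  have h2 := sNorm_pos (s := s) hh
  have : 0 < ws h * sNorm s h ^ ρ := by positivity
  simpa using this

lemma ModelData.wLp_gam_le (hws : ∀ x, 1 ≤ wstar x) (M : ModelData d T) {a b : A}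
    (hb : (b : Idx).prec (a : Idx)) (ha : (a : Idx).prec c) {h : Sp d} (hh : h ≠ 0) :
    wLp w ((a : Idx).iOminus b) (M.gam h a b) ≤ M.gamNorm s w wstar c *
      ENNReal.ofReal (wstar h * sNorm s h ^ ((a : Idx).r - (b : Idx).r)) := by
  refine (ENNReal.div_le_iff_le_mul (Or.inl (ofReal_mul_sNorm_ne_zero hws hh _))
    (Or.inl ENNReal.ofReal_ne_top)).1 ?_
  exact le_iSup_of_le a (le_iSup_of_le b (le_iSup_of_le hb (le_iSup_of_le ha
    (le_iSup_of_le h (le_iSup_of_le hh le_rfl)))))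

lemma wLp_le_mdHolder (hvs : ∀ x, 1 ≤ vstar x) (D : Sp d → Sp d → ∀ a : A, T a) {a : A}
    (ha : (a : Idx).prec c) {h : Sp d} (hh : h ≠ 0) :
    wLp v (c.iOminus a) (fun x => D h x a) ≤ mdHolder s v vstar c D *
      ENNReal.ofReal (vstar h * sNorm s h ^ (c.r - (a : Idx).r)) := by
  refine (ENNReal.div_le_iff_le_mul (Or.inl (ofReal_mul_sNorm_ne_zero hvs hh _))
    (Or.inl ENNReal.ofReal_ne_top)).1 ?_
  exact le_iSup_of_le a (le_iSup_of_le ha (le_iSup_of_le h (le_iSup_of_le hh le_rfl)))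

lemma wLp_le_mdSize (f : Sp d → ⨁ a, T a) {a : A} (ha : (a : Idx).prec c) :
    wLp v (c.iOminus a) (fun x => f x a) ≤ mdSize v c f :=
  le_iSup_of_le a (le_iSup_of_le ha le_rfl)

lemma ModelData.piNorm_le_add (hw : _root_.Measurable w) {M S : ModelData d T} (hM : M.Measurable)
    (hS : S.Measurable) : M.piNorm ℓ w c ≤ S.piNorm ℓ w c + (M.sub S).piNorm ℓ w c := by
  refine iSup_le fun a => iSup_le fun ha => iSup_le fun t => ofReal_rpow_mul_le t.2.1 ?_
  rw [mul_add]
  refine le_trans ?_ (add_le_add (S.wLp_pi_le ha t) ((M.sub S).wLp_pi_le ha t))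
  refine le_trans (le_of_eq ?_) (wLp_add_le hw (a : Idx).one_le (hS.1 t a) ((hM.sub hS).1 t a))
  congr 1
  funext x
  simp [ModelData.sub]

lemma ModelData.gamNorm_le_add (hw : _root_.Measurable w) (hws : ∀ x, 1 ≤ wstar x)
    {M S : ModelData d T}
    (hM : M.Measurable) (hS : S.Measurable) :
    M.gamNorm s w wstar c ≤ S.gamNorm s w wstar c + (M.sub S).gamNorm s w wstar c := by
  refine iSup_le fun a => iSup_le fun b => iSup_le fun hb => iSup_le fun ha => iSup_le fun h =>
    iSup_le fun hh => ?_
  refine (ENNReal.div_le_iff_le_mul (Or.inl (ofReal_mul_sNorm_ne_zero hws hh _))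
    (Or.inl ENNReal.ofReal_ne_top)).2 ?_
  rw [add_mul]
  refine le_trans ?_ (add_le_add (S.wLp_gam_le hws hb ha hh) ((M.sub S).wLp_gam_le hws hb ha hh))
  refine le_trans (le_of_eq ?_) (wLp_add_le hw (Idx.one_le_iOminus _ _) (hS.2 h hh a b hb)
    ((hM.sub hS).2 h hh a b hb))
  congr 1
  funext x
  simp [ModelData.sub]

lemma ModelData.norm_le_add (hw : _root_.Measurable w) (hws : ∀ x, 1 ≤ wstar x)
    {M S : ModelData d T}
    (hM : M.Measurable) (hS : S.Measurable) :
    M.norm s ℓ w wstar c ≤ S.norm s ℓ w wstar c + (M.sub S).norm s ℓ w wstar c := by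
  unfold ModelData.norm
  rw [add_add_add_comm]
  exact add_le_add (ModelData.piNorm_le_add hw hM hS) (ModelData.gamNorm_le_add hw hws hM hS)

lemma ModelData.norm_sub_comm (M S : ModelData d T) :
    (M.sub S).norm s ℓ w wstar c = (S.sub M).norm s ℓ w wstar c := by
  have h1 : ∀ t a, (M.sub S).pi t a = fun x => -(S.sub M).pi t a x := fun t a => by
    funext x; simp [ModelData.sub]
  have h2 : ∀ h a b, (M.sub S).gam h a b = fun x => -(S.sub M).gam h a b x := fun h a b => by
    funext x; simp [ModelData.sub]
  simp only [ModelData.norm, ModelData.piNorm, ModelData.gamNorm, h1, h2, wLp_neg]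

end Components

/-! ### The semigroup acting on smooth models -/

section Tame

variable {d : ℕ} {s : Fin d → ℝ} {ℓ : ℝ} {G : Sp d → ℝ} {Q : ℝ → Sp d → Sp d → ℝ}
  {W Wstar : Sp d → ℝ} {p : ℝ≥0∞}

/-- Functions on which the semigroup acts for times up to `1` with the usual properties. This class
contains all the spaces `L^p(w')` with `G`-controlled weights `w'` and is a vector space. -/
structure Tame (Q : ℝ → Sp d → Sp d → ℝ) (g : Sp d → ℝ) : Prop where
  integrable : ∀ t : ℝ, 0 < t → t ≤ 1 → ∀ x, Integrable (fun y => Q t x y * g y)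
  continuous_applyQ : ∀ t : ℝ, 0 < t → t ≤ 1 → Continuous (applyQ Q t g)
  integrable_applyQ : ∀ t u : ℝ, 0 < t → 0 < u → t + u ≤ 1 → ∀ x,
    Integrable (fun y => Q t x y * applyQ Q u g y)
  applyQ_applyQ : ∀ t u : ℝ, 0 < t → 0 < u → t + u ≤ 1 →
    applyQ Q t (applyQ Q u g) = applyQ Q (t + u) g

lemma applyQ_add_of_integrable {t : ℝ} {f g : Sp d → ℝ} {x : Sp d}
    (hf : Integrable (fun y => Q t x y * f y)) (hg : Integrable (fun y => Q t x y * g y)) :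
    applyQ Q t (f + g) x = applyQ Q t f x + applyQ Q t g x := by
  unfold applyQ
  rw [← integral_add hf hg]
  refine integral_congr_ae (ae_of_all _ fun y => ?_)
  simp [mul_add]

lemma applyQ_zero (t : ℝ) : applyQ Q t 0 = 0 := by
  funext x
  simp [applyQ]

lemma tame_zero : Tame Q (0 : Sp d → ℝ) := by
  refine ⟨fun t _ _ x => by simp, fun t _ _ => ?_, fun t u _ _ _ x => ?_, fun t u _ _ _ => ?_⟩
  · rw [applyQ_zero]; exact continuous_zero
  · simp [applyQ_zero]
  · simp [applyQ_zero]

lemma Tame.add {f g : Sp d → ℝ} (hf : Tame Q f) (hg : Tame Q g) : Tame Q (f + g) := by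
  have e : ∀ t : ℝ, 0 < t → t ≤ 1 → applyQ Q t (f + g) = applyQ Q t f + applyQ Q t g :=
    fun t ht ht1 => funext fun x =>
      applyQ_add_of_integrable (hf.integrable t ht ht1 x) (hg.integrable t ht ht1 x)
  have e2 : ∀ (t u : ℝ), 0 < t → 0 < u → t + u ≤ 1 → ∀ x,
      applyQ Q t (applyQ Q u f + applyQ Q u g) x = applyQ Q t (applyQ Q u f) x +
        applyQ Q t (applyQ Q u g) x := fun t u ht hu htu x =>
    applyQ_add_of_integrable (hf.integrable_applyQ t u ht hu htu x)
      (hg.integrable_applyQ t u ht hu htu x)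
  refine ⟨fun t ht ht1 x => ?_, fun t ht ht1 => ?_, fun t u ht hu htu x => ?_,
    fun t u ht hu htu => ?_⟩
  · refine ((hf.integrable t ht ht1 x).add (hg.integrable t ht ht1 x)).congr
      (ae_of_all _ fun y => ?_)
    simp [mul_add]
  · rw [e t ht ht1]
    exact (hf.continuous_applyQ t ht ht1).add (hg.continuous_applyQ t ht ht1)
  · rw [e u hu (by linarith)]
    refine ((hf.integrable_applyQ t u ht hu htu x).add
      (hg.integrable_applyQ t u ht hu htu x)).congr (ae_of_all _ fun y => ?_)
    simp [mul_add]
  · rw [e u hu (by linarith), e (t + u) (by linarith) htu]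
    funext x
    rw [e2 t u ht hu htu x, hf.applyQ_applyQ t u ht hu htu, hg.applyQ_applyQ t u ht hu htu]
    rfl

lemma MemWLp.tame (hs : ∀ i, 1 ≤ s i) (hG : ∀ x, 0 ≤ G x) (hQ : IsGTypeSemigroup s ℓ G Q)
    (hW : GControlled s ℓ G W Wstar) (hp : 1 ≤ p) {f : Sp d → ℝ} (hf : MemWLp W p f) :
    Tame Q f :=
  ⟨fun _ ht ht1 x => integrable_kernel_mul hs hG hQ hW hp hf ht (by linarith) x,
    fun _ ht ht1 => RegInt.continuous_applyQ hs hG hQ hW hp hf ht (by linarith),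
    fun _ _ ht hu htu x => integrable_kernel_mul hs hG hQ hW hp
      (hf.applyQ hs hG hQ hW hp hu (by linarith)) ht (by linarith) x,
    fun _ _ ht hu htu => RegInt.applyQ_applyQ hs hG hQ hW hp hf ht hu (by linarith)⟩

end Tame

/-! ### Joint measurability -/

section Caratheodory

variable {d : ℕ}

/-- A function which is continuous in one variable and almost everywhere measurable in the other is
almost everywhere jointly measurable. -/
lemma aestronglyMeasurable_uncurry_of_continuous {g : Sp d → Sp d → ℝ}
    (hc : ∀ x, Continuous (g x)) (hm : ∀ h, AEStronglyMeasurable (fun x => g x h) volume) :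
    AEStronglyMeasurable (Function.uncurry g) (volume.prod volume) := by
  obtain ⟨D, hDc, hDd⟩ := TopologicalSpace.exists_countable_dense (Sp d)
  have hae : ∀ᵐ x : Sp d, ∀ h ∈ D, g x h = (hm h).mk _ x :=
    (ae_ball_iff hDc).2 fun h _ => (hm h).ae_eq_mk
  -- discard the points where measurable representatives fail on a countable dense set of `h`
  obtain ⟨N, hN, hNm, hN0⟩ := exists_measurable_superset_of_null (ae_iff.1 hae)
  set g' : Sp d → Sp d → ℝ := fun h x => Nᶜ.indicator (fun x => g x h) x with hg'
  have hg'D : ∀ h ∈ D, StronglyMeasurable (g' h) := by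
    intro h hh
    have : g' h = Nᶜ.indicator ((hm h).mk _) := by
      funext x
      by_cases hx : x ∈ N
      · simp [hg', hx]
      · have hx' : ∀ h ∈ D, g x h = (hm h).mk _ x := by
          by_contra hcon
          exact hx (hN hcon)
        simp [hg', hx, hx' h hh]
    rw [this]
    exact (hm h).stronglyMeasurable_mk.indicator hNm.compl
  have hg'c : ∀ x, Continuous fun h => g' h x := by
    intro x
    by_cases hx : x ∈ N
    · simp [hg', hx, continuous_const]
    · simpa [hg', hx] using hc x
  have hg'm : ∀ h, StronglyMeasurable (g' h) := by
    intro h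
    obtain ⟨u, huD, hu⟩ := mem_closure_iff_seq_limit.1 (hDd h)
    exact stronglyMeasurable_of_tendsto atTop (fun n => hg'D (u n) (huD n))
      (tendsto_pi_nhds.2 fun x => ((hg'c x).tendsto h).comp hu)
  have hj := stronglyMeasurable_uncurry_of_continuous_of_stronglyMeasurable hg'c hg'm
  refine ⟨fun z => Function.uncurry g' z.swap, hj.comp_measurable measurable_swap, ?_⟩
  -- the modification only concerns a null set of points `x`
  have h1 : ∀ᵐ z : Sp d × Sp d ∂(volume.prod volume), z.1 ∉ N :=
    Measure.quasiMeasurePreserving_fst.ae (measure_eq_zero_iff_ae_notMem.1 hN0)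
  filter_upwards [h1] with z hz
  simp [Function.uncurry, hg', hz]

end Caratheodory

/-! ### The algebra of smooth models -/

section Smooth

variable {d : ℕ} {s : Fin d → ℝ} {ℓ : ℝ} {G : Sp d → ℝ} {Q : ℝ → Sp d → Sp d → ℝ}
  {A : Set Idx} {T : A → Type*} [∀ a, NormedAddCommGroup (T a)] [∀ a, NormedSpace ℝ (T a)]
  {w wstar W Wstar : Sp d → ℝ} {c : Idx}

lemma induction_incl {motive : (⨁ a, T a) → Prop} (zero : motive 0)
    (inc : ∀ a τ, motive (incl a τ)) (add : ∀ σ τ, motive σ → motive τ → motive (σ + τ))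
    (σ : ⨁ a, T a) : motive σ := by
  classical
  refine DirectSum.induction_on σ zero (fun a τ => ?_) add
  have h := inc a τ
  unfold incl at h
  rw [← DirectSum.lof_eq_of ℝ]
  convert h

open scoped Classical in
lemma ModelData.evalGam_incl (M : ModelData d T) (h x : Sp d) (a b : A) (τ : T a) :
    M.evalGam h x (incl a τ) b = incl a τ b +
      if (b : Idx).prec (a : Idx) then M.gam h a b x τ else 0 := by
  unfold ModelData.evalGam
  rw [glue_incl]
  split_ifs <;> rfl

variable [∀ a, CompleteSpace (T a)] {𝒯 : RIStructure A T}

/-- The functions `Π_x σ` and the maps `Γ_{xy}` of a smooth model, in terms of its data. -/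
lemma IsSmoothModel.exists_test (hs : ∀ i, 1 ≤ s i) (hG : ∀ x, 0 ≤ G x)
    (hQ : IsGTypeSemigroup s ℓ G Q) {S : ModelData d T}
    (hS : IsSmoothModel s ℓ G Q 𝒯 w wstar S) :
    ∃ (Φ : Sp d → (⨁ a, T a) → Sp d → ℝ) (Γ : Sp d → Sp d → (⨁ a, T a) → (⨁ a, T a)),
      (∀ x σ, Tame Q (Φ x σ)) ∧ (∀ t x σ, S.evalPi t x σ = applyQ Q t (Φ x σ) x) ∧
      (∀ x y σ, Φ x (Γ x y σ) = Φ y σ) ∧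
      (∀ h, h ≠ 0 → ∀ x σ b, Γ (x + h) x σ b = S.evalGam h x σ b) ∧
      (∀ x y z σ, Γ x y (Γ y z σ) = Γ x z σ) := by
  obtain ⟨P, Γ, hΓ, hPΓ, -, hchain, hmem, hpi, hgam, -, -⟩ := hS
  set Φ : Sp d → (⨁ a, T a) → Sp d → ℝ := fun x σ =>
    (glue (fun a => (P x a : T a →ₗ[ℝ] C(Sp d, ℝ))) σ : C(Sp d, ℝ)) with hΦ
  have hΦ0 : ∀ x, Φ x 0 = 0 := fun x => by simp [hΦ]
  have hΦa : ∀ x σ τ, Φ x (σ + τ) = Φ x σ + Φ x τ := fun x σ τ => by simp [hΦ]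
  have hΦi : ∀ x a τ, Φ x (incl a τ) = P x a τ := fun x a τ => by
    simp only [hΦ, glue_incl]; rfl
  have htame : ∀ x σ, Tame Q (Φ x σ) := fun x σ => by
    induction σ using induction_incl with
    | zero => rw [hΦ0]; exact tame_zero
    | inc a τ =>
      rw [hΦi]
      obtain ⟨p, w', ws', hp, hw', hm⟩ := hmem x a τ
      exact hm.tame hs hG hQ hw' hp
    | add σ τ h1 h2 => rw [hΦa]; exact h1.add h2
  refine ⟨Φ, fun x y σ => Γ x y σ, htame, fun t x σ => ?_, fun x y σ => ?_, fun h hh x σ b => ?_,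
    fun x y z σ => ?_⟩
  · induction σ using induction_incl with
    | zero => rw [hΦ0, applyQ_zero]; simp [ModelData.evalPi]
    | inc a τ =>
      rw [hΦi, ← hpi]
      unfold ModelData.evalPi
      rw [glue_incl]
      rfl
    | add σ τ h1 h2 =>
      rw [hΦa, applyQ_add_of_integrable ((htame x σ).integrable t t.2.1 t.2.2 x)
        ((htame x τ).integrable t t.2.1 t.2.2 x), ← h1, ← h2]
      unfold ModelData.evalPi
      rw [map_add]
  · simp only [hΦ]
    rw [hPΓ]
  · unfold ModelData.evalGam
    refine 𝒯.group_apply (hΓ _ _) _ (fun a hb τ => ?_) (fun a hb => ?_) σ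
    · rw [if_pos hb]
      exact hgam h hh a b hb x τ
    · rw [if_neg hb]
  · change Γ x y (Γ y z σ) = Γ x z σ
    rw [← hchain x y z]
    rfl

open scoped Classical in
/-- The cocycle property of `Γ` in components. -/
lemma IsSmoothModel.gam_add (hs : ∀ i, 1 ≤ s i) (hG : ∀ x, 0 ≤ G x)
    (hQ : IsGTypeSemigroup s ℓ G Q) {S : ModelData d T}
    (hS : IsSmoothModel s ℓ G Q 𝒯 w wstar S) {h k : Sp d} (hh : h ≠ 0) (hk : k ≠ 0)
    (hhk : h + k ≠ 0) {a b : A} (ha : (a : Idx).prec c) (hab : (b : Idx).prec (a : Idx)) (x : Sp d) :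
    S.gam (h + k) a b x = S.gam h a b x + (S.gam k a b (x + h) +
      ∑ e ∈ 𝒯.below c with (b : Idx).prec (e : A) ∧ (e : Idx).prec a,
        (S.gam k e b (x + h)).comp (S.gam h a e x)) := by
  obtain ⟨Φ, Γ, -, -, -, hΓ, hchain⟩ := hS.exists_test hs hG hQ
  ext τ
  have hba : b ≠ a := fun e => hab.ne (by rw [e])
  have h1 := hΓ (h + k) hhk x (incl a τ) b
  rw [S.evalGam_incl, if_pos hab, incl_apply_of_ne hba, zero_add, ← hchain _ (x + h),
    show x + (h + k) = (x + h) + k by abel, hΓ k hk] at h1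
  -- expand `Γ_{(x+h+k)(x+h)} Γ_{(x+h)x} τ`; both factors are unipotent and triangular
  have hσ : ∀ e : A, Γ (x + h) x (incl a τ) e = incl a τ e +
      if (e : Idx).prec (a : Idx) then S.gam h a e x τ else 0 := fun e => by
    rw [hΓ h hh, S.evalGam_incl]
  have hsupp : ∀ e, e ∉ 𝒯.below c → Γ (x + h) x (incl a τ) e = 0 := by
    intro e he
    rw [𝒯.mem_below] at he
    rw [hσ, incl_apply_of_ne (by rintro rfl; exact he ha), if_neg fun hea => he (hea.trans ha),
      zero_add]
  rw [S.evalGam_eq_sum _ _ _ hsupp, hσ b, if_pos hab, incl_apply_of_ne hba, zero_add] at h1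
  rw [← h1]
  simp only [add_apply, sum_apply,
    ContinuousLinearMap.comp_apply]
  congr 1
  have ham : a ∈ (𝒯.below c).filter fun e : A => (b : Idx).prec (e : Idx) :=
    Finset.mem_filter.2 ⟨𝒯.mem_below.2 ha, hab⟩
  rw [← Finset.add_sum_erase _ _ ham, hσ a, incl_apply_self, if_neg fun h => h.ne rfl, add_zero]
  congr 1
  rw [← Finset.filter_filter, Finset.sum_filter]
  symm
  rw [← Finset.add_sum_erase _ _ ham, if_neg fun h => h.ne rfl, zero_add]
  refine Finset.sum_congr rfl fun e he => ?_
  rw [hσ e, incl_apply_of_ne (Finset.ne_of_mem_erase he), zero_add]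
  split_ifs with h
  · rfl
  · rw [map_zero]

/-- For a smooth model, the failure of `x ↦ Q_t(x, Π_x f(x))` to be an orbit of the semigroup is an
integral of local increments. -/
lemma IsSmoothModel.exists_increment (hs : ∀ i, 1 ≤ s i) (hG : ∀ x, 0 ≤ G x)
    (hQ : IsGTypeSemigroup s ℓ G Q) (hW : GControlled s ℓ G W Wstar) {p : ℝ≥0∞} (hp : 1 ≤ p)
    {S : ModelData d T} (hS : IsSmoothModel s ℓ G Q 𝒯 w wstar S) {f : Sp d → ⨁ a, T a}
    (hf : ∀ x a, a ∉ 𝒯.below c → f x a = 0)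
    (hfm : ∀ a, AEStronglyMeasurable (fun x => f x a) volume) {t u : Tm}
    (hut : (u : ℝ) < t) (hF : MemWLp W p fun x => S.evalPi u x (f x)) :
    ∃ D : Sp d → Sp d → ℝ, AEStronglyMeasurable (Function.uncurry D) (volume.prod volume) ∧
      (∀ h, h ≠ 0 → ∀ x, D x h =
        ∑ b ∈ 𝒯.below c, S.pi u b (x - h) (mdDelta S f h x b)) ∧
      (∀ x, Integrable fun h => Q (t - u) x (x - h) * D x h) ∧
      ∀ x, applyQ Q (t - u) (fun x => S.evalPi u x (f x)) x - S.evalPi t x (f x) =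
        ∫ h, Q (t - u) x (x - h) * D x h := by
  classical
  have hSm : S.Measurable := by
    obtain ⟨P, Γ, -, -, -, -, -, -, -, h, -⟩ := hS
    exact h
  obtain ⟨Φ, Γ, htame, hev, hΦΓ, hΓ, -⟩ := hS.exists_test hs hG hQ
  have hu0 : 0 < (u : ℝ) := u.2.1
  have hu1 : (u : ℝ) ≤ 1 := u.2.2
  have ht1 : (t : ℝ) ≤ 1 := t.2.2
  -- re-centring: `Q_u(x-h, Π_x f(x)) = Q_u(x-h, Π_{x-h} Γ_{(x-h)x} f(x))`
  have hshift : ∀ h : Sp d, h ≠ 0 → ∀ x, applyQ Q u (Φ x (f x)) (x - h) =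
      ∑ b ∈ 𝒯.below c, S.pi u b (x - h) (S.evalGam (-h) x (f x) b) := by
    intro h hh x
    have hg : ∀ b, Γ (x - h) x (f x) b = S.evalGam (-h) x (f x) b := fun b => by
      rw [sub_eq_add_neg]; exact hΓ (-h) (neg_ne_zero.2 hh) x (f x) b
    have hsupp : ∀ b, b ∉ 𝒯.below c → Γ (x - h) x (f x) b = 0 := by
      intro b hb
      rw [hg, S.evalGam_eq_sum _ _ _ (hf x), hf x b hb, zero_add]
      refine Finset.sum_eq_zero fun a ha => ?_
      obtain ⟨h1, h2⟩ := Finset.mem_filter.1 ha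
      exact absurd (𝒯.mem_below.2 (h2.trans (𝒯.mem_below.1 h1))) hb
    rw [← hΦΓ (x - h) x (f x), ← hev, S.evalPi_eq_sum _ _ hsupp]
    exact Finset.sum_congr rfl fun b _ => by rw [hg]
  set F : Sp d → ℝ := fun x => S.evalPi u x (f x) with hFdef
  -- written in terms of `Π_x` the increment is continuous in `h`, hence jointly measurable; the maps
  -- `Γ_{(x-h)x}` alone are only known to be measurable in `x` for each fixed `h`
  refine ⟨fun x h => F (x - h) - applyQ Q u (Φ x (f x)) (x - h), ?_, fun h hh x => ?_, fun x => ?_,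
    fun x => ?_⟩
  · have hq : Measure.QuasiMeasurePreserving (fun z : Sp d × Sp d => z.1 - z.2)
        (volume.prod volume) volume := quasiMeasurePreserving_sub volume volume
    refine (hF.1.comp_quasiMeasurePreserving hq).sub ?_
    refine aestronglyMeasurable_uncurry_of_continuous
      (g := fun x h => applyQ Q u (Φ x (f x)) (x - h)) (fun x => ?_) (fun h => ?_)
    · exact ((htame x (f x)).continuous_applyQ u hu0 hu1).comp (continuous_const.sub continuous_id)
    · rcases eq_or_ne h 0 with rfl | hh
      · refine hF.1.congr (ae_of_all _ fun x => ?_)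
        simp only [hFdef, sub_zero]
        exact hev u x (f x)
      · simp_rw [hshift h hh]
        refine Finset.aestronglyMeasurable_fun_sum _ fun b _ => aestronglyMeasurable_clm_apply
          (aestronglyMeasurable_comp_sub (hSm.1 u b) h)
          (aestronglyMeasurable_evalGam hSm (neg_ne_zero.2 hh) hf hfm b)
  · simp only [hFdef]
    rw [hshift h hh, S.evalPi_eq_sum _ _ (hf _), ← Finset.sum_sub_distrib]
    refine Finset.sum_congr rfl fun b _ => ?_
    rw [← map_sub]
    rfl
  · have h1 := (htame x (f x)).integrable_applyQ (t - u) u (by linarith) hu0 (by linarith) x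
    have h2 := integrable_kernel_mul hs hG hQ hW hp hF (t := (t : ℝ) - u) (by linarith)
      (by linarith) x
    refine ((h2.sub h1).comp_sub_left x).congr (ae_of_all _ fun h => ?_)
    simp only [Pi.sub_apply, mul_sub]
  · have h1 := (htame x (f x)).integrable_applyQ (t - u) u (by linarith) hu0 (by linarith) x
    have h2 := integrable_kernel_mul hs hG hQ hW hp hF (t := (t : ℝ) - u) (by linarith)
      (by linarith) x
    have h3 := (htame x (f x)).applyQ_applyQ (t - u) u (by linarith) hu0 (by linarith)
    rw [sub_add_cancel] at h3
    rw [hev t, ← h3]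
    have h4 := integral_sub_left_eq_self (μ := (volume : Measure (Sp d)))
      (fun y => Q (t - u) x y * (F y - applyQ Q u (Φ x (f x)) y)) x
    rw [h4]
    unfold applyQ at h1 ⊢
    rw [← integral_sub h2 h1]
    refine integral_congr_ae (ae_of_all _ fun y => ?_)
    simp only [mul_sub]

end Smooth

/-! ### Exponential growth of smooth models -/

section Growth

variable {d : ℕ} {s : Fin d → ℝ} {ℓ : ℝ} {G : Sp d → ℝ} {Q : ℝ → Sp d → Sp d → ℝ}
  {W Wstar : Sp d → ℝ}

/-- The exponential growth factor `exp (r (‖h‖ + 1))`. -/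
noncomputable def expGrowth (r : ℝ) (h : Sp d) : ℝ≥0∞ := ENNReal.ofReal (Real.exp (r * (‖h‖ + 1)))

lemma one_le_expGrowth {r : ℝ} (hr : 0 ≤ r) (h : Sp d) : 1 ≤ expGrowth r h := by
  rw [expGrowth, ← ENNReal.ofReal_one]
  exact ENNReal.ofReal_le_ofReal (Real.one_le_exp (by positivity))

lemma expGrowth_mul (r r' : ℝ) (h : Sp d) :
    expGrowth r h * expGrowth r' h = expGrowth (r + r') h := by
  rw [expGrowth, expGrowth, expGrowth, ← ENNReal.ofReal_mul (Real.exp_pos _).le, ← Real.exp_add,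
    ← add_mul]

lemma expGrowth_mono {r r' : ℝ} (hr : r ≤ r') (h : Sp d) : expGrowth r h ≤ expGrowth r' h := by
  unfold expGrowth
  gcongr

lemma ofReal_pow_ceil_le {Λ : ℝ} (hΛ : 1 ≤ Λ) (m : ℕ) (h : Sp d) :
    ENNReal.ofReal (Λ ^ (⌈‖h‖⌉₊ * m)) ≤ expGrowth (m * Real.log Λ) h := by
  refine ENNReal.ofReal_le_ofReal ?_
  have h0 : 0 < Λ := by linarith
  have hl := Real.log_nonneg hΛ
  rw [← Real.rpow_natCast, Real.rpow_def_of_pos h0]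
  refine Real.exp_le_exp.2 ?_
  push_cast
  have h1 := (Nat.ceil_lt_add_one (norm_nonneg h)).le
  calc Real.log Λ * (⌈‖h‖⌉₊ * m) = m * Real.log Λ * ⌈‖h‖⌉₊ := by ring
    _ ≤ m * Real.log Λ * (‖h‖ + 1) := by gcongr

/-- Every translation is a sum of `⌈‖h‖⌉₊` translations of norm at most one. -/
lemma exists_unit_step {h : Sp d} (hh : h ≠ 0) :
    ∃ k : Sp d, k ≠ 0 ∧ ‖k‖ ≤ 1 ∧ 1 ≤ ⌈‖h‖⌉₊ ∧ h = ⌈‖h‖⌉₊ • k := by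
  have h0 : 0 < ‖h‖ := norm_pos_iff.2 hh
  have hN : 0 < ⌈‖h‖⌉₊ := Nat.ceil_pos.2 h0
  have hN' : (0 : ℝ) < ⌈‖h‖⌉₊ := by exact_mod_cast hN
  refine ⟨(⌈‖h‖⌉₊ : ℝ)⁻¹ • h, smul_ne_zero (inv_ne_zero hN'.ne') hh, ?_, hN, ?_⟩
  · rw [norm_smul, norm_inv, Real.norm_natCast, inv_mul_le_iff₀ hN', mul_one]
    exact Nat.le_ceil _
  · rw [← Nat.cast_smul_eq_nsmul ℝ, smul_smul, mul_inv_cancel₀ hN'.ne', one_smul]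

lemma GControlled.exists_weight_le_pow (hW : GControlled s ℓ G W Wstar) :
    ∃ C : ℝ, 1 ≤ C ∧ ∀ k : Sp d, ‖k‖ ≤ 1 → ∀ (j : ℕ) (x : Sp d), W x ≤ C ^ j * W (x - j • k) := by
  obtain ⟨C, hC⟩ := (isCompact_closedBall (0 : Sp d) 1).exists_bound_of_continuousOn
    hW.continuous_star.continuousOn
  refine ⟨max 1 C, le_max_left _ _, fun k hk j => ?_⟩
  induction j with
  | zero => intro x; simp
  | succ j ih =>
    intro x
    have h1 := ih x
    have h2 := hW.weight_le (x - j • k) (x - (j + 1) • k)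
    have e : x - j • k - (x - (j + 1) • k) = k := by rw [add_smul, one_smul]; abel
    rw [e] at h2
    have h3 : Wstar k ≤ max 1 C :=
      ((le_abs_self _).trans (hC k (mem_closedBall_zero_iff.2 hk))).trans (le_max_right _ _)
    have h4 := (hW.weight_pos (x - (j + 1) • k)).le
    calc W x ≤ max 1 C ^ j * W (x - j • k) := h1
      _ ≤ max 1 C ^ j * (max 1 C * W (x - (j + 1) • k)) := by
          gcongr
          exact h2.trans (mul_le_mul_of_nonneg_right h3 h4)
      _ = _ := by rw [pow_succ]; ring

lemma GControlled.exists_weight_le_exp (hW : GControlled s ℓ G W Wstar) :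
    ∃ r : ℝ, 0 ≤ r ∧ ∀ h x : Sp d, W x ≤ Real.exp (r * (‖h‖ + 1)) * W (x - h) := by
  obtain ⟨C, hC, hpow⟩ := hW.exists_weight_le_pow
  refine ⟨Real.log C, Real.log_nonneg hC, fun h x => ?_⟩
  have hWn := (hW.weight_pos (x - h)).le
  rcases eq_or_ne h 0 with rfl | hh
  · have := Real.log_nonneg hC
    rw [sub_zero] at hWn ⊢
    exact le_mul_of_one_le_left hWn (Real.one_le_exp (by positivity))
  · obtain ⟨k, -, hk, -, e⟩ := exists_unit_step hh
    have h1 := hpow k hk ⌈‖h‖⌉₊ x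
    rw [← e] at h1
    refine h1.trans (mul_le_mul_of_nonneg_right ?_ hWn)
    have h2 := ofReal_pow_ceil_le hC 1 h
    rw [mul_one, Nat.cast_one, one_mul] at h2
    exact (ENNReal.ofReal_le_ofReal_iff (Real.exp_pos _).le).1 h2

/-- The indicator function of the set on which the weight is at least `δ`. -/
noncomputable def superlevel (W : Sp d → ℝ) (δ : ℝ) : Sp d → ℝ := {x | δ ≤ W x}.indicator 1

lemma superlevel_le {δ : ℝ} (hδ : 0 < δ) (hW0 : ∀ x, 0 < W x) (x : Sp d) :
    |superlevel W δ x| ≤ δ⁻¹ * W x := by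
  have h0 := hW0 x
  unfold superlevel
  by_cases hx : δ ≤ W x
  · rw [indicator_of_mem (by exact hx), Pi.one_apply, abs_one, inv_mul_eq_div, one_le_div hδ]
    exact hx
  · rw [indicator_of_notMem (by exact hx), abs_zero]
    positivity

lemma superlevel_mul_self (δ : ℝ) (x : Sp d) :
    superlevel W δ x * superlevel W δ x = superlevel W δ x := by
  unfold superlevel
  by_cases hx : x ∈ {x | δ ≤ W x} <;> simp [hx]

lemma superlevel_nonneg (δ : ℝ) (x : Sp d) : 0 ≤ superlevel W δ x :=
  indicator_nonneg (fun _ _ => zero_le_one) x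

lemma superlevel_le_one (δ : ℝ) (x : Sp d) : superlevel W δ x ≤ 1 :=
  indicator_le_self' (fun _ _ => zero_le_one) x

lemma measurable_superlevel (hW : Measurable W) (δ : ℝ) : Measurable (superlevel W δ) :=
  measurable_one.indicator (measurableSet_le measurable_const hW)

end Growth

section SmoothGrowth

variable {d : ℕ} {s : Fin d → ℝ} {ℓ : ℝ} {G : Sp d → ℝ} {Q : ℝ → Sp d → Sp d → ℝ}
  {A : Set Idx} {T : A → Type*} [∀ a, NormedAddCommGroup (T a)] [∀ a, NormedSpace ℝ (T a)]
  {w wstar v vstar W Wstar : Sp d → ℝ} {c : Idx} [∀ a, CompleteSpace (T a)]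
  {𝒯 : RIStructure A T}

lemma IsSmoothModel.measurable {S : ModelData d T} (hS : IsSmoothModel s ℓ G Q 𝒯 w wstar S) :
    S.Measurable := by
  obtain ⟨P, Γ, -, -, -, -, -, -, -, h, -⟩ := hS
  exact h

lemma IsSmoothModel.norm_lt_top {S : ModelData d T} (hS : IsSmoothModel s ℓ G Q 𝒯 w wstar S)
    (c : Idx) : S.norm s ℓ w wstar c < ∞ := by
  obtain ⟨P, Γ, -, -, -, -, -, -, -, -, h⟩ := hS
  exact h c

lemma exists_gam_bound (hs : ∀ i, 1 ≤ s i) (𝒯 : RIStructure A T) (hw : GControlled s ℓ G w wstar)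
    (c : Idx) {R : ℝ≥0∞} (hR : R ≠ ∞) :
    ∃ γ : ℝ, 0 ≤ γ ∧ ∀ M : ModelData d T, M.gamNorm s w wstar c ≤ R → ∀ a b : A,
      (b : Idx).prec (a : Idx) → (a : Idx).prec c → ∀ k : Sp d, k ≠ 0 → ‖k‖ ≤ 1 →
        wLp w ((a : Idx).iOminus b) (M.gam (-k) a b) ≤ ENNReal.ofReal γ := by
  have h1 : ∀ a b : A, ∃ C : ℝ, (b : Idx).prec (a : Idx) → ∀ k : Sp d, ‖k‖ ≤ 1 →
      wstar (-k) * sNorm s (-k) ^ ((a : Idx).r - (b : Idx).r) ≤ C := by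
    intro a b
    by_cases hab : (b : Idx).prec (a : Idx)
    · have hc : Continuous fun k : Sp d =>
          wstar (-k) * sNorm s (-k) ^ ((a : Idx).r - (b : Idx).r) :=
        (hw.continuous_star.comp continuous_neg).mul
          (((continuous_sNorm hs).comp continuous_neg).rpow_const fun x =>
            Or.inr (sub_nonneg.2 hab.1.le))
      obtain ⟨C, hC⟩ := (isCompact_closedBall (0 : Sp d) 1).exists_bound_of_continuousOn
        hc.continuousOn
      exact ⟨C, fun _ k hk => (le_abs_self _).trans (hC k (mem_closedBall_zero_iff.2 hk))⟩
    · exact ⟨0, fun h => absurd h hab⟩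
  choose C hC using h1
  set γ : ℝ := ∑ a ∈ 𝒯.below c, ∑ b ∈ 𝒯.below c, R.toReal * max 0 (C a b) with hγ
  refine ⟨γ, Finset.sum_nonneg fun a _ => Finset.sum_nonneg fun b _ => by positivity,
    fun M hM a b hab hac k hk hk1 => ?_⟩
  refine (M.wLp_gam_le (s := s) hw.one_le_star hab hac (neg_ne_zero.2 hk)).trans ?_
  calc M.gamNorm s w wstar c *
        ENNReal.ofReal (wstar (-k) * sNorm s (-k) ^ ((a : Idx).r - (b : Idx).r))
      ≤ ENNReal.ofReal R.toReal * ENNReal.ofReal (max 0 (C a b)) := by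
        rw [ENNReal.ofReal_toReal hR]
        gcongr
        exact (hC a b hab k hk1).trans (le_max_right _ _)
    _ = ENNReal.ofReal (R.toReal * max 0 (C a b)) :=
        (ENNReal.ofReal_mul ENNReal.toReal_nonneg).symm
    _ ≤ ENNReal.ofReal γ := by
        refine ENNReal.ofReal_le_ofReal ?_
        calc R.toReal * max 0 (C a b) ≤ ∑ b ∈ 𝒯.below c, R.toReal * max 0 (C a b) :=
              Finset.single_le_sum (f := fun b => R.toReal * max 0 (C a b))
                (fun b _ => by positivity) (𝒯.mem_below.2 (hab.trans hac))
          _ ≤ γ := Finset.single_le_sum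
                (f := fun a => ∑ b ∈ 𝒯.below c, R.toReal * max 0 (C a b))
                (fun a _ => Finset.sum_nonneg fun b _ => by positivity) (𝒯.mem_below.2 hac)

/-- The number of indices below `a`, a strictly increasing grading of the index set. -/
noncomputable def RIStructure.rank (𝒯 : RIStructure A T) (a : A) : ℕ := (𝒯.below a).card

lemma RIStructure.rank_lt (𝒯 : RIStructure A T) {a b : A} (h : (b : Idx).prec (a : Idx)) :
    𝒯.rank b < 𝒯.rank a := by
  refine Finset.card_lt_card ⟨fun e he => ?_, fun hsub => ?_⟩
  · exact 𝒯.mem_below.2 ((𝒯.mem_below.1 he).trans h)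
  · exact (𝒯.mem_below.1 (hsub (𝒯.mem_below.2 h))).ne rfl

lemma RIStructure.rank_le (𝒯 : RIStructure A T) {a : A} (h : (a : Idx).prec c) :
    𝒯.rank a ≤ (𝒯.below c).card :=
  Finset.card_le_card fun _ he => 𝒯.mem_below.2 ((𝒯.mem_below.1 he).trans h)

/-- On a superlevel set of the weight, the structure group elements `Γ_{(x-h)x}` of a smooth model
grow at most exponentially in `h`, uniformly over bounded sets of models. The map is a product of
`⌈‖h‖⌉₊` maps for unit steps, each of which costs a power of the weight; since the maps are
triangular, only boundedly many factors enter each term. -/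
lemma exists_gam_growth (hs : ∀ i, 1 ≤ s i) (hG : ∀ x, 0 ≤ G x)
    (hQ : IsGTypeSemigroup s ℓ G Q) (𝒯 : RIStructure A T) (hw : GControlled s ℓ G w wstar)
    (c : Idx) {R : ℝ≥0∞} (hR : R ≠ ∞) {δ : ℝ} (hδ : 0 < δ) :
    ∃ r : ℝ, 0 ≤ r ∧ ∀ S : ModelData d T, IsSmoothModel s ℓ G Q 𝒯 w wstar S →
      S.gamNorm s w wstar c ≤ R → ∀ a b : A, (b : Idx).prec (a : Idx) → (a : Idx).prec c →
        ∀ h : Sp d, h ≠ 0 → wLp (superlevel w δ) ((a : Idx).iOminus b) (S.gam (-h) a b) ≤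
          expGrowth r h := by
  classical
  obtain ⟨C, hC, hpow⟩ := hw.exists_weight_le_pow
  obtain ⟨γ, hγ0, hγ⟩ := exists_gam_bound hs 𝒯 hw c hR
  set g : ℝ := δ⁻¹ * γ with hg
  have hg0 : 0 ≤ g := by positivity
  set n : ℕ := (𝒯.below c).card with hn
  set Λ : ℝ := C * (1 + g * (1 + n)) with hΛ
  have hΛ' : 1 + g * (1 + n) ≤ Λ := le_mul_of_one_le_left (by positivity) hC
  have hgn : 0 ≤ g * (1 + n) := by positivity
  have hCΛ : C ≤ Λ := le_mul_of_one_le_right (by linarith) (by linarith)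
  have hΛ1 : 1 ≤ Λ := hC.trans hCΛ
  refine ⟨n * Real.log Λ, mul_nonneg n.cast_nonneg (Real.log_nonneg hΛ1), fun S hS hSR => ?_⟩
  have hSm := hS.measurable
  have hχm := measurable_superlevel hw.measurable_weight δ
  -- the `j`-th unit step: comparing `w` at `x` and at `x - j k` costs the factor `C ^ j`
  have hstep : ∀ a b : A, (b : Idx).prec (a : Idx) → (a : Idx).prec c → ∀ k : Sp d, k ≠ 0 →
      ‖k‖ ≤ 1 → ∀ j : ℕ, wLp (superlevel w δ) ((a : Idx).iOminus b)
        (fun x => S.gam (-k) a b (x - j • k)) ≤ ENNReal.ofReal (g * C ^ j) := by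
    intro a b hab hac k hk hk1 j
    have h1 := wLp_comp_sub_le (p := (a : Idx).iOminus b) (w' := superlevel w δ) (w := w)
      (h := j • k) (K := δ⁻¹ * C ^ j) (by positivity) (fun x => (hw.weight_pos x).le)
      (fun x => (superlevel_le hδ hw.weight_pos x).trans (by
        rw [mul_assoc]; gcongr; exact hpow k hk1 j x)) hw.measurable_weight
      (hSm.2 (-k) (neg_ne_zero.2 hk) a b hab)
    refine h1.trans ((mul_le_mul_right (hγ S hSR a b hab hac k hk hk1) _).trans (le_of_eq ?_))
    rw [← ENNReal.ofReal_mul (by positivity)]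
    congr 1
    rw [hg]; ring
  -- the exponent is proportional to the rank difference, which is additive along `b ≺ e ≺ a`, so that
  -- the bound is stable under the cocycle relation and a superlevel set is used for each factor
  have hmain : ∀ k : Sp d, k ≠ 0 → ‖k‖ ≤ 1 → ∀ j : ℕ, ∀ a b : A, (b : Idx).prec (a : Idx) →
      (a : Idx).prec c → wLp (superlevel w δ) ((a : Idx).iOminus b) (S.gam (-((j + 1) • k)) a b) ≤
        ENNReal.ofReal (Λ ^ ((j + 1) * (𝒯.rank a - 𝒯.rank b))) := by
    intro k hk hk1 j
    induction j with
    | zero =>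
      intro a b hab hac
      have h1 := hstep a b hab hac k hk hk1 0
      simp only [zero_smul, sub_zero, pow_zero, mul_one] at h1
      rw [zero_add, one_smul, one_mul]
      refine h1.trans (ENNReal.ofReal_le_ofReal ?_)
      have h2 := 𝒯.rank_lt hab
      calc g ≤ Λ := by
            refine le_trans ?_ hΛ'
            have : 0 ≤ g * n := by positivity
            linarith
        _ = Λ ^ 1 := (pow_one Λ).symm
        _ ≤ _ := pow_le_pow_right₀ hΛ1 (by omega)
    | succ j ih =>
      intro a b hab hac
      have hj0 : ∀ i : ℕ, -((i + 1) • k) ≠ 0 := fun i =>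
        neg_ne_zero.2 (smul_ne_zero (Nat.succ_ne_zero i) hk)
      have e1 : -((j + 1 + 1) • k) = -((j + 1) • k) + -k := by
        rw [add_smul (j + 1) 1 k, one_smul]; abel
      have hadd : ∀ x, S.gam (-((j + 1 + 1) • k)) a b x = S.gam (-((j + 1) • k)) a b x +
          (S.gam (-k) a b (x - (j + 1) • k) +
            ∑ e ∈ 𝒯.below c with (b : Idx).prec (e : A) ∧ (e : Idx).prec a,
              (S.gam (-k) e b (x - (j + 1) • k)).comp (S.gam (-((j + 1) • k)) a e x)) := by
        intro x
        have h1 := hS.gam_add hs hG hQ (hj0 j) (neg_ne_zero.2 hk)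
          (by rw [← e1]; exact hj0 (j + 1)) hac hab x
        rw [← e1, ← sub_eq_add_neg] at h1
        exact h1
      rw [funext hadd]
      set m := 𝒯.rank a - 𝒯.rank b with hm
      have hm1 : 1 ≤ m := by have := 𝒯.rank_lt hab; omega
      have hmeas1 : AEStronglyMeasurable (fun x => S.gam (-k) a b (x - (j + 1) • k)) volume :=
        aestronglyMeasurable_comp_sub (hSm.2 _ (neg_ne_zero.2 hk) a b hab) _
      have hmeas2 : ∀ e ∈ (𝒯.below c).filter fun e : A =>
          (b : Idx).prec (e : A) ∧ (e : Idx).prec a, AEStronglyMeasurable (fun x =>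
            (S.gam (-k) e b (x - (j + 1) • k)).comp (S.gam (-((j + 1) • k)) a e x)) volume := by
        intro e he
        obtain ⟨-, hbe, hea⟩ := Finset.mem_filter.1 he
        exact isBoundedBilinearMap_comp.continuous.comp_aestronglyMeasurable
          ((aestronglyMeasurable_comp_sub (hSm.2 _ (neg_ne_zero.2 hk) e b hbe) _).prodMk
            (hSm.2 _ (hj0 j) a e hea))
      have hone := Idx.one_le_iOminus (a : Idx) (b : Idx)
      refine (wLp_add_le hχm hone (hSm.2 _ (hj0 j) a b hab)
        (hmeas1.add (Finset.aestronglyMeasurable_fun_sum _ hmeas2))).trans ?_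
      refine (add_le_add le_rfl (wLp_add_le hχm hone hmeas1
        (Finset.aestronglyMeasurable_fun_sum _ hmeas2))).trans ?_
      refine (add_le_add le_rfl (add_le_add le_rfl (wLp_sum_le hχm hone _ hmeas2))).trans ?_
      have hterm : ∀ e ∈ (𝒯.below c).filter fun e : A =>
          (b : Idx).prec (e : A) ∧ (e : Idx).prec a, wLp (superlevel w δ) ((a : Idx).iOminus b)
            (fun x => (S.gam (-k) e b (x - (j + 1) • k)).comp (S.gam (-((j + 1) • k)) a e x)) ≤
              ENNReal.ofReal (g * Λ ^ ((j + 1) * m)) := by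
        intro e he
        obtain ⟨-, hbe, hea⟩ := Finset.mem_filter.1 he
        have := Idx.holderTriple_iOminus hbe hea
        have h1 := wLp_clm_comp_le (r := (a : Idx).iOminus b) (p := (e : Idx).iOminus b)
          (q := (a : Idx).iOminus e) hχm hχm
          (aestronglyMeasurable_comp_sub (hSm.2 _ (neg_ne_zero.2 hk) e b hbe) ((j + 1) • k))
          (hSm.2 _ (hj0 j) a e hea)
        simp only [superlevel_mul_self] at h1
        refine h1.trans ((mul_le_mul' (hstep e b hbe (hea.trans hac) k hk hk1 (j + 1))
          (ih a e hea hac)).trans ?_)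
        rw [← ENNReal.ofReal_mul (by positivity)]
        refine ENNReal.ofReal_le_ofReal ?_
        rw [mul_assoc]
        gcongr
        have h2 := 𝒯.rank_lt hbe
        have h3 := 𝒯.rank_lt hea
        calc C ^ (j + 1) * Λ ^ ((j + 1) * (𝒯.rank a - 𝒯.rank e))
            ≤ Λ ^ (j + 1) * Λ ^ ((j + 1) * (𝒯.rank a - 𝒯.rank e)) := by gcongr
          _ = Λ ^ ((j + 1) * (1 + (𝒯.rank a - 𝒯.rank e))) := by rw [← pow_add]; congr 1; ring
          _ ≤ _ := pow_le_pow_right₀ hΛ1 (Nat.mul_le_mul_left _ (by omega))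
      have hcard : (((𝒯.below c).filter fun e : A =>
          (b : Idx).prec (e : A) ∧ (e : Idx).prec a).card : ℝ) ≤ n := by
        exact_mod_cast Finset.card_filter_le _ _
      have hp : 0 ≤ Λ ^ ((j + 1) * m) := by positivity
      calc _ ≤ ENNReal.ofReal (Λ ^ ((j + 1) * m)) + (ENNReal.ofReal (g * Λ ^ ((j + 1) * m)) +
            ∑ e ∈ 𝒯.below c with (b : Idx).prec (e : A) ∧ (e : Idx).prec a,
              ENNReal.ofReal (g * Λ ^ ((j + 1) * m))) := by
            refine add_le_add (ih a b hab hac) (add_le_add ?_ (Finset.sum_le_sum hterm))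
            refine (hstep a b hab hac k hk hk1 (j + 1)).trans (ENNReal.ofReal_le_ofReal ?_)
            gcongr
            exact (pow_le_pow_left₀ (by linarith) hCΛ _).trans
              (pow_le_pow_right₀ hΛ1 (Nat.le_mul_of_pos_right _ hm1))
        _ ≤ ENNReal.ofReal (Λ ^ ((j + 1) * m) * (1 + g * (1 + n))) := by
            rw [Finset.sum_const, nsmul_eq_mul, ← ENNReal.ofReal_natCast,
              ← ENNReal.ofReal_mul (by positivity), ← ENNReal.ofReal_add (by positivity)
                (by positivity), ← ENNReal.ofReal_add hp (by positivity)]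
            refine ENNReal.ofReal_le_ofReal ?_
            have := mul_le_mul_of_nonneg_right hcard (show 0 ≤ g * Λ ^ ((j + 1) * m) by positivity)
            linarith
        _ ≤ _ := by
            refine ENNReal.ofReal_le_ofReal ?_
            calc Λ ^ ((j + 1) * m) * (1 + g * (1 + n)) ≤ Λ ^ ((j + 1) * m) * Λ := by gcongr
              _ = Λ ^ ((j + 1) * m + 1) := (pow_succ _ _).symm
              _ ≤ _ := pow_le_pow_right₀ hΛ1 (by
                rw [add_mul (j + 1) 1 m, one_mul]; omega)
  intro a b hab hac h hh
  obtain ⟨k, hk, hk1, hN, e⟩ := exists_unit_step hh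
  obtain ⟨j, hj⟩ : ∃ j, ⌈‖h‖⌉₊ = j + 1 := ⟨⌈‖h‖⌉₊ - 1, by omega⟩
  have h1 := hmain k hk hk1 j a b hab hac
  rw [← hj, ← e] at h1
  refine h1.trans (le_trans (ENNReal.ofReal_le_ofReal ?_) (ofReal_pow_ceil_le hΛ1 n h))
  have := 𝒯.rank_le hac
  exact pow_le_pow_right₀ hΛ1 (Nat.mul_le_mul_left _ (by omega))

/-! ### Hölder bounds for the local increments -/

/-- Hölder's inequality for the pairing of a family of functionals with a family of vectors. -/
lemma wLp_pairing_le {w₁ w₂ : Sp d → ℝ} (hw₁ : Measurable w₁) (hw₂ : Measurable w₂)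
    {L : ∀ a : A, Sp d → (T a →L[ℝ] ℝ)} {g : Sp d → ∀ a : A, T a}
    (hL : ∀ a ∈ 𝒯.below c, AEStronglyMeasurable (L a) volume)
    (hg : ∀ a ∈ 𝒯.below c, AEStronglyMeasurable (fun x => g x a) volume) :
    wLp (fun x => w₁ x * w₂ x) c.i (fun x => ∑ a ∈ 𝒯.below c, L a x (g x a)) ≤
      ∑ a ∈ 𝒯.below c, wLp w₁ (a : Idx).i (L a) * wLp w₂ (c.iOminus a) (fun x => g x a) := by
  refine (wLp_sum_le (hw₁.mul hw₂) c.one_le _ fun a ha =>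
    aestronglyMeasurable_clm_apply (hL a ha) (hg a ha)).trans (Finset.sum_le_sum fun a ha => ?_)
  have := Idx.holderTriple_of_prec (𝒯.mem_below.1 ha)
  exact wLp_clm_apply_le hw₁ hw₂ (hL a ha) (hg a ha)

/-- The local increments of a smooth model grow at most exponentially on superlevel sets of the
weight, uniformly over bounded sets of models. -/
lemma exists_increment_growth (hs : ∀ i, 1 ≤ s i) (hG : ∀ x, 0 ≤ G x)
    (hQ : IsGTypeSemigroup s ℓ G Q) (𝒯 : RIStructure A T) (hw : GControlled s ℓ G w wstar)
    (hv : GControlled s ℓ G v vstar) (c : Idx) {R F : ℝ≥0∞} (hR : R ≠ ∞) (hF : F ≠ ∞) {δ : ℝ}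
    (hδ : 0 < δ) (u : Tm) :
    ∃ (r : ℝ) (C : ℝ≥0∞), C ≠ ∞ ∧ ∀ (S : ModelData d T) (f : Sp d → ⨁ a, T a),
      IsSmoothModel s ℓ G Q 𝒯 w wstar S → S.norm s ℓ w wstar c ≤ R →
      (∀ x a, a ∉ 𝒯.below c → f x a = 0) →
      (∀ a, AEStronglyMeasurable (fun x => f x a) volume) → mdSize v c f ≤ F →
      ∀ h : Sp d, h ≠ 0 → wLp (fun x => superlevel w δ x * v x) c.i
        (fun x => ∑ b ∈ 𝒯.below c, S.pi u b (x - h) (mdDelta S f h x b)) ≤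
          C * expGrowth r h := by
  classical
  obtain ⟨r₁, hr₁, hgam⟩ := exists_gam_growth hs hG hQ 𝒯 hw c hR hδ
  obtain ⟨r₂, hr₂, hwe⟩ := hw.exists_weight_le_exp
  obtain ⟨r₃, hr₃, hve⟩ := hv.exists_weight_le_exp
  set n : ℕ := (𝒯.below c).card with hn
  refine ⟨r₂ + (r₁ + r₃), ∑ b ∈ 𝒯.below c, (ENNReal.ofReal δ⁻¹ *
    (ENNReal.ofReal ((u : ℝ) ^ ((b : Idx).r / ℓ)) * R)) * ((2 + n) * F),
    ENNReal.sum_ne_top.2 fun b _ => ENNReal.mul_ne_top (ENNReal.mul_ne_top ENNReal.ofReal_ne_top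
      (ENNReal.mul_ne_top ENNReal.ofReal_ne_top hR)) (ENNReal.mul_ne_top (by finiteness) hF),
    fun S f hS hSR hf hfm hfF h hh => ?_⟩
  have hSm := hS.measurable
  have hχm := measurable_superlevel hw.measurable_weight δ
  have hvm := hv.measurable_weight
  have hχvm : Measurable fun x => superlevel w δ x * v x := hχm.mul hvm
  -- the indicator of the superlevel set equals its square: one copy goes with `Π`, one with `Δ f`
  have hχv : ∀ x, |superlevel w δ x * v x| ≤ v x := fun x => by
    have h0 := (hv.weight_pos x).le
    rw [abs_of_nonneg (mul_nonneg (superlevel_nonneg δ x) h0)]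
    exact mul_le_of_le_one_left h0 (superlevel_le_one δ x)
  have hpi : ∀ b ∈ 𝒯.below c, wLp (superlevel w δ) (b : Idx).i (fun x => S.pi u b (x - h)) ≤
      expGrowth r₂ h * (ENNReal.ofReal δ⁻¹ * (ENNReal.ofReal ((u : ℝ) ^ ((b : Idx).r / ℓ)) * R)) := by
    intro b hb
    have h1 := wLp_comp_sub_le (p := (b : Idx).i) (w' := superlevel w δ) (w := w)
      (h := h) (K := Real.exp (r₂ * (‖h‖ + 1)) * δ⁻¹) (by positivity)
      (fun x => (hw.weight_pos x).le)
      (fun x => (superlevel_le hδ hw.weight_pos x).trans (by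
        have := mul_le_mul_of_nonneg_left (hwe h x) (inv_nonneg.2 hδ.le)
        linarith)) hw.measurable_weight (hSm.1 u b)
    rw [ENNReal.ofReal_mul (Real.exp_pos _).le, mul_assoc] at h1
    refine h1.trans ?_
    unfold expGrowth
    gcongr
    refine (S.wLp_pi_le (ℓ := ℓ) (𝒯.mem_below.1 hb) u).trans ?_
    gcongr
    exact le_self_add.trans hSR
  have hdel : ∀ b ∈ 𝒯.below c, wLp (fun x => superlevel w δ x * v x) (c.iOminus b)
      (fun x => mdDelta S f h x b) ≤ expGrowth (r₁ + r₃) h * ((2 + n) * F) := by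
    intro b hb
    have hbc := 𝒯.mem_below.1 hb
    have hone := Idx.one_le_iOminus c (b : Idx)
    have hE : 1 ≤ expGrowth (r₁ + r₃) h := one_le_expGrowth (by linarith) h
    have hmt : ∀ a ∈ (𝒯.below c).filter fun a : A => (b : Idx).prec (a : Idx),
        AEStronglyMeasurable (fun x => S.gam (-h) a b x (f x a)) volume := fun a ha =>
      aestronglyMeasurable_clm_apply (hSm.2 _ (neg_ne_zero.2 hh) a b (Finset.mem_filter.1 ha).2)
        (hfm a)
    have hms := Finset.aestronglyMeasurable_fun_sum _ hmt
    have hshift := aestronglyMeasurable_comp_sub (hfm b) h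
    have e : (fun x => mdDelta S f h x b) = fun x => f (x - h) b - (f x b +
        ∑ a ∈ 𝒯.below c with (b : Idx).prec (a : A), S.gam (-h) a b x (f x a)) := by
      funext x
      rw [mdDelta, S.evalGam_eq_sum _ _ _ (hf x)]
    rw [e]
    refine (wLp_sub_le hχvm hone hshift ((hfm b).add hms)).trans ?_
    refine (add_le_add le_rfl (wLp_add_le hχvm hone (hfm b) hms)).trans ?_
    refine (add_le_add le_rfl (add_le_add le_rfl (wLp_sum_le hχvm hone _ hmt))).trans ?_
    have hsz : wLp v (c.iOminus b) (fun x => f x b) ≤ F := (wLp_le_mdSize f hbc).trans hfF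
    -- the three parts of `Δ_{x;h} f`: the translate of `f`, the diagonal part of `Γ f`, and the rest
    have t1 : wLp (fun x => superlevel w δ x * v x) (c.iOminus b) (fun x => f (x - h) b) ≤
        expGrowth (r₁ + r₃) h * F := by
      have h1 := wLp_comp_sub_le (p := c.iOminus b) (w' := fun x => superlevel w δ x * v x)
        (w := v) (h := h) (Real.exp_pos (r₃ * (‖h‖ + 1))).le (fun x => (hv.weight_pos x).le)
        (fun x => (hχv x).trans (hve h x)) hvm (hfm b)
      refine h1.trans ?_
      have h2 : expGrowth r₃ h ≤ expGrowth (r₁ + r₃) h := expGrowth_mono (by linarith) h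
      exact mul_le_mul' h2 hsz
    have t2 : wLp (fun x => superlevel w δ x * v x) (c.iOminus b) (fun x => f x b) ≤
        expGrowth (r₁ + r₃) h * F := by
      refine le_trans ?_ (mul_le_mul' hE hsz)
      rw [one_mul]
      refine wLp_mono_ae (ae_of_all _ fun x => ?_)
      rw [norm_smul, norm_smul]
      refine mul_le_mul_of_nonneg_right ((hχv x).trans (le_abs_self _)) (norm_nonneg _)
    have t3 : ∀ a ∈ (𝒯.below c).filter fun a : A => (b : Idx).prec (a : Idx),
        wLp (fun x => superlevel w δ x * v x) (c.iOminus b)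
          (fun x => S.gam (-h) a b x (f x a)) ≤ expGrowth (r₁ + r₃) h * F := by
      intro a ha
      obtain ⟨ha, hba⟩ := Finset.mem_filter.1 ha
      have hac := 𝒯.mem_below.1 ha
      have := Idx.holderTriple_iOminus hba hac
      refine (wLp_clm_apply_le (p := (a : Idx).iOminus b) (q := c.iOminus a) hχm hvm
        (hSm.2 _ (neg_ne_zero.2 hh) a b hba) (hfm a)).trans ?_
      refine mul_le_mul' ((hgam S hS (le_add_self.trans hSR) a b hba hac h hh).trans
        (expGrowth_mono (by linarith) h)) ((wLp_le_mdSize f hac).trans hfF)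
    calc _ ≤ expGrowth (r₁ + r₃) h * F + (expGrowth (r₁ + r₃) h * F +
          ∑ a ∈ 𝒯.below c with (b : Idx).prec (a : A), expGrowth (r₁ + r₃) h * F) :=
          add_le_add t1 (add_le_add t2 (Finset.sum_le_sum t3))
      _ ≤ expGrowth (r₁ + r₃) h * F + (expGrowth (r₁ + r₃) h * F +
          n * (expGrowth (r₁ + r₃) h * F)) := by
          rw [Finset.sum_const, nsmul_eq_mul]
          gcongr
          exact Finset.card_filter_le _ _
      _ = _ := by ring
  have h1 := wLp_pairing_le (𝒯 := 𝒯) (c := c) hχm hχvm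
    (L := fun b x => S.pi u b (x - h)) (g := fun x b => mdDelta S f h x b)
    (fun b _ => aestronglyMeasurable_comp_sub (hSm.1 u b) h)
    (fun b _ => aestronglyMeasurable_mdDelta hSm hh hf hfm b)
  simp only [← mul_assoc, superlevel_mul_self] at h1
  refine h1.trans ?_
  rw [Finset.sum_mul]
  refine Finset.sum_le_sum fun b hb => (mul_le_mul' (hpi b hb) (hdel b hb)).trans (le_of_eq ?_)
  rw [← expGrowth_mul r₂]
  ring

end SmoothGrowth

/-! ### Passing to the limit in the integrated increments -/

section Limit

variable {d : ℕ} {s : Fin d → ℝ} {ℓ : ℝ} {G : Sp d → ℝ} {Q : ℝ → Sp d → Sp d → ℝ}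
  {W Wstar : Sp d → ℝ} {p : ℝ≥0∞}

lemma supKernel_ne_top (hQ : IsGTypeSemigroup s ℓ G Q) {t : ℝ} (ht : 0 < t) (h : Sp d) :
    supKernel Q t h ≠ ∞ := by
  obtain ⟨C, -, hC⟩ := supKernel_le hQ
  exact ((hC t ht h).trans_lt (ENNReal.mul_lt_top ENNReal.ofReal_lt_top ENNReal.ofReal_lt_top)).ne

/-- If `V` is a limit of integrals `∫ Q_τ(x, x - h) D_n(x, h) dh`, and the norms of the integrands
`D_n(·, h)` are controlled by `β h` asymptotically for every fixed `h`, then `V` is controlled by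
the integral of `β`. The interchange of limits is justified by an integrable bound `b` of
the norms of `D_n(·, h)`, uniform in `n`. -/
lemma wLp_le_of_tendsto_increments (hQ : IsGTypeSemigroup s ℓ G Q) {ω : Sp d → ℝ}
    (hω : Measurable ω) (hp : 1 ≤ p) {τ : ℝ} (hτ : 0 < τ) (h0 : ∀ᵐ h : Sp d, h ≠ 0)
    {V : Sp d → ℝ} {Vn : ℕ → Sp d → ℝ} {Dn : ℕ → Sp d → Sp d → ℝ}
    (hV : AEStronglyMeasurable V volume) (hVn : ∀ n, AEStronglyMeasurable (Vn n) volume)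
    (hlim : Tendsto (fun n => wLp ω p (fun x => Vn n x - V x)) atTop (𝓝 0))
    (hDm : ∀ n, AEStronglyMeasurable (Function.uncurry (Dn n)) (volume.prod volume))
    (hrep : ∀ n x, Vn n x = ∫ h, Q τ x (x - h) * Dn n x h)
    {β β' b : Sp d → ℝ≥0∞} (hβ : Measurable β) (hβ' : Measurable β') (hb : Measurable b)
    {e : ℕ → ℝ≥0∞} (he : Tendsto e atTop (𝓝 0))
    (hβt : ∀ h, β h ≠ ∞) (hβ't : ∀ h, β' h ≠ ∞) (hbt : ∀ h, b h ≠ ∞)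
    (hβi : ∫⁻ h, supKernel Q τ h * β h ≠ ∞) (hbi : ∫⁻ h, supKernel Q τ h * b h ≠ ∞)
    (h1 : ∀ n, ∀ h, h ≠ 0 → wLp ω p (fun x => Dn n x h) ≤ β h + e n * β' h)
    (h2 : ∀ n, ∀ h, h ≠ 0 → wLp ω p (fun x => Dn n x h) ≤ b h) :
    wLp ω p V ≤ ∫⁻ h, supKernel Q τ h * β h := by
  have hκ := measurable_supKernel hQ hτ
  -- the excess over `β h` tends to zero for each `h` and is dominated by `b h`
  set m : ℕ → Sp d → ℝ≥0∞ := fun n h => min (e n * β' h) (b h) with hm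
  have hmm : ∀ n, Measurable (m n) := fun n => (hβ'.const_mul _).min hb
  have hmi : ∀ n, ∫⁻ h, supKernel Q τ h * m n h ≤ ∫⁻ h, supKernel Q τ h * b h := fun n =>
    lintegral_mono fun h => mul_le_mul_right (min_le_right _ _) _
  have hbound : ∀ n, wLp ω p (Vn n) ≤
      (∫⁻ h, supKernel Q τ h * β h) + ∫⁻ h, supKernel Q τ h * m n h := by
    intro n
    -- Minkowski's inequality for the integral representing `V_n`
    have hUm : AEMeasurable (Function.uncurry fun (x h : Sp d) => ‖ω x • Dn n x h‖ₑ)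
        (volume.prod volume) := by
      have h3 : AEStronglyMeasurable (fun z : Sp d × Sp d => ω z.1 • Dn n z.1 z.2)
          (volume.prod volume) :=
        (hω.comp measurable_fst).aestronglyMeasurable.smul (hDm n)
      exact h3.aemeasurable.enorm
    have hsum : ∫⁻ h, supKernel Q τ h * (β h + m n h) =
        (∫⁻ h, supKernel Q τ h * β h) + ∫⁻ h, supKernel Q τ h * m n h := by
      simp_rw [mul_add]
      have h3 : Measurable fun h => supKernel Q τ h * β h := hκ.mul hβ
      exact lintegral_add_left h3 _
    have key := eLpNorm_lintegral_mul_le (μ := (volume : Measure (Sp d)))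
      (ν := (volume : Measure (Sp d))) hp hκ (b := fun h => β h + m n h) (hβ.add (hmm n))
      (ae_of_all _ fun h => ENNReal.add_ne_top.2
        ⟨hβt h, ((min_le_right _ _).trans_lt (hbt h).lt_top).ne⟩)
      (by rw [hsum]; exact ENNReal.add_ne_top.2 ⟨hβi, ((hmi n).trans_lt hbi.lt_top).ne⟩) hUm
      (K := 1) (by
        filter_upwards [h0] with h hh
        rw [one_mul]
        have h3 : eLpNorm (fun x => ‖ω x • Dn n x h‖ₑ) p volume = wLp ω p (fun x => Dn n x h) :=
          eLpNorm_enorm _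
        rw [h3]
        simp only [hm]
        rcases min_cases (e n * β' h) (b h) with ⟨h4, -⟩ | ⟨h4, -⟩ <;> rw [h4]
        · exact h1 n h hh
        · exact (h2 n h hh).trans le_add_self)
    rw [one_mul, hsum] at key
    refine le_trans (eLpNorm_mono_enorm fun x => ?_) key
    rw [enorm_eq_self]
    calc ‖ω x • Vn n x‖ₑ = ‖∫ h, Q τ x (x - h) * (ω x • Dn n x h)‖ₑ := by
          rw [hrep, smul_eq_mul, ← integral_const_mul]
          congr 2
          funext h
          simp only [smul_eq_mul]
          ring
      _ ≤ ∫⁻ h, ‖Q τ x (x - h) * (ω x • Dn n x h)‖ₑ := enorm_integral_le_lintegral_enorm _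
      _ ≤ _ := by
          refine lintegral_mono fun h => ?_
          rw [enorm_mul]
          gcongr
          have := enorm_le_supKernel (Q := Q) τ x (x - h)
          rwa [sub_sub_cancel] at this
  -- dominated convergence in `h`
  have htend : Tendsto (fun n => ∫⁻ h, supKernel Q τ h * m n h) atTop (𝓝 0) := by
    have h3 := tendsto_lintegral_of_dominated_convergence (μ := (volume : Measure (Sp d)))
      (F := fun n h => supKernel Q τ h * m n h) (f := fun _ => 0)
      (fun h => supKernel Q τ h * b h) (fun n => hκ.mul (hmm n))
      (fun n => ae_of_all _ fun h => mul_le_mul_right (min_le_right _ _) _) hbi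
      (ae_of_all _ fun h => by
        have h4 : Tendsto (fun n => e n * β' h) atTop (𝓝 (0 * β' h)) :=
          ENNReal.Tendsto.mul_const he (Or.inr (hβ't h))
        have h5 : Tendsto (fun n => supKernel Q τ h * (e n * β' h)) atTop
            (𝓝 (supKernel Q τ h * (0 * β' h))) :=
          ENNReal.Tendsto.const_mul h4 (Or.inr (supKernel_ne_top hQ hτ h))
        rw [zero_mul, mul_zero] at h5
        exact tendsto_of_tendsto_of_tendsto_of_le_of_le tendsto_const_nhds h5 (fun _ => zero_le)
          fun n => mul_le_mul_right (min_le_left _ _) _)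
    simpa using h3
  have hfinal : Tendsto (fun n => wLp ω p (fun x => Vn n x - V x) +
      ((∫⁻ h, supKernel Q τ h * β h) + ∫⁻ h, supKernel Q τ h * m n h)) atTop
      (𝓝 (0 + ((∫⁻ h, supKernel Q τ h * β h) + 0))) :=
    hlim.add (tendsto_const_nhds.add htend)
  rw [zero_add, add_zero] at hfinal
  refine ge_of_tendsto' hfinal fun n => ?_
  calc wLp ω p V = wLp ω p (fun x => Vn n x - (Vn n x - V x)) := by simp
    _ ≤ wLp ω p (Vn n) + wLp ω p (fun x => Vn n x - V x) :=
        wLp_sub_le hω hp (hVn n) ((hVn n).sub hV)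
    _ ≤ _ := by rw [add_comm]; exact add_le_add le_rfl (hbound n)

/-- Weighted norms are exhausted by superlevel sets of a positive weight. -/
lemma wLp_le_of_superlevel {w : Sp d → ℝ} (hw : Measurable w) (hw0 : ∀ x, 0 < w x)
    (hW : Measurable W) {V : Sp d → ℝ} (hV : AEStronglyMeasurable V volume) {K : ℝ≥0∞}
    (h : ∀ δ : ℝ, 0 < δ → wLp (fun x => superlevel w δ x * W x) p V ≤ K) : wLp W p V ≤ K := by
  have h1 : ∀ n : ℕ, 0 < 1 / ((n : ℝ) + 1) := fun n => by positivity
  refine (Lp.eLpNorm_lim_le_liminf_eLpNorm (p := p)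
    (f := fun n x => (superlevel w (1 / ((n : ℝ) + 1)) x * W x) • V x) (fun n => ?_)
    (fun x => W x • V x) (ae_of_all _ fun x => ?_)).trans ?_
  · exact ((measurable_superlevel hw _).mul hW).aestronglyMeasurable.smul hV
  · refine tendsto_const_nhds.congr' ?_
    filter_upwards [(tendsto_one_div_add_atTop_nhds_zero_nat (𝕜 := ℝ)).eventually_lt_const (hw0 x)]
      with n hn
    have : superlevel w (1 / ((n : ℝ) + 1)) x = 1 :=
      indicator_of_mem (show x ∈ {x | 1 / ((n : ℝ) + 1) ≤ w x} from hn.le) 1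
    rw [this, one_mul]
  · exact Filter.liminf_le_of_frequently_le' (Filter.Frequently.of_forall fun n => h _ (h1 n))

lemma expGrowth_lintegral_ne_top (hs : ∀ i, 1 ≤ s i) (hℓ : 0 < ℓ) (hG : ∀ x, 0 ≤ G x)
    (hQ : IsGTypeSemigroup s ℓ G Q) (hW : GControlled s ℓ G W Wstar) (r : ℝ) {t : ℝ}
    (ht : 0 < t) (ht1 : t ≤ 1) : ∫⁻ h, supKernel Q t h * expGrowth r h ≠ ∞ := by
  have h1 := lintegral_supKernel_exp_lt_top hs hℓ hG hQ hW r ht ht1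
  have h2 : ∀ h : Sp d, supKernel Q t h * expGrowth r h =
      ENNReal.ofReal (Real.exp r) * (supKernel Q t h * ENNReal.ofReal (Real.exp (r * ‖h‖))) := by
    intro h
    rw [expGrowth, mul_add, mul_one, Real.exp_add, ENNReal.ofReal_mul (Real.exp_pos _).le]
    ring
  simp_rw [h2]
  rw [lintegral_const_mul' _ _ ENNReal.ofReal_ne_top]
  exact ENNReal.mul_ne_top ENNReal.ofReal_ne_top h1.ne

lemma measurable_expGrowth (r : ℝ) : Measurable fun h : Sp d => expGrowth r h := by
  unfold expGrowth
  fun_prop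

end Limit

section Germ

variable {d : ℕ} {s : Fin d → ℝ} {ℓ : ℝ} {G : Sp d → ℝ} {Q : ℝ → Sp d → Sp d → ℝ}
  {A : Set Idx} {T : A → Type*} [∀ a, NormedAddCommGroup (T a)] [∀ a, NormedSpace ℝ (T a)]
  {w wstar v vstar W Wstar : Sp d → ℝ} {c : Idx}

lemma evalPi_sub_evalPi (M₁ M₂ : ModelData d T) {B : Finset A} {f₁ f₂ : Sp d → ⨁ a, T a}
    (hf₁ : ∀ x a, a ∉ B → f₁ x a = 0) (hf₂ : ∀ x a, a ∉ B → f₂ x a = 0) (t : Tm) (x : Sp d) :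
    M₁.evalPi t x (f₁ x) - M₂.evalPi t x (f₂ x) =
      (M₁.sub M₂).evalPi t x (f₁ x) + M₂.evalPi t x (f₁ x - f₂ x) := by
  have h : ∀ a, a ∉ B → (f₁ x - f₂ x) a = 0 := fun a ha => by
    have : (f₁ x - f₂ x) a = f₁ x a - f₂ x a := DFinsupp.sub_apply _ _ _
    rw [this, hf₁ x a ha, hf₂ x a ha, sub_zero]
  rw [M₁.evalPi_eq_sum t x (hf₁ x), M₂.evalPi_eq_sum t x (hf₂ x), ModelData.evalPi_eq_sum _ t x (hf₁ x),
    M₂.evalPi_eq_sum t x h, ← Finset.sum_add_distrib, ← Finset.sum_sub_distrib]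
  refine Finset.sum_congr rfl fun a _ => ?_
  have : (f₁ x - f₂ x) a = f₁ x a - f₂ x a := DFinsupp.sub_apply _ _ _
  rw [this, map_sub]
  simp [ModelData.sub]

variable [∀ a, CompleteSpace (T a)] {𝒯 : RIStructure A T}

lemma wLp_evalPi_le (hw : Measurable w) (hv : Measurable v) {M : ModelData d T} (hM : M.Measurable)
    {f : Sp d → ⨁ a, T a} (hf : ∀ x a, a ∉ 𝒯.below c → f x a = 0)
    (hfm : ∀ a, AEStronglyMeasurable (fun x => f x a) volume) (t : Tm) :
    wLp (fun x => w x * v x) c.i (fun x => M.evalPi t x (f x)) ≤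
      (∑ a ∈ 𝒯.below c, ENNReal.ofReal ((t : ℝ) ^ ((a : Idx).r / ℓ))) *
        (M.piNorm ℓ w c * mdSize v c f) := by
  simp_rw [fun x => M.evalPi_eq_sum t x (hf x)]
  refine (wLp_pairing_le hw hv (L := fun a => M.pi t a) (g := fun x a => f x a)
    (fun a _ => hM.1 t a) (fun a _ => hfm a)).trans ?_
  rw [Finset.sum_mul]
  refine Finset.sum_le_sum fun a ha => ?_
  rw [← mul_assoc]
  exact mul_le_mul' (M.wLp_pi_le (𝒯.mem_below.1 ha) t) (wLp_le_mdSize f (𝒯.mem_below.1 ha))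

/-- The size in `h` of the local increments of two modelled distributions. -/
noncomputable def incrementSize (𝒯 : RIStructure A T) (s : Fin d → ℝ) (ℓ : ℝ)
    (Wstar : Sp d → ℝ) (c : Idx) (u : Tm) (h : Sp d) : ℝ≥0∞ :=
  ∑ b ∈ 𝒯.below c, ENNReal.ofReal ((u : ℝ) ^ ((b : Idx).r / ℓ)) *
    ENNReal.ofReal (Wstar h * sNorm s h ^ (c.r - (b : Idx).r))

lemma measurable_sNorm_rpow (hs : ∀ i, 1 ≤ s i) {ws : Sp d → ℝ} (hws : Continuous ws) (ρ : ℝ) :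
    Measurable fun h : Sp d => ENNReal.ofReal (ws h * sNorm s h ^ ρ) :=
  (hws.measurable.mul ((continuous_sNorm hs).measurable.pow_const ρ)).ennreal_ofReal

lemma measurable_incrementSize (hs : ∀ i, 1 ≤ s i) (hW : Continuous Wstar) (u : Tm) :
    Measurable (incrementSize 𝒯 s ℓ Wstar c u) :=
  Finset.measurable_fun_sum _ fun _ _ => (measurable_sNorm_rpow hs hW _).const_mul _

lemma incrementSize_ne_top (u : Tm) (h : Sp d) : incrementSize 𝒯 s ℓ Wstar c u h ≠ ∞ :=
  ENNReal.sum_ne_top.2 fun _ _ => ENNReal.mul_ne_top ENNReal.ofReal_ne_top ENNReal.ofReal_ne_top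

/-- The integrated increments are of order `t^{r(c)/ℓ}`. -/
lemma exists_lintegral_incrementSize_le (hs : ∀ i, 1 ≤ s i) (hℓ : 0 < ℓ) (hG : ∀ x, 0 ≤ G x)
    (hQ : IsGTypeSemigroup s ℓ G Q) (𝒯 : RIStructure A T) (hW : GControlled s ℓ G W Wstar)
    (c : Idx) :
    ∃ C : ℝ, 0 < C ∧ ∀ t u : Tm, (t : ℝ) / 4 ≤ u → (u : ℝ) ≤ t / 2 →
      ∫⁻ h, supKernel Q (t - u) h * incrementSize 𝒯 s ℓ Wstar c u h ≤
        ENNReal.ofReal (C * (t : ℝ) ^ (c.r / ℓ)) := by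
  obtain ⟨C, hC, hsup⟩ := supKernel_le hQ
  have h1 : ∀ b : A, ∃ K : ℝ, 0 < K ∧ ((b : Idx).prec c → ∀ t u : Tm, (t : ℝ) / 4 ≤ u →
      (u : ℝ) ≤ t / 2 → ∫⁻ h, supKernel Q (t - u) h * (ENNReal.ofReal ((u : ℝ) ^ ((b : Idx).r / ℓ)) *
        ENNReal.ofReal (Wstar h * sNorm s h ^ (c.r - (b : Idx).r))) ≤
          ENNReal.ofReal (K * (t : ℝ) ^ (c.r / ℓ))) := by
    intro b
    by_cases hb : (b : Idx).prec c
    · have hρ : 0 ≤ c.r - (b : Idx).r := by linarith [hb.1]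
      obtain ⟨K, hK, hint⟩ := hW.lintegral_scaledG_le hs hG hρ
      set θ := (b : Idx).r / ℓ with hθ
      refine ⟨C * 4 ^ |θ| * K, by positivity, fun _ t u h4 h2 => ?_⟩
      have ht := t.2.1
      have hu := u.2.1
      -- here `u` is comparable to `t`, whatever the sign of the exponent
      have hu4 : (u : ℝ) ^ θ ≤ 4 ^ |θ| * (t : ℝ) ^ θ := by
        rcases le_total 0 θ with h0 | h0
        · calc (u : ℝ) ^ θ ≤ (t : ℝ) ^ θ := Real.rpow_le_rpow hu.le (by linarith) h0
            _ ≤ _ := le_mul_of_one_le_left (by positivity)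
              (Real.one_le_rpow (by norm_num) (abs_nonneg _))
        · calc (u : ℝ) ^ θ ≤ ((t : ℝ) / 4) ^ θ :=
                Real.rpow_le_rpow_of_nonpos (by linarith) h4 h0
            _ = _ := by
              rw [abs_of_nonpos h0, div_eq_mul_inv, Real.mul_rpow ht.le (by norm_num),
                Real.inv_rpow (by norm_num), Real.rpow_neg (by norm_num)]
              ring
      have htu : ((t : ℝ) - u) ^ ((c.r - (b : Idx).r) / ℓ) ≤ (t : ℝ) ^ ((c.r - (b : Idx).r) / ℓ) :=
        Real.rpow_le_rpow (by linarith) (by linarith) (by positivity)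
      have htu0 : 0 < (t : ℝ) - u := by linarith
      calc _ ≤ ∫⁻ h, ENNReal.ofReal (C * (u : ℝ) ^ θ) *
            (ENNReal.ofReal (scaledG s ℓ G (t - u) h) *
              ENNReal.ofReal (Wstar h * sNorm s h ^ (c.r - (b : Idx).r))) := by
            refine lintegral_mono fun h => ?_
            refine (mul_le_mul_left (hsup _ htu0 h) _).trans (le_of_eq ?_)
            rw [ENNReal.ofReal_mul hC.le]
            ring
        _ = ENNReal.ofReal (C * (u : ℝ) ^ θ) * ∫⁻ h, ENNReal.ofReal (scaledG s ℓ G (t - u) h) *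
              ENNReal.ofReal (Wstar h * sNorm s h ^ (c.r - (b : Idx).r)) :=
            lintegral_const_mul' _ _ ENNReal.ofReal_ne_top
        _ ≤ ENNReal.ofReal (C * (u : ℝ) ^ θ) *
              ENNReal.ofReal (K * ((t : ℝ) - u) ^ ((c.r - (b : Idx).r) / ℓ)) := by
            gcongr
            exact hint _ htu0 (by linarith [t.2.2])
        _ ≤ _ := by
            rw [← ENNReal.ofReal_mul (by positivity)]
            refine ENNReal.ofReal_le_ofReal ?_
            calc C * (u : ℝ) ^ θ * (K * ((t : ℝ) - u) ^ ((c.r - (b : Idx).r) / ℓ))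
                ≤ C * (4 ^ |θ| * (t : ℝ) ^ θ) * (K * (t : ℝ) ^ ((c.r - (b : Idx).r) / ℓ)) := by
                  gcongr
              _ = C * 4 ^ |θ| * K * ((t : ℝ) ^ θ * (t : ℝ) ^ ((c.r - (b : Idx).r) / ℓ)) := by ring
              _ = _ := by
                  rw [← Real.rpow_add ht, hθ, ← add_div, add_sub_cancel]
    · exact ⟨1, one_pos, fun h => absurd h hb⟩
  choose K hK0 hK using h1
  refine ⟨1 + ∑ b ∈ 𝒯.below c, K b, by
    have := Finset.sum_nonneg fun b (_ : b ∈ 𝒯.below c) => (hK0 b).le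
    linarith, fun t u h4 h2 => ?_⟩
  have ht := t.2.1
  have htu0 : 0 < (t : ℝ) - u := by linarith
  have hκ := measurable_supKernel hQ htu0
  unfold incrementSize
  simp_rw [Finset.mul_sum]
  have hm : ∀ b ∈ 𝒯.below c, Measurable fun h : Sp d => supKernel Q (t - u) h *
      (ENNReal.ofReal ((u : ℝ) ^ ((b : Idx).r / ℓ)) *
        ENNReal.ofReal (Wstar h * sNorm s h ^ (c.r - (b : Idx).r))) := fun b _ =>
    hκ.mul ((measurable_sNorm_rpow hs hW.continuous_star _).const_mul _)
  rw [lintegral_finsetSum _ hm]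
  calc _ ≤ ∑ b ∈ 𝒯.below c, ENNReal.ofReal (K b * (t : ℝ) ^ (c.r / ℓ)) :=
        Finset.sum_le_sum fun b hb => hK b (𝒯.mem_below.1 hb) t u h4 h2
    _ = ENNReal.ofReal ((∑ b ∈ 𝒯.below c, K b) * (t : ℝ) ^ (c.r / ℓ)) := by
        rw [Finset.sum_mul, ENNReal.ofReal_sum_of_nonneg fun b _ =>
          mul_nonneg (hK0 b).le (by positivity)]
    _ ≤ _ := by
        refine ENNReal.ofReal_le_ofReal ?_
        gcongr
        linarith

/-- The local increment `∑_b Q_u(x-h, Π_{x-h} (Δ_{x;h} f)_b)`. -/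
noncomputable def increment (𝒯 : RIStructure A T) (c : Idx) (M : ModelData d T)
    (f : Sp d → ⨁ a, T a) (u : Tm) (x h : Sp d) : ℝ :=
  ∑ b ∈ 𝒯.below c, M.pi u b (x - h) (mdDelta M f h x b)

lemma aestronglyMeasurable_increment {M : ModelData d T} (hM : M.Measurable)
    {f : Sp d → ⨁ a, T a} (hf : ∀ x a, a ∉ 𝒯.below c → f x a = 0)
    (hfm : ∀ a, AEStronglyMeasurable (fun x => f x a) volume) (u : Tm) {h : Sp d} (hh : h ≠ 0) :
    AEStronglyMeasurable (fun x => increment 𝒯 c M f u x h) volume :=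
  Finset.aestronglyMeasurable_fun_sum _ fun b _ => aestronglyMeasurable_clm_apply
    (aestronglyMeasurable_comp_sub (hM.1 u b) h) (aestronglyMeasurable_mdDelta hM hh hf hfm b)

/-- The difference of the local increments of two modelled distributions, possibly for different
models. -/
lemma wLp_increment_sub_le (hw : GControlled s ℓ G w wstar) (hv : GControlled s ℓ G v vstar)
    {M₁ M₂ : ModelData d T} (hM₁ : M₁.Measurable) (hM₂ : M₂.Measurable)
    {f₁ f₂ : Sp d → ⨁ a, T a} (hf₁ : ∀ x a, a ∉ 𝒯.below c → f₁ x a = 0)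
    (hfm₁ : ∀ a, AEStronglyMeasurable (fun x => f₁ x a) volume)
    (hf₂ : ∀ x a, a ∉ 𝒯.below c → f₂ x a = 0)
    (hfm₂ : ∀ a, AEStronglyMeasurable (fun x => f₂ x a) volume) (u : Tm) {h : Sp d} (hh : h ≠ 0) :
    wLp (fun x => w x * v x) c.i
        (fun x => increment 𝒯 c M₁ f₁ u x h - increment 𝒯 c M₂ f₂ u x h) ≤
      ((M₁.sub M₂).piNorm ℓ w c * mdSemi s v vstar c M₁ f₁ +
        M₂.piNorm ℓ w c * mdSemiDist s v vstar c M₁ M₂ f₁ f₂) *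
        incrementSize 𝒯 s ℓ (fun x => wstar x * vstar x) c u h := by
  have hwm := hw.measurable_weight
  have hvm := hv.measurable_weight
  have hd₁ := fun b => aestronglyMeasurable_mdDelta hM₁ hh hf₁ hfm₁ b
  have hd₂ := fun b => aestronglyMeasurable_mdDelta hM₂ hh hf₂ hfm₂ b
  have e : (fun x => increment 𝒯 c M₁ f₁ u x h - increment 𝒯 c M₂ f₂ u x h) = fun x =>
      (∑ b ∈ 𝒯.below c, (M₁.sub M₂).pi u b (x - h) (mdDelta M₁ f₁ h x b)) +
        ∑ b ∈ 𝒯.below c, M₂.pi u b (x - h) (mdDelta M₁ f₁ h x b - mdDelta M₂ f₂ h x b) := by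
    funext x
    rw [increment, increment, ← Finset.sum_sub_distrib, ← Finset.sum_add_distrib]
    refine Finset.sum_congr rfl fun b _ => ?_
    rw [map_sub]
    simp [ModelData.sub]
  have hone : ∀ x, 1 ≤ wstar x := hw.one_le_star
  have hone' : ∀ x, 1 ≤ vstar x := hv.one_le_star
  have hterm : ∀ {M : ModelData d T} (_ : M.Measurable) {D : Sp d → Sp d → ∀ a : A, T a}
      (_ : ∀ b, AEStronglyMeasurable (fun x => D h x b) volume),
      wLp (fun x => w x * v x) c.i (fun x => ∑ b ∈ 𝒯.below c, M.pi u b (x - h) (D h x b)) ≤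
        (M.piNorm ℓ w c * mdHolder s v vstar c D) *
          incrementSize 𝒯 s ℓ (fun x => wstar x * vstar x) c u h := by
    intro M hM D hD
    refine (wLp_pairing_le hwm hvm (L := fun b x => M.pi u b (x - h)) (g := fun x b => D h x b)
      (fun b _ => aestronglyMeasurable_comp_sub (hM.1 u b) h) (fun b _ => hD b)).trans ?_
    unfold incrementSize
    rw [Finset.mul_sum]
    refine Finset.sum_le_sum fun b hb => ?_
    have hbc := 𝒯.mem_below.1 hb
    have h1 := hw.wLp_comp_sub_le (p := (b : Idx).i) (hM.1 u b) h
    have h2 := wLp_le_mdHolder (s := s) (v := v) hone' D hbc hh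
    have h3 := M.wLp_pi_le (ℓ := ℓ) (w := w) hbc u
    calc _ ≤ (ENNReal.ofReal (wstar h) *
          (ENNReal.ofReal ((u : ℝ) ^ ((b : Idx).r / ℓ)) * M.piNorm ℓ w c)) *
          (mdHolder s v vstar c D *
            ENNReal.ofReal (vstar h * sNorm s h ^ (c.r - (b : Idx).r))) :=
          mul_le_mul' (h1.trans (mul_le_mul_right h3 _)) h2
      _ = _ := by
          rw [mul_assoc (wstar h), ENNReal.ofReal_mul (zero_le_one.trans (hone h))]
          ring
  rw [e, add_mul]
  refine (wLp_add_le (hwm.mul hvm) c.one_le ?_ ?_).trans (add_le_add ?_ ?_)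
  · exact Finset.aestronglyMeasurable_fun_sum _ fun b _ => aestronglyMeasurable_clm_apply
      (aestronglyMeasurable_comp_sub ((hM₁.sub hM₂).1 u b) h) (hd₁ b)
  · exact Finset.aestronglyMeasurable_fun_sum _ fun b _ => aestronglyMeasurable_clm_apply
      (aestronglyMeasurable_comp_sub (hM₂.1 u b) h) ((hd₁ b).sub (hd₂ b))
  · exact hterm (hM₁.sub hM₂) hd₁
  · exact hterm hM₂ (D := fun h x b => mdDelta M₁ f₁ h x b - mdDelta M₂ f₂ h x b)
      fun b => (hd₁ b).sub (hd₂ b)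

end Germ

/-! ### The germ of a modelled distribution is almost an orbit -/

section AlmostOrbit

variable {d : ℕ} {s : Fin d → ℝ} {ℓ : ℝ} {G : Sp d → ℝ} {Q : ℝ → Sp d → Sp d → ℝ}
  {A : Set Idx} {T : A → Type*} [∀ a, NormedAddCommGroup (T a)] [∀ a, NormedSpace ℝ (T a)]
  {w wstar v vstar W Wstar : Sp d → ℝ} {c : Idx} [∀ a, CompleteSpace (T a)]
  {𝒯 : RIStructure A T}

/-- Local increments depend continuously on the model on superlevel sets of the weight, at each
fixed distance `h`. The bound involves `wstar (-h)`, so that it need not be integrable in `h`. -/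
lemma exists_increment_sub_le (hs : ∀ i, 1 ≤ s i) (hw : GControlled s ℓ G w wstar)
    (hv : GControlled s ℓ G v vstar) {M : ModelData d T} (hM : M.Measurable)
    (hMt : M.piNorm ℓ w c ≠ ∞) {f : Sp d → ⨁ a, T a} (hf : ∀ x a, a ∉ 𝒯.below c → f x a = 0)
    (hfm : ∀ a, AEStronglyMeasurable (fun x => f x a) volume) (hsize : mdSize v c f ≠ ∞)
    (hsemi : mdSemi s v vstar c M f ≠ ∞) {δ : ℝ} (hδ : 0 < δ) (u : Tm) :
    ∃ β' : Sp d → ℝ≥0∞, Measurable β' ∧ (∀ h, β' h ≠ ∞) ∧ ∀ S : ModelData d T, S.Measurable →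
      (M.sub S).norm s ℓ w wstar c ≤ 1 → ∀ h, h ≠ 0 →
        wLp (fun x => superlevel w δ x * v x) c.i
          (fun x => increment 𝒯 c S f u x h - increment 𝒯 c M f u x h) ≤
            (M.sub S).norm s ℓ w wstar c * β' h := by
  classical
  -- `P U` bounds the functionals `Π`, `Z` the effect of changing the model and `Y` the increments of
  -- `f` for the limiting model
  set P : Sp d → ℝ≥0∞ := fun h => ENNReal.ofReal (δ⁻¹ * wstar h) with hP
  set U : A → ℝ≥0∞ := fun b => ENNReal.ofReal ((u : ℝ) ^ ((b : Idx).r / ℓ)) with hU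
  set Z : A → Sp d → ℝ≥0∞ := fun b h => ∑ a ∈ 𝒯.below c with (b : Idx).prec (a : A),
    ENNReal.ofReal δ⁻¹ * ENNReal.ofReal (wstar (-h) * sNorm s (-h) ^ ((a : Idx).r - (b : Idx).r)) *
      mdSize v c f with hZ
  set Y : A → Sp d → ℝ≥0∞ := fun b h => mdSemi s v vstar c M f *
    ENNReal.ofReal (vstar h * sNorm s h ^ (c.r - (b : Idx).r)) with hY
  have hPm : Measurable P := (hw.continuous_star.measurable.const_mul _).ennreal_ofReal
  have hZm : ∀ b, Measurable (Z b) := fun b => Finset.measurable_fun_sum _ fun a _ =>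
    (((measurable_sNorm_rpow hs hw.continuous_star _).comp measurable_neg).const_mul _).mul_const _
  have hYm : ∀ b, Measurable (Y b) := fun b =>
    (measurable_sNorm_rpow hs hv.continuous_star _).const_mul _
  have hZt : ∀ b h, Z b h ≠ ∞ := fun b h => ENNReal.sum_ne_top.2 fun a _ =>
    ENNReal.mul_ne_top (ENNReal.mul_ne_top ENNReal.ofReal_ne_top ENNReal.ofReal_ne_top) hsize
  have hYt : ∀ b h, Y b h ≠ ∞ := fun b h => ENNReal.mul_ne_top hsemi ENNReal.ofReal_ne_top
  refine ⟨fun h => (∑ b ∈ 𝒯.below c, P h * U b * (Y b h + Z b h)) +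
    ∑ b ∈ 𝒯.below c, P h * U b * M.piNorm ℓ w c * Z b h, ?_, fun h => ?_,
    fun S hS hS1 h hh => ?_⟩
  · exact (Finset.measurable_fun_sum _ fun b _ => (hPm.mul_const _).mul ((hYm b).add (hZm b))).add
      (Finset.measurable_fun_sum _ fun b _ => ((hPm.mul_const _).mul_const _).mul (hZm b))
  · refine ENNReal.add_ne_top.2 ⟨ENNReal.sum_ne_top.2 fun b _ => ?_,
      ENNReal.sum_ne_top.2 fun b _ => ?_⟩
    · exact ENNReal.mul_ne_top (ENNReal.mul_ne_top ENNReal.ofReal_ne_top ENNReal.ofReal_ne_top)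
        (ENNReal.add_ne_top.2 ⟨hYt b h, hZt b h⟩)
    · exact ENNReal.mul_ne_top (ENNReal.mul_ne_top (ENNReal.mul_ne_top ENNReal.ofReal_ne_top
        ENNReal.ofReal_ne_top) hMt) (hZt b h)
  set e := (M.sub S).norm s ℓ w wstar c with he
  have hpie : (S.sub M).piNorm ℓ w c ≤ e := by
    rw [he, ModelData.norm_sub_comm]; exact le_self_add
  have hgame : (M.sub S).gamNorm s w wstar c ≤ e := le_add_self
  have hχm := measurable_superlevel hw.measurable_weight δ
  have hvm := hv.measurable_weight
  have hχvm : Measurable fun x => superlevel w δ x * v x := hχm.mul hvm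
  have hdS := fun b => aestronglyMeasurable_mdDelta hS hh hf hfm b
  have hdM := fun b => aestronglyMeasurable_mdDelta hM hh hf hfm b
  -- the increments of the two models differ by the action of the difference of the two `Γ`
  have hZb : ∀ b ∈ 𝒯.below c, wLp (fun x => superlevel w δ x * v x) (c.iOminus b)
      (fun x => mdDelta S f h x b - mdDelta M f h x b) ≤ e * Z b h := by
    intro b hb
    have hmt : ∀ a ∈ (𝒯.below c).filter fun a : A => (b : Idx).prec (a : Idx),
        AEStronglyMeasurable (fun x => (M.sub S).gam (-h) a b x (f x a)) volume := fun a ha =>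
      aestronglyMeasurable_clm_apply ((hM.sub hS).2 _ (neg_ne_zero.2 hh) a b
        (Finset.mem_filter.1 ha).2) (hfm a)
    simp_rw [fun x => mdDelta_sub_mdDelta S M hf h x b]
    refine (wLp_sum_le hχvm (Idx.one_le_iOminus c b) _ hmt).trans ?_
    rw [hZ, Finset.mul_sum]
    refine Finset.sum_le_sum fun a ha => ?_
    obtain ⟨ha, hba⟩ := Finset.mem_filter.1 ha
    have hac := 𝒯.mem_below.1 ha
    have := Idx.holderTriple_iOminus hba hac
    have hg := (hM.sub hS).2 (-h) (neg_ne_zero.2 hh) a b hba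
    refine (wLp_clm_apply_le (p := (a : Idx).iOminus b) (q := c.iOminus a) hχm hvm hg
      (hfm a)).trans ?_
    have h1 : wLp (superlevel w δ) ((a : Idx).iOminus b) ((M.sub S).gam (-h) a b) ≤
        ENNReal.ofReal δ⁻¹ * wLp w ((a : Idx).iOminus b) ((M.sub S).gam (-h) a b) := by
      have := wLp_comp_sub_le (p := (a : Idx).iOminus b) (w' := superlevel w δ) (w := w)
        (h := 0) (K := δ⁻¹) (by positivity) (fun x => (hw.weight_pos x).le)
        (fun x => by rw [sub_zero]; exact superlevel_le hδ hw.weight_pos x)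
        hw.measurable_weight hg
      simpa using this
    calc _ ≤ (ENNReal.ofReal δ⁻¹ * (e *
          ENNReal.ofReal (wstar (-h) * sNorm s (-h) ^ ((a : Idx).r - (b : Idx).r)))) *
          mdSize v c f := by
          refine mul_le_mul' (h1.trans ?_) (wLp_le_mdSize f hac)
          gcongr
          refine ((M.sub S).wLp_gam_le (s := s) hw.one_le_star hba hac (neg_ne_zero.2 hh)).trans ?_
          gcongr
      _ = _ := by ring
  have hYb : ∀ b ∈ 𝒯.below c, wLp (fun x => superlevel w δ x * v x) (c.iOminus b)
      (fun x => mdDelta S f h x b) ≤ Y b h + Z b h := by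
    intro b hb
    have h1 : wLp (fun x => superlevel w δ x * v x) (c.iOminus b)
        (fun x => mdDelta M f h x b) ≤ Y b h := by
      refine le_trans (wLp_mono_ae (w' := v) (ae_of_all _ fun x => ?_))
        (wLp_le_mdHolder hv.one_le_star (mdDelta M f) (𝒯.mem_below.1 hb) hh)
      rw [norm_smul, norm_smul, norm_mul, Real.norm_of_nonneg (superlevel_nonneg δ x)]
      gcongr
      exact mul_le_of_le_one_left (norm_nonneg _) (superlevel_le_one δ x)
    calc _ = wLp (fun x => superlevel w δ x * v x) (c.iOminus b)
          (fun x => mdDelta M f h x b + (mdDelta S f h x b - mdDelta M f h x b)) := by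
          congr 1; funext x; abel
      _ ≤ _ := wLp_add_le hχvm (Idx.one_le_iOminus c b) (hdM b) ((hdS b).sub (hdM b))
      _ ≤ Y b h + e * Z b h := add_le_add h1 (hZb b hb)
      _ ≤ Y b h + 1 * Z b h := by gcongr
      _ = _ := by rw [one_mul]
  have hpi : ∀ {M' : ModelData d T} (_ : M'.Measurable), ∀ b ∈ 𝒯.below c,
      wLp (superlevel w δ) (b : Idx).i (fun x => M'.pi u b (x - h)) ≤
        P h * U b * M'.piNorm ℓ w c := by
    intro M' hM' b hb
    have h1 := wLp_comp_sub_le (p := (b : Idx).i) (w' := superlevel w δ) (w := w)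
      (h := h) (K := δ⁻¹ * wstar h)
      (mul_nonneg (by positivity) (zero_le_one.trans (hw.one_le_star h)))
      (fun x => (hw.weight_pos x).le)
      (fun x => (superlevel_le hδ hw.weight_pos x).trans (by
        rw [mul_assoc]
        gcongr
        simpa using hw.weight_le x (x - h))) hw.measurable_weight (hM'.1 u b)
    refine h1.trans ?_
    rw [mul_assoc]
    exact mul_le_mul_right (M'.wLp_pi_le (𝒯.mem_below.1 hb) u) _
  have hsplit : (fun x => increment 𝒯 c S f u x h - increment 𝒯 c M f u x h) = fun x =>
      (∑ b ∈ 𝒯.below c, (S.sub M).pi u b (x - h) (mdDelta S f h x b)) +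
        ∑ b ∈ 𝒯.below c, M.pi u b (x - h) (mdDelta S f h x b - mdDelta M f h x b) := by
    funext x
    rw [increment, increment, ← Finset.sum_sub_distrib, ← Finset.sum_add_distrib]
    refine Finset.sum_congr rfl fun b _ => ?_
    rw [map_sub]
    simp [ModelData.sub]
  have t1 := wLp_pairing_le (𝒯 := 𝒯) (c := c) hχm hχvm
    (L := fun b x => (S.sub M).pi u b (x - h)) (g := fun x b => mdDelta S f h x b)
    (fun b _ => aestronglyMeasurable_comp_sub ((hS.sub hM).1 u b) h) (fun b _ => hdS b)
  have t2 := wLp_pairing_le (𝒯 := 𝒯) (c := c) hχm hχvm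
    (L := fun b x => M.pi u b (x - h)) (g := fun x b => mdDelta S f h x b - mdDelta M f h x b)
    (fun b _ => aestronglyMeasurable_comp_sub (hM.1 u b) h) (fun b _ => (hdS b).sub (hdM b))
  simp only [← mul_assoc, superlevel_mul_self] at t1 t2
  rw [hsplit, mul_add]
  refine (wLp_add_le hχvm c.one_le ?_ ?_).trans (add_le_add (t1.trans ?_) (t2.trans ?_))
  · exact Finset.aestronglyMeasurable_fun_sum _ fun b _ => aestronglyMeasurable_clm_apply
      (aestronglyMeasurable_comp_sub ((hS.sub hM).1 u b) h) (hdS b)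
  · exact Finset.aestronglyMeasurable_fun_sum _ fun b _ => aestronglyMeasurable_clm_apply
      (aestronglyMeasurable_comp_sub (hM.1 u b) h) ((hdS b).sub (hdM b))
  · rw [Finset.mul_sum]
    refine Finset.sum_le_sum fun b hb => ?_
    calc _ ≤ (P h * U b * e) * (Y b h + Z b h) :=
          mul_le_mul' ((hpi (hS.sub hM) b hb).trans (mul_le_mul_right hpie _)) (hYb b hb)
      _ = _ := by ring
  · rw [Finset.mul_sum]
    refine Finset.sum_le_sum fun b hb => ?_
    calc _ ≤ (P h * U b * M.piNorm ℓ w c) * (e * Z b h) :=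
          mul_le_mul' (hpi hM b hb) (hZb b hb)
      _ = _ := by ring

lemma IsModel.norm_lt_top (hw : GControlled s ℓ G w wstar) {M : ModelData d T}
    (hM : IsModel s ℓ G Q 𝒯 w wstar M) (c : Idx) : M.norm s ℓ w wstar c < ∞ := by
  obtain ⟨S, hS, hlt⟩ := hM.2 c 1 one_pos
  refine (ModelData.norm_le_add hw.measurable_weight hw.one_le_star hM.1 hS.measurable).trans_lt ?_
  exact ENNReal.add_lt_top.2 ⟨hS.norm_lt_top c, hlt.trans ENNReal.one_lt_top⟩

lemma IsModel.exists_seq {M : ModelData d T} (hM : IsModel s ℓ G Q 𝒯 w wstar M) (c : Idx) :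
    ∃ S : ℕ → ModelData d T, (∀ n, IsSmoothModel s ℓ G Q 𝒯 w wstar (S n)) ∧
      (∀ n, (M.sub (S n)).norm s ℓ w wstar c ≤ 1) ∧
      Tendsto (fun n => (M.sub (S n)).norm s ℓ w wstar c) atTop (𝓝 0) := by
  have h1 : ∀ n : ℕ, (0 : ℝ≥0∞) < ((n : ℝ≥0∞) + 1)⁻¹ := fun n => by
    rw [ENNReal.inv_pos]; finiteness
  choose S hS hlt using fun n : ℕ => hM.2 c _ (h1 n)
  refine ⟨S, hS, fun n => (hlt n).le.trans ?_, ?_⟩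
  · rw [ENNReal.inv_le_one]; exact le_add_self
  · have h2 : Tendsto (fun n : ℕ => ((n : ℝ≥0∞) + 1)⁻¹) atTop (𝓝 0) := by
      have h3 := (tendsto_add_atTop_iff_nat 1).2 ENNReal.tendsto_inv_nat_nhds_zero
      simpa using h3
    exact tendsto_of_tendsto_of_tendsto_of_le_of_le tendsto_const_nhds h2 (fun _ => zero_le)
      fun n => (hlt n).le

lemma memWLp_evalPi (hw : Measurable w) (hv : Measurable v)
    {M : ModelData d T} (hM : M.Measurable) (hMt : M.piNorm ℓ w c ≠ ∞)
    {f : Sp d → ⨁ a, T a} (hf : ∀ x a, a ∉ 𝒯.below c → f x a = 0)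
    (hfm : ∀ a, AEStronglyMeasurable (fun x => f x a) volume) (hsize : mdSize v c f ≠ ∞) (t : Tm) :
    MemWLp (fun x => w x * v x) c.i (fun x => M.evalPi t x (f x)) :=
  ⟨ModelData.aestronglyMeasurable_evalPi hM t hf hfm, (wLp_evalPi_le hw hv hM hf hfm t).trans_lt
    (ENNReal.mul_lt_top (ENNReal.sum_lt_top.2 fun _ _ => ENNReal.ofReal_lt_top)
      (ENNReal.mul_lt_top hMt.lt_top hsize.lt_top))⟩

lemma mdSemiDist_lt_top (hv : GControlled s ℓ G v vstar) {M₁ M₂ : ModelData d T}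
    (hM₁ : M₁.Measurable) (hM₂ : M₂.Measurable) {f₁ f₂ : Sp d → ⨁ a, T a}
    (hf₁ : IsModelled s v vstar c M₁ f₁) (hf₂ : IsModelled s v vstar c M₂ f₂)
    (𝒯 : RIStructure A T) : mdSemiDist s v vstar c M₁ M₂ f₁ f₂ < ∞ := by
  have hle : mdSemiDist s v vstar c M₁ M₂ f₁ f₂ ≤
      mdSemi s v vstar c M₁ f₁ + mdSemi s v vstar c M₂ f₂ := by
    refine iSup_le fun a => iSup_le fun ha => iSup_le fun h => iSup_le fun hh => ?_
    refine (ENNReal.div_le_iff_le_mul (Or.inl (ofReal_mul_sNorm_ne_zero hv.one_le_star hh _))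
      (Or.inl ENNReal.ofReal_ne_top)).2 ?_
    rw [add_mul]
    refine (wLp_sub_le hv.measurable_weight (Idx.one_le_iOminus c a)
      (aestronglyMeasurable_mdDelta hM₁ hh (hf₁.eq_zero (𝒯 := 𝒯)) hf₁.measurable a)
      (aestronglyMeasurable_mdDelta hM₂ hh (hf₂.eq_zero (𝒯 := 𝒯)) hf₂.measurable a)).trans ?_
    exact add_le_add (wLp_le_mdHolder hv.one_le_star (mdDelta M₁ f₁) ha hh)
      (wLp_le_mdHolder hv.one_le_star (mdDelta M₂ f₂) ha hh)
  exact hle.trans_lt (ENNReal.add_lt_top.2 ⟨hf₁.semi_lt_top, hf₂.semi_lt_top⟩)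

/-- The germs of a modelled distribution for models converging to `M` converge. -/
lemma tendsto_wLp_evalPi_sub (hw : Measurable w) (hv : Measurable v) {M : ModelData d T}
    (hM : M.Measurable) {S : ℕ → ModelData d T} (hS : ∀ n, (S n).Measurable)
    (hlim : Tendsto (fun n => (M.sub (S n)).norm s ℓ w wstar c) atTop (𝓝 0))
    {f : Sp d → ⨁ a, T a} (hf : ∀ x a, a ∉ 𝒯.below c → f x a = 0)
    (hfm : ∀ a, AEStronglyMeasurable (fun x => f x a) volume) (hsize : mdSize v c f ≠ ∞) (t : Tm) :
    Tendsto (fun n => wLp (fun x => w x * v x) c.i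
      (fun x => M.evalPi t x (f x) - (S n).evalPi t x (f x))) atTop (𝓝 0) := by
  set U := ∑ a ∈ 𝒯.below c, ENNReal.ofReal ((t : ℝ) ^ ((a : Idx).r / ℓ)) with hU
  have hUt : U ≠ ∞ := ENNReal.sum_ne_top.2 fun _ _ => ENNReal.ofReal_ne_top
  have h1 : Tendsto (fun n => U * ((M.sub (S n)).norm s ℓ w wstar c * mdSize v c f)) atTop
      (𝓝 (U * (0 * mdSize v c f))) :=
    ENNReal.Tendsto.const_mul (ENNReal.Tendsto.mul_const hlim (Or.inr hsize)) (Or.inr hUt)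
  rw [zero_mul, mul_zero] at h1
  refine tendsto_of_tendsto_of_tendsto_of_le_of_le tendsto_const_nhds h1 (fun _ => zero_le)
    fun n => ?_
  simp_rw [← fun x => M.evalPi_sub (S n) (hf x) t x]
  refine (wLp_evalPi_le (ℓ := ℓ) hw hv (hM.sub (hS n)) hf hfm t).trans ?_
  gcongr
  exact le_self_add

/-- The defect of the germs of two modelled distributions. For smooth models it is an integral of
local increments; general models are reached by approximation, where the exponential moments
of the kernels dominate the increments of the approximating models. -/
lemma wLp_germ_defect_le (hs : ∀ i, 1 ≤ s i) (hℓ : 0 < ℓ) (hG : ∀ x, 0 ≤ G x)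
    (hQ : IsGTypeSemigroup s ℓ G Q) (hw : GControlled s ℓ G w wstar)
    (hv : GControlled s ℓ G v vstar)
    (hwv : GControlled s ℓ G (fun x => w x * v x) (fun x => wstar x * vstar x))
    (h0 : ∀ᵐ h : Sp d, h ≠ 0) {M₁ M₂ : ModelData d T} {f₁ f₂ : Sp d → ⨁ a, T a}
    (hM₁ : IsModel s ℓ G Q 𝒯 w wstar M₁) (hM₂ : IsModel s ℓ G Q 𝒯 w wstar M₂)
    (hf₁ : IsModelled s v vstar c M₁ f₁) (hf₂ : IsModelled s v vstar c M₂ f₂)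
    {t u : Tm} (hut : (u : ℝ) < t)
    (hint : ∫⁻ h, supKernel Q (t - u) h *
      incrementSize 𝒯 s ℓ (fun x => wstar x * vstar x) c u h ≠ ∞)
    (hK : mdSemiDist s v vstar c M₁ M₂ f₁ f₂ ≠ ∞) :
    wLp (fun x => w x * v x) c.i (fun x => (M₁.evalPi t x (f₁ x) - M₂.evalPi t x (f₂ x)) -
        applyQ Q (t - u) (fun x => M₁.evalPi u x (f₁ x) - M₂.evalPi u x (f₂ x)) x) ≤
      ((M₁.sub M₂).piNorm ℓ w c * mdSemi s v vstar c M₁ f₁ +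
        M₂.piNorm ℓ w c * mdSemiDist s v vstar c M₁ M₂ f₁ f₂) *
        ∫⁻ h, supKernel Q (t - u) h *
          incrementSize 𝒯 s ℓ (fun x => wstar x * vstar x) c u h := by
  have hM₁t := (hM₁.norm_lt_top hw c).ne
  have hM₂t := (hM₂.norm_lt_top hw c).ne
  have hz₁ : ∀ x a, a ∉ 𝒯.below c → f₁ x a = 0 := hf₁.eq_zero
  have hz₂ : ∀ x a, a ∉ 𝒯.below c → f₂ x a = 0 := hf₂.eq_zero
  have hwm := hw.measurable_weight
  have hvm := hv.measurable_weight
  have hWm := hwv.measurable_weight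
  have ht0 : 0 < (t : ℝ) := t.2.1
  have hu0 : 0 < (u : ℝ) := u.2.1
  have ht1 : (t : ℝ) ≤ 1 := t.2.2
  have hτ : 0 < (t : ℝ) - u := by linarith
  obtain ⟨S₁, hS₁, hS₁1, hS₁l⟩ := hM₁.exists_seq c
  obtain ⟨S₂, hS₂, hS₂1, hS₂l⟩ := hM₂.exists_seq c
  have hpit : ∀ {M : ModelData d T}, M.norm s ℓ w wstar c ≠ ∞ → M.piNorm ℓ w c ≠ ∞ := fun h =>
    (le_self_add.trans_lt h.lt_top).ne
  have hEm : ∀ {M M' : ModelData d T}, M.Measurable → M'.Measurable → M.norm s ℓ w wstar c ≠ ∞ →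
      M'.norm s ℓ w wstar c ≠ ∞ → ∀ t : Tm, MemWLp (fun x => w x * v x) c.i
        (fun x => M.evalPi t x (f₁ x)) ∧ MemWLp (fun x => w x * v x) c.i
        (fun x => M'.evalPi t x (f₂ x)) := fun hM hM' hMt hMt' t =>
    ⟨memWLp_evalPi hwm hvm hM (hpit hMt) hz₁ hf₁.measurable hf₁.size_lt_top.ne t,
      memWLp_evalPi hwm hvm hM' (hpit hMt') hz₂ hf₂.measurable hf₂.size_lt_top.ne t⟩
  have hE := hEm hM₁.1 hM₂.1 hM₁t hM₂t
  have hEn := fun n => hEm (hS₁ n).measurable (hS₂ n).measurable ((hS₁ n).norm_lt_top c).ne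
    ((hS₂ n).norm_lt_top c).ne
  choose D₁ hD₁m hD₁e hD₁i hD₁r using fun n => (hS₁ n).exists_increment hs hG hQ hwv c.one_le
    hz₁ hf₁.measurable hut (hEn n u).1
  choose D₂ hD₂m hD₂e hD₂i hD₂r using fun n => (hS₂ n).exists_increment hs hG hQ hwv c.one_le
    hz₂ hf₂.measurable hut (hEn n u).2
  set E : Tm → Sp d → ℝ := fun t x => M₁.evalPi t x (f₁ x) - M₂.evalPi t x (f₂ x) with hEdef
  set En : ℕ → Tm → Sp d → ℝ := fun n t x =>
    (S₁ n).evalPi t x (f₁ x) - (S₂ n).evalPi t x (f₂ x) with hEndef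
  have hEM : ∀ t, MemWLp (fun x => w x * v x) c.i (E t) := fun t =>
    (hE t).1.sub hWm c.one_le (hE t).2
  have hEnM : ∀ n t, MemWLp (fun x => w x * v x) c.i (En n t) := fun n t =>
    (hEn n t).1.sub hWm c.one_le (hEn n t).2
  have hQE := (hEM u).applyQ hs hG hQ hwv c.one_le hτ (by linarith)
  have hQEn := fun n => (hEnM n u).applyQ hs hG hQ hwv c.one_le hτ (by linarith)
  rw [wLp_sub_comm]
  -- the bound is uniform in `δ`, although the rates of the approximation depend on it
  refine wLp_le_of_superlevel hwm hw.weight_pos hWm (hQE.1.sub (hEM t).1) fun δ hδ => ?_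
  have hχm := measurable_superlevel hwm δ
  have hωm : Measurable fun x => superlevel w δ x * (w x * v x) := hχm.mul hWm
  have hω1 : ∀ (g : Sp d → ℝ), wLp (fun x => superlevel w δ x * (w x * v x)) c.i g ≤
      wLp (fun x => w x * v x) c.i g := fun g => wLp_mono_ae (ae_of_all _ fun x => by
    rw [norm_smul, norm_smul, norm_mul, Real.norm_of_nonneg (superlevel_nonneg δ x)]
    gcongr
    exact mul_le_of_le_one_left (norm_nonneg _) (superlevel_le_one δ x))
  have hω2 : ∀ (g : Sp d → ℝ), wLp (fun x => superlevel w δ x * (w x * v x)) c.i g ≤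
      wLp (fun x => superlevel w δ x * v x) c.i g := fun g => wLp_mono_ae (ae_of_all _ fun x => by
    rw [norm_smul, norm_smul, norm_mul, norm_mul, norm_mul, Real.norm_of_nonneg (hw.weight_pos x).le]
    gcongr
    exact mul_le_of_le_one_left (norm_nonneg _) (hw.weight_le_one x))
  -- convergence of the defects of the approximations
  have hlim : Tendsto (fun n => wLp (fun x => superlevel w δ x * (w x * v x)) c.i (fun x =>
      (applyQ Q (t - u) (En n u) x - En n t x) - (applyQ Q (t - u) (E u) x - E t x)))
      atTop (𝓝 0) := by
    have hconv : ∀ t : Tm, Tendsto (fun n => wLp (fun x => w x * v x) c.i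
        (fun x => En n t x - E t x)) atTop (𝓝 0) := by
      intro t
      have h3 := (tendsto_wLp_evalPi_sub hwm hvm hM₂.1 (fun n => (hS₂ n).measurable) hS₂l hz₂
        hf₂.measurable hf₂.size_lt_top.ne t).add (tendsto_wLp_evalPi_sub hwm hvm hM₁.1
        (fun n => (hS₁ n).measurable) hS₁l hz₁ hf₁.measurable hf₁.size_lt_top.ne t)
      rw [add_zero] at h3
      refine tendsto_of_tendsto_of_tendsto_of_le_of_le tendsto_const_nhds h3 (fun _ => zero_le)
        fun n => ?_
      refine le_trans (le_of_eq ?_) (wLp_sub_le hWm c.one_le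
        ((hE t).2.1.sub (hEn n t).2.1) ((hE t).1.1.sub (hEn n t).1.1))
      congr 1
      funext x
      simp only [hEdef, hEndef]
      ring
    obtain ⟨C, hC, hop⟩ := wLp_applyQ_le hs hG hQ hwv
    have h4 : Tendsto (fun n => ENNReal.ofReal C * wLp (fun x => w x * v x) c.i
        (fun x => En n u x - E u x) + wLp (fun x => w x * v x) c.i
        (fun x => En n t x - E t x)) atTop (𝓝 (ENNReal.ofReal C * 0 + 0)) :=
      (ENNReal.Tendsto.const_mul (hconv u) (Or.inr ENNReal.ofReal_ne_top)).add (hconv t)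
    rw [mul_zero, add_zero] at h4
    refine tendsto_of_tendsto_of_tendsto_of_le_of_le tendsto_const_nhds h4 (fun _ => zero_le)
      fun n => ?_
    refine (hω1 _).trans ?_
    have h5 := (hop c.i c.one_le (t - u) hτ (by linarith) _ ((hEnM n u).1.sub (hEM u).1)).2
    have h6 := applyQ_sub hs hG hQ hwv c.one_le (hEnM n u) (hEM u) hτ (by linarith)
    refine le_trans (le_of_eq ?_) ((wLp_sub_le hWm c.one_le ((hQEn n).1.sub hQE.1)
      ((hEnM n t).1.sub (hEM t).1)).trans (add_le_add (le_trans (le_of_eq ?_) h5) le_rfl))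
    · congr 1
      funext x
      simp only [Pi.sub_apply]
      ring
    · congr 1
      exact h6.symm
  obtain ⟨β₁, hβ₁m, hβ₁t, hβ₁⟩ := exists_increment_sub_le (𝒯 := 𝒯) hs hw hv hM₁.1 (hpit hM₁t) hz₁
    hf₁.measurable hf₁.size_lt_top.ne hf₁.semi_lt_top.ne hδ u
  obtain ⟨β₂, hβ₂m, hβ₂t, hβ₂⟩ := exists_increment_sub_le (𝒯 := 𝒯) hs hw hv hM₂.1 (hpit hM₂t) hz₂
    hf₂.measurable hf₂.size_lt_top.ne hf₂.semi_lt_top.ne hδ u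
  obtain ⟨r₁, C₁, hC₁, hg₁⟩ := exists_increment_growth hs hG hQ 𝒯 hw hv c
    (ENNReal.add_ne_top.2 ⟨hM₁t, ENNReal.one_ne_top⟩) hf₁.size_lt_top.ne hδ u
  obtain ⟨r₂, C₂, hC₂, hg₂⟩ := exists_increment_growth hs hG hQ 𝒯 hw hv c
    (ENNReal.add_ne_top.2 ⟨hM₂t, ENNReal.one_ne_top⟩) hf₂.size_lt_top.ne hδ u
  have hSnorm : ∀ {M S : ModelData d T}, M.Measurable → S.Measurable →
      (M.sub S).norm s ℓ w wstar c ≤ 1 → S.norm s ℓ w wstar c ≤ M.norm s ℓ w wstar c + 1 :=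
    fun {M S} hM hS h => (ModelData.norm_le_add hwm hw.one_le_star hS hM).trans
      (add_le_add le_rfl (by rw [ModelData.norm_sub_comm]; exact h))
  -- at fixed `h`, the increments of the approximations satisfy the desired bound up to an error that
  -- vanishes in the limit; their exponential growth provides the dominating function
  set K := (M₁.sub M₂).piNorm ℓ w c * mdSemi s v vstar c M₁ f₁ +
    M₂.piNorm ℓ w c * mdSemiDist s v vstar c M₁ M₂ f₁ f₂ with hKdef
  have hKt : K ≠ ∞ := by
    refine ENNReal.add_ne_top.2 ⟨ENNReal.mul_ne_top ?_ hf₁.semi_lt_top.ne,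
      ENNReal.mul_ne_top (hpit hM₂t) hK⟩
    have h3 := ModelData.piNorm_le_add (ℓ := ℓ) (c := c) hwm (hM₁.1.sub hM₂.1) hM₁.1
    have e : (M₁.sub M₂).sub M₁ = (⟨fun t a x => -M₂.pi t a x, fun h a b x => -M₂.gam h a b x⟩ :
        ModelData d T) := by
      simp [ModelData.sub]
    rw [e] at h3
    refine (h3.trans_lt (ENNReal.add_lt_top.2 ⟨(hpit hM₁t).lt_top, ?_⟩)).ne
    have e2 : (⟨fun t a x => -M₂.pi t a x, fun h a b x => -M₂.gam h a b x⟩ :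
        ModelData d T).piNorm ℓ w c = M₂.piNorm ℓ w c := by
      simp only [ModelData.piNorm, wLp_neg]
    rw [e2]
    exact (hpit hM₂t).lt_top
  set β := incrementSize 𝒯 s ℓ (fun x => wstar x * vstar x) c u with hβ
  have hβm : Measurable β := measurable_incrementSize hs hwv.continuous_star u
  have hκm := measurable_supKernel hQ hτ
  have hcomm : ∫⁻ h, supKernel Q (t - u) h * (K * β h) = K * ∫⁻ h, supKernel Q (t - u) h * β h := by
    rw [← lintegral_const_mul' _ _ hKt]
    exact lintegral_congr fun h => by ring
  -- the kernels have exponential moments of every order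
  have hbi : ∫⁻ h, supKernel Q (t - u) h * (C₁ * expGrowth r₁ h + C₂ * expGrowth r₂ h) ≠ ∞ := by
    have e : ∀ h, supKernel Q (t - u) h * (C₁ * expGrowth r₁ h + C₂ * expGrowth r₂ h) =
        C₁ * (supKernel Q (t - u) h * expGrowth r₁ h) +
          C₂ * (supKernel Q (t - u) h * expGrowth r₂ h) := fun h => by ring
    have hm1 : Measurable fun h => C₁ * (supKernel Q (t - u) h * expGrowth r₁ h) :=
      (hκm.mul (measurable_expGrowth r₁)).const_mul _
    simp_rw [e]
    rw [lintegral_add_left hm1, lintegral_const_mul' _ _ hC₁, lintegral_const_mul' _ _ hC₂]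
    exact ENNReal.add_ne_top.2 ⟨ENNReal.mul_ne_top hC₁ (expGrowth_lintegral_ne_top hs hℓ hG hQ hw
      r₁ hτ (by linarith)), ENNReal.mul_ne_top hC₂ (expGrowth_lintegral_ne_top hs hℓ hG hQ hw
      r₂ hτ (by linarith))⟩
  rw [← hcomm]
  refine wLp_le_of_tendsto_increments hQ hωm c.one_le hτ h0 (hQE.1.sub (hEM t).1)
    (Vn := fun n x => applyQ Q (t - u) (En n u) x - En n t x)
    (Dn := fun n x h => D₁ n x h - D₂ n x h)
    (fun n => (hQEn n).1.sub (hEnM n t).1) hlim (fun n => (hD₁m n).sub (hD₂m n)) (fun n x => ?_)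
    (β := fun h => K * β h) (β' := fun h => β₁ h + β₂ h)
    (b := fun h => C₁ * expGrowth r₁ h + C₂ * expGrowth r₂ h)
    (e := fun n => (M₁.sub (S₁ n)).norm s ℓ w wstar c + (M₂.sub (S₂ n)).norm s ℓ w wstar c)
    (hβm.const_mul K) (hβ₁m.add hβ₂m)
    (((measurable_expGrowth r₁).const_mul _).add ((measurable_expGrowth r₂).const_mul _))
    (by simpa using hS₁l.add hS₂l) (fun h => ENNReal.mul_ne_top hKt (incrementSize_ne_top u h))
    (fun h => ENNReal.add_ne_top.2 ⟨hβ₁t h, hβ₂t h⟩)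
    (fun h => ENNReal.add_ne_top.2 ⟨ENNReal.mul_ne_top hC₁ ENNReal.ofReal_ne_top,
      ENNReal.mul_ne_top hC₂ ENNReal.ofReal_ne_top⟩)
    (by rw [hcomm]; exact ENNReal.mul_ne_top hKt hint) hbi (fun n h hh => ?_) (fun n h hh => ?_)
  · have h6 := applyQ_sub hs hG hQ hwv c.one_le (hEn n u).1 (hEn n u).2 hτ (by linarith)
    have h7 := integral_sub (hD₁i n x) (hD₂i n x)
    rw [← hD₁r, ← hD₂r] at h7
    simp only [hEndef, h6, mul_sub]
    rw [h7]
    ring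
  · have hi₁ : (fun x => D₁ n x h) = fun x => increment 𝒯 c (S₁ n) f₁ u x h :=
      funext fun x => hD₁e n h hh x
    have hi₂ : (fun x => D₂ n x h) = fun x => increment 𝒯 c (S₂ n) f₂ u x h :=
      funext fun x => hD₂e n h hh x
    have a₁ := aestronglyMeasurable_increment (c := c) (hS₁ n).measurable hz₁ hf₁.measurable u hh
    have a₂ := aestronglyMeasurable_increment (c := c) (hS₂ n).measurable hz₂ hf₂.measurable u hh
    have a₃ := aestronglyMeasurable_increment (c := c) hM₁.1 hz₁ hf₁.measurable u hh
    have a₄ := aestronglyMeasurable_increment (c := c) hM₂.1 hz₂ hf₂.measurable u hh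
    have b₁ := (hω2 _).trans (hβ₁ (S₁ n) (hS₁ n).measurable (hS₁1 n) h hh)
    have b₂ := (hω2 _).trans (hβ₂ (S₂ n) (hS₂ n).measurable (hS₂1 n) h hh)
    have b₃ := (hω1 _).trans (wLp_increment_sub_le (c := c) (𝒯 := 𝒯) hw hv hM₁.1 hM₂.1 hz₁
      hf₁.measurable hz₂ hf₂.measurable u hh)
    have e : (fun x => D₁ n x h - D₂ n x h) = fun x =>
        (increment 𝒯 c M₁ f₁ u x h - increment 𝒯 c M₂ f₂ u x h) +
          ((increment 𝒯 c (S₁ n) f₁ u x h - increment 𝒯 c M₁ f₁ u x h) -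
            (increment 𝒯 c (S₂ n) f₂ u x h - increment 𝒯 c M₂ f₂ u x h)) := by
      funext x
      rw [congrFun hi₁ x, congrFun hi₂ x]
      ring
    rw [e]
    refine (wLp_add_le hωm c.one_le (a₃.sub a₄) ((a₁.sub a₃).sub (a₂.sub a₄))).trans
      (add_le_add b₃ ?_)
    refine (wLp_sub_le hωm c.one_le (a₁.sub a₃) (a₂.sub a₄)).trans ((add_le_add b₁ b₂).trans ?_)
    rw [mul_add]
    gcongr
    · exact le_self_add
    · exact le_add_self
  · have c₁ := hg₁ (S₁ n) f₁ (hS₁ n) (hSnorm hM₁.1 (hS₁ n).measurable (hS₁1 n)) hz₁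
      hf₁.measurable le_rfl h hh
    have c₂ := hg₂ (S₂ n) f₂ (hS₂ n) (hSnorm hM₂.1 (hS₂ n).measurable (hS₂1 n)) hz₂
      hf₂.measurable le_rfl h hh
    simp_rw [← hD₁e n h hh] at c₁
    simp_rw [← hD₂e n h hh] at c₂
    have a₁ := aestronglyMeasurable_increment (c := c) (hS₁ n).measurable hz₁ hf₁.measurable u hh
    have a₂ := aestronglyMeasurable_increment (c := c) (hS₂ n).measurable hz₂ hf₂.measurable u hh
    have hi₁ : (fun x => D₁ n x h) = fun x => increment 𝒯 c (S₁ n) f₁ u x h :=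
      funext fun x => hD₁e n h hh x
    have hi₂ : (fun x => D₂ n x h) = fun x => increment 𝒯 c (S₂ n) f₂ u x h :=
      funext fun x => hD₂e n h hh x
    rw [← hi₁] at a₁
    rw [← hi₂] at a₂
    exact (wLp_sub_le hωm c.one_le a₁ a₂).trans
      (add_le_add ((hω2 _).trans c₁) ((hω2 _).trans c₂))

end AlmostOrbit

/-! ### Reconstructions as orbits of the semigroup -/

section Reconstruction

variable {d : ℕ} {s : Fin d → ℝ} {ℓ : ℝ} {G : Sp d → ℝ} {Q : ℝ → Sp d → Sp d → ℝ}
  {W Wstar : Sp d → ℝ} {p : ℝ≥0∞}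

/-- Extension by zero of a family indexed by `0 < t ≤ 1` to all real times. -/
noncomputable def extendTm (E : Tm → Sp d → ℝ) (t : ℝ) : Sp d → ℝ :=
  open scoped Classical in if h : t ∈ Set.Ioc (0 : ℝ) 1 then E ⟨t, h⟩ else 0

lemma extendTm_of_mem (E : Tm → Sp d → ℝ) {t : ℝ} (ht : 0 < t) (ht1 : t ≤ 1) :
    extendTm E t = E ⟨t, ht, ht1⟩ := by
  unfold extendTm
  exact dif_pos (show t ∈ Set.Ioc (0 : ℝ) 1 from ⟨ht, ht1⟩)

lemma extendTm_coe (E : Tm → Sp d → ℝ) (t : Tm) : extendTm E t = E t :=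
  extendTm_of_mem E t.2.1 t.2.2

lemma wLp_le_of_besovNorm_le {α : ℝ} {u : Tm → Sp d → ℝ} {K : ℝ≥0∞}
    (h : besovNorm ℓ α p W u ≤ K) (t : Tm) :
    wLp W p (u t) ≤ ENNReal.ofReal ((t : ℝ) ^ (α / ℓ)) * K := by
  refine le_ofReal_rpow_mul t.2.1 (le_trans ?_ h)
  exact (le_iSup (fun t : Tm => ENNReal.ofReal ((t : ℝ) ^ (-α / ℓ)) * wLp W p (u t)) t).trans
    le_add_self

lemma besovNorm_le {α : ℝ} {u : Tm → Sp d → ℝ} {K : ℝ≥0∞}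
    (h : ∀ t : Tm, wLp W p (u t) ≤ ENNReal.ofReal ((t : ℝ) ^ (α / ℓ)) * K) :
    besovNorm ℓ α p W u ≤ 2 * K := by
  rw [two_mul]
  refine add_le_add ?_ (iSup_le fun t => ofReal_rpow_mul_le t.2.1 (h t))
  have h1 := h Tm.one
  have e : ((Tm.one : Tm) : ℝ) = 1 := rfl
  rwa [e, Real.one_rpow, ENNReal.ofReal_one, one_mul] at h1

lemma besovNorm_congr {α : ℝ} {u u' : Tm → Sp d → ℝ} (h : ∀ t, u t =ᵐ[volume] u' t) :
    besovNorm ℓ α p W u = besovNorm ℓ α p W u' := by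
  simp only [besovNorm, fun t => wLp_congr_ae (w := W) (p := p) (h t)]

lemma BesovElt.aestronglyMeasurable_eval (Λ : BesovElt d) (t : Tm) :
    AEStronglyMeasurable (Λ.eval t) volume :=
  AEEqFun.aestronglyMeasurable (Λ t)

lemma wLp_lt_top_of_besovNorm {α : ℝ} {u : Tm → Sp d → ℝ} (h : besovNorm ℓ α p W u < ∞) (t : Tm) :
    wLp W p (u t) < ∞ :=
  (wLp_le_of_besovNorm_le le_rfl t).trans_lt (ENNReal.mul_lt_top ENNReal.ofReal_lt_top h)

/-- Elements of Besov spaces are compatible with the semigroup, since this holds for the functions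
approximating them in a Besov space of lower regularity. -/
lemma MemBesov.isOrbit (hs : ∀ i, 1 ≤ s i) (hG : ∀ x, 0 ≤ G x)
    (hQ : IsGTypeSemigroup s ℓ G Q) (hW : GControlled s ℓ G W Wstar) (hp : 1 ≤ p) {α : ℝ}
    {Λ : BesovElt d} (hΛ : MemBesov Q ℓ α p W Λ) : IsOrbit Q W p (extendTm Λ.eval) := by
  have hmem : ∀ t : Tm, MemWLp W p (Λ.eval t) := fun t =>
    ⟨Λ.aestronglyMeasurable_eval t, wLp_lt_top_of_besovNorm hΛ.2 t⟩
  refine ⟨fun t ht ht1 => ?_, fun u t hu hut ht1 => ?_⟩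
  · rw [extendTm_of_mem _ ht ht1]; exact hmem _
  have ht : 0 < t := hu.trans hut
  have hu1 : u ≤ 1 := hut.le.trans ht1
  have htu : 0 < t - u := by linarith
  rw [extendTm_of_mem _ ht ht1, extendTm_of_mem _ hu hu1]
  set t' : Tm := ⟨t, ht, ht1⟩ with ht'
  set u' : Tm := ⟨u, hu, hu1⟩ with hu'
  have hQΛ := (hmem u').applyQ hs hG hQ hW hp htu (by linarith)
  obtain ⟨C, hC, hop⟩ := wLp_applyQ_le hs hG hQ hW
  refine ae_eq_of_wLp_sub_eq_zero hW.measurable_weight hW.weight_pos hp (hmem t').1 hQΛ.1 ?_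
  set β := α - 1 with hβ
  -- any approximating function `f` satisfies `Q_t f = Q_{t-u} Q_u f` exactly
  set K : ℝ≥0∞ := ENNReal.ofReal (t ^ (β / ℓ)) +
    ENNReal.ofReal C * ENNReal.ofReal (u ^ (β / ℓ)) with hK
  have hKt : K ≠ ∞ := by finiteness
  have hbound : ∀ ε : ℝ≥0∞, 0 < ε →
      wLp W p (fun x => Λ.eval t' x - applyQ Q (t - u) (Λ.eval u') x) ≤ K * ε := by
    intro ε hε
    obtain ⟨f, hf, hlt⟩ := hΛ.1 β (by linarith) ε hε
    have h1 := wLp_le_of_besovNorm_le hlt.le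
    have hQf := hf.1.applyQ hs hG hQ hW hp ht (by linarith)
    have hQfu := hf.1.applyQ hs hG hQ hW hp hu (by linarith)
    have e1 : applyQ Q t f = applyQ Q (t - u) (applyQ Q u f) := by
      rw [applyQ_applyQ hs hG hQ hW hp hf.1 htu hu (by linarith), sub_add_cancel]
    have h2 := (hop p hp (t - u) htu (by linarith) _ ((hmem u').sub hW.measurable_weight hp hQfu).1).2
    rw [applyQ_sub hs hG hQ hW hp (hmem u') hQfu htu (by linarith), ← e1] at h2
    refine (wLp_sub_le_add hW.measurable_weight hp (hmem t').1 hQf.1 hQΛ.1).trans ?_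
    rw [wLp_sub_comm (applyQ Q t f), hK, add_mul, mul_assoc]
    exact add_le_add (h1 t') (h2.trans (mul_le_mul_right (h1 u') _))
  refine nonpos_iff_eq_zero.1 (le_of_forall_gt fun ε hε => ?_)
  obtain ⟨a, ha, hlt⟩ := exists_pos_forall_ofReal_mul_lt hKt hε
  refine (hbound (ENNReal.ofReal a) (ENNReal.ofReal_pos.2 ha)).trans_lt ?_
  rw [mul_comm]
  exact hlt a le_rfl

lemma IsOrbit.sub (hs : ∀ i, 1 ≤ s i) (hG : ∀ x, 0 ≤ G x)
    (hQ : IsGTypeSemigroup s ℓ G Q) (hW : GControlled s ℓ G W Wstar) (hp : 1 ≤ p)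
    {Λ₁ Λ₂ : ℝ → Sp d → ℝ} (h₁ : IsOrbit Q W p Λ₁) (h₂ : IsOrbit Q W p Λ₂) :
    IsOrbit Q W p (fun t x => Λ₁ t x - Λ₂ t x) := by
  refine ⟨fun t ht ht1 => (h₁.mem t ht ht1).sub hW.measurable_weight hp (h₂.mem t ht ht1),
    fun u t hu hut ht1 => ?_⟩
  rw [applyQ_sub hs hG hQ hW hp (h₁.mem u hu (hut.le.trans ht1)) (h₂.mem u hu (hut.le.trans ht1))
    (by linarith) (by linarith)]
  filter_upwards [h₁.semigroup u t hu hut ht1, h₂.semigroup u t hu hut ht1] with x hx₁ hx₂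
  rw [hx₁, hx₂]

/-- An orbit of the semigroup with a suitable bound defines an element of a Besov space. -/
lemma IsOrbit.exists_memBesov (hs : ∀ i, 1 ≤ s i) (hℓ : 0 < ℓ) (hG : ∀ x, 0 ≤ G x)
    (hQ : IsGTypeSemigroup s ℓ G Q) (hW : GControlled s ℓ G W Wstar) (hp : 1 ≤ p)
    {Λ : ℝ → Sp d → ℝ} (hΛ : IsOrbit Q W p Λ) {α : ℝ} (hα : α ≤ 0) {K : ℝ≥0∞} (hK : K ≠ ∞)
    (hb : ∀ t, 0 < t → t ≤ 1 → wLp W p (Λ t) ≤ ENNReal.ofReal (t ^ (α / ℓ)) * K) :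
    ∃ Λ' : BesovElt d, MemBesov Q ℓ α p W Λ' ∧ ∀ t : Tm, Λ'.eval t =ᵐ[volume] Λ t := by
  have hm : ∀ t : Tm, AEStronglyMeasurable (Λ t) volume := fun t => (hΛ.mem t t.2.1 t.2.2).1
  set Λ' : BesovElt d := fun t => AEEqFun.mk (Λ t) (hm t) with hΛ'
  have hae : ∀ t : Tm, Λ'.eval t =ᵐ[volume] Λ t := fun t => AEEqFun.coeFn_mk (Λ t) (hm t)
  refine ⟨Λ', ⟨fun β hβ ε hε => ?_, ?_⟩, hae⟩
  · obtain ⟨f, hf, hlt⟩ := hΛ.exists_approx hs hℓ hG hQ hW hp hβ (hβ.le.trans hα) hK hb hε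
    refine ⟨f, hf, lt_of_le_of_lt (le_of_eq (besovNorm_congr fun t => ?_)) hlt⟩
    filter_upwards [hae t] with x hx
    rw [hx]
  · rw [besovNorm_congr hae]
    refine (besovNorm_le fun t => hb t t.2.1 t.2.2).trans_lt ?_
    exact ENNReal.mul_lt_top (by finiteness) hK.lt_top

lemma wLp_le_of_recSup_le {c : Idx} {D : Tm → Sp d → ℝ} {K : ℝ≥0∞} (h : recSup ℓ W c D ≤ K)
    (t : Tm) : wLp W c.i (D t) ≤ ENNReal.ofReal ((t : ℝ) ^ (c.r / ℓ)) * K :=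
  le_ofReal_rpow_mul t.2.1
    ((le_iSup (fun t : Tm => ENNReal.ofReal ((t : ℝ) ^ (-c.r / ℓ)) * wLp W c.i (D t)) t).trans h)

lemma recSup_le {c : Idx} {D : Tm → Sp d → ℝ} {K : ℝ≥0∞}
    (h : ∀ t : Tm, wLp W c.i (D t) ≤ ENNReal.ofReal ((t : ℝ) ^ (c.r / ℓ)) * K) :
    recSup ℓ W c D ≤ K :=
  iSup_le fun t => ofReal_rpow_mul_le t.2.1 (h t)

end Reconstruction

/-! ### Bounds for pairs of modelled distributions -/

section Pair

variable {d : ℕ} {s : Fin d → ℝ} {ℓ : ℝ} {G : Sp d → ℝ} {Q : ℝ → Sp d → Sp d → ℝ}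
  {A : Set Idx} {T : A → Type*} [∀ a, NormedAddCommGroup (T a)] [∀ a, NormedSpace ℝ (T a)]
  {w wstar v vstar : Sp d → ℝ} {c : Idx} {α₀ : ℝ}

/-- The difference of the germs `Q_t(x, Π_x f(x))` of two modelled distributions. -/
noncomputable def germSub (M₁ M₂ : ModelData d T) (f₁ f₂ : Sp d → ⨁ a, T a) (t : Tm) (x : Sp d) :
    ℝ :=
  M₁.evalPi t x (f₁ x) - M₂.evalPi t x (f₂ x)

/-- The quantity controlling the coherence of a pair of modelled distributions. The choice `M₁ = M₂`,
`f₂ = 0` recovers `‖Π‖ ‖f‖` for a single modelled distribution. -/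
noncomputable def pairSemi (s : Fin d → ℝ) (ℓ : ℝ) (w v vstar : Sp d → ℝ) (c : Idx)
    (M₁ M₂ : ModelData d T) (f₁ f₂ : Sp d → ⨁ a, T a) : ℝ≥0∞ :=
  (M₁.sub M₂).piNorm ℓ w c * mdSemi s v vstar c M₁ f₁ +
    M₂.piNorm ℓ w c * mdSemiDist s v vstar c M₁ M₂ f₁ f₂

/-- The quantity controlling the size of the difference of the germs of a pair of modelled
distributions. -/
noncomputable def pairSize (ℓ : ℝ) (w v : Sp d → ℝ) (c : Idx)
    (M₁ M₂ : ModelData d T) (f₁ f₂ : Sp d → ⨁ a, T a) : ℝ≥0∞ :=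
  (M₁.sub M₂).piNorm ℓ w c * mdSize v c f₁ + M₂.piNorm ℓ w c * mdSize v c (fun x => f₁ x - f₂ x)

lemma mdDelta_zero (M : ModelData d T) (h x : Sp d) (a : A) :
    mdDelta M (fun _ => 0) h x a = 0 := by
  unfold mdDelta
  rw [M.evalGam_eq_sum (B := ∅) _ _ _ fun _ _ => rfl]
  simp

lemma mdSemiDist_zero (M : ModelData d T) (f : Sp d → ⨁ a, T a) :
    mdSemiDist s v vstar c M M f (fun _ => 0) = mdSemi s v vstar c M f := by
  unfold mdSemiDist mdSemi
  simp only [mdDelta_zero, sub_zero]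

lemma germSub_zero (M : ModelData d T) (f : Sp d → ⨁ a, T a) (t : Tm) (x : Sp d) :
    germSub M M f (fun _ => 0) t x = M.evalPi t x (f x) := by
  simp [germSub, ModelData.evalPi]

lemma piNorm_sub_self (M : ModelData d T) : (M.sub M).piNorm ℓ w c = 0 := by
  have h : ∀ t a, (M.sub M).pi t a = fun _ => 0 := fun t a => by
    funext x; simp [ModelData.sub]
  simp [ModelData.piNorm, h, wLp_zero]

lemma pairSemi_zero (M : ModelData d T) (f : Sp d → ⨁ a, T a) :
    pairSemi s ℓ w v vstar c M M f (fun _ => 0) =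
      M.piNorm ℓ w c * mdSemi s v vstar c M f := by
  rw [pairSemi, piNorm_sub_self, zero_mul, zero_add, mdSemiDist_zero]

lemma pairSize_zero (M : ModelData d T) (f : Sp d → ⨁ a, T a) :
    pairSize ℓ w v c M M f (fun _ => 0) = M.piNorm ℓ w c * mdSize v c f := by
  simp only [pairSize, piNorm_sub_self, zero_mul, zero_add, sub_zero]

lemma isModelled_zero (M : ModelData d T) : IsModelled s v vstar c M (fun _ => 0) where
  support _ _ _ := rfl
  measurable _ := aestronglyMeasurable_const
  size_lt_top := by
    simp [mdSize, wLp_zero]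
  semi_lt_top := by
    simp [mdSemi, mdHolder, mdDelta_zero, wLp_zero]

lemma wLp_recDefect_le (W : Sp d → ℝ) (M : ModelData d T) (f : Sp d → ⨁ a, T a)
    (Λ : BesovElt d) (t : Tm) : wLp W c.i (recDefect M f Λ t) ≤
      ENNReal.ofReal ((t : ℝ) ^ (c.r / ℓ)) * recSup ℓ W c (recDefect M f Λ) :=
  wLp_le_of_recSup_le (D := recDefect M f Λ) le_rfl t

variable [∀ a, CompleteSpace (T a)] {𝒯 : RIStructure A T}

/-- The difference of the germs of two modelled distributions is almost an orbit. -/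
lemma exists_isAlmostOrbit_germSub (hs : ∀ i, 1 ≤ s i) (hℓ : 0 < ℓ) (hG : ∀ x, 0 ≤ G x)
    (hQ : IsGTypeSemigroup s ℓ G Q) (𝒯 : RIStructure A T) (hw : GControlled s ℓ G w wstar)
    (hv : GControlled s ℓ G v vstar)
    (hwv : GControlled s ℓ G (fun x => w x * v x) (fun x => wstar x * vstar x))
    (h0 : ∀ᵐ h : Sp d, h ≠ 0) (c : Idx) :
    ∃ C : ℝ, 0 < C ∧ ∀ (M₁ M₂ : ModelData d T) (f₁ f₂ : Sp d → ⨁ a, T a),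
      IsModel s ℓ G Q 𝒯 w wstar M₁ → IsModel s ℓ G Q 𝒯 w wstar M₂ →
      IsModelled s v vstar c M₁ f₁ → IsModelled s v vstar c M₂ f₂ →
      IsAlmostOrbit Q (fun x => w x * v x) c.i (c.r / ℓ)
        (ENNReal.ofReal C * pairSemi s ℓ w v vstar c M₁ M₂ f₁ f₂)
        (extendTm (germSub M₁ M₂ f₁ f₂)) := by
  obtain ⟨C, hC, hint⟩ := exists_lintegral_incrementSize_le hs hℓ hG hQ 𝒯 hwv c
  refine ⟨C, hC, fun M₁ M₂ f₁ f₂ hM₁ hM₂ hf₁ hf₂ => ⟨fun t ht ht1 => ?_,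
    fun t u ht ht1 hu4 hu2 => ?_⟩⟩
  · rw [extendTm_of_mem _ ht ht1]
    exact (memWLp_evalPi (𝒯 := 𝒯) hw.measurable_weight hv.measurable_weight hM₁.1
      (le_self_add.trans_lt (hM₁.norm_lt_top hw c)).ne hf₁.eq_zero hf₁.measurable
      hf₁.size_lt_top.ne _).sub hwv.measurable_weight c.one_le
      (memWLp_evalPi (𝒯 := 𝒯) hw.measurable_weight hv.measurable_weight hM₂.1
      (le_self_add.trans_lt (hM₂.norm_lt_top hw c)).ne hf₂.eq_zero hf₂.measurable
      hf₂.size_lt_top.ne _)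
  · have hu : 0 < u := by linarith
    have hu1 : u ≤ 1 := by linarith
    rw [extendTm_of_mem _ ht ht1, extendTm_of_mem _ hu hu1]
    have h1 := hint ⟨t, ht, ht1⟩ ⟨u, hu, hu1⟩ hu4 hu2
    refine (wLp_germ_defect_le hs hℓ hG hQ hw hv hwv h0 hM₁ hM₂ hf₁ hf₂ (t := ⟨t, ht, ht1⟩)
      (u := ⟨u, hu, hu1⟩) (by show u < t; linarith) (h1.trans_lt ENNReal.ofReal_lt_top).ne
      (mdSemiDist_lt_top hv hM₁.1 hM₂.1 hf₁ hf₂ 𝒯).ne).trans ?_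
    refine (mul_le_mul_right h1 _).trans (le_of_eq ?_)
    rw [ENNReal.ofReal_mul hC.le, pairSemi]
    ring

lemma exists_wLp_germSub_le (𝒯 : RIStructure A T) (hℓ : 0 < ℓ) (hreg : IsRegularity A α₀)
    (hw : GControlled s ℓ G w wstar) (hv : GControlled s ℓ G v vstar)
    (hwv : GControlled s ℓ G (fun x => w x * v x) (fun x => wstar x * vstar x)) (c : Idx) :
    ∃ C : ℝ, 0 < C ∧ ∀ (M₁ M₂ : ModelData d T) (f₁ f₂ : Sp d → ⨁ a, T a),
      M₁.Measurable → M₂.Measurable →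
      IsModelled s v vstar c M₁ f₁ → IsModelled s v vstar c M₂ f₂ → ∀ t : Tm,
      wLp (fun x => w x * v x) c.i (germSub M₁ M₂ f₁ f₂ t) ≤
        ENNReal.ofReal ((t : ℝ) ^ (α₀ / ℓ)) *
          (ENNReal.ofReal C * pairSize ℓ w v c M₁ M₂ f₁ f₂) := by
  refine ⟨(𝒯.below c).card + 1, by positivity, fun M₁ M₂ f₁ f₂ hM₁ hM₂ hf₁ hf₂ t => ?_⟩
  have ht := t.2.1
  have hwm := hw.measurable_weight
  have hvm := hv.measurable_weight
  have hz₁ : ∀ x a, a ∉ 𝒯.below c → f₁ x a = 0 := hf₁.eq_zero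
  have hz₂ : ∀ x a, a ∉ 𝒯.below c → f₂ x a = 0 := hf₂.eq_zero
  have hsub : ∀ x a, (f₁ x - f₂ x) a = f₁ x a - f₂ x a := fun x a => DFinsupp.sub_apply _ _ _
  have hz : ∀ x a, a ∉ 𝒯.below c → (f₁ x - f₂ x) a = 0 := fun x a ha => by
    rw [hsub, hz₁ x a ha, hz₂ x a ha, sub_zero]
  have hm : ∀ a, AEStronglyMeasurable (fun x => (f₁ x - f₂ x) a) volume := fun a => by
    simp_rw [hsub]
    exact (hf₁.measurable a).sub (hf₂.measurable a)
  have hU : ∑ a ∈ 𝒯.below c, ENNReal.ofReal ((t : ℝ) ^ ((a : Idx).r / ℓ)) ≤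
      ENNReal.ofReal ((t : ℝ) ^ (α₀ / ℓ)) * ENNReal.ofReal ((𝒯.below c).card + 1) := by
    calc _ ≤ ∑ a ∈ 𝒯.below c, ENNReal.ofReal ((t : ℝ) ^ (α₀ / ℓ)) := by
          refine Finset.sum_le_sum fun a _ => ENNReal.ofReal_le_ofReal ?_
          refine Real.rpow_le_rpow_of_exponent_ge ht t.2.2 ?_
          gcongr
          exact (hreg a a.2).1
      _ = (𝒯.below c).card * ENNReal.ofReal ((t : ℝ) ^ (α₀ / ℓ)) := by
          rw [Finset.sum_const, nsmul_eq_mul]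
      _ ≤ _ := by
          rw [mul_comm, ENNReal.ofReal_add (by positivity) (by positivity), ENNReal.ofReal_natCast]
          gcongr
          exact le_self_add
  have e : germSub M₁ M₂ f₁ f₂ t = fun x =>
      (M₁.sub M₂).evalPi t x (f₁ x) + M₂.evalPi t x (f₁ x - f₂ x) := by
    funext x
    exact evalPi_sub_evalPi M₁ M₂ hz₁ hz₂ t x
  rw [e, ← mul_assoc, pairSize, mul_add]
  refine (wLp_add_le hwv.measurable_weight c.one_le
    (ModelData.aestronglyMeasurable_evalPi (hM₁.sub hM₂) t hz₁ hf₁.measurable)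
    (ModelData.aestronglyMeasurable_evalPi hM₂ t hz hm)).trans (add_le_add ?_ ?_)
  · exact (wLp_evalPi_le hwm hvm (hM₁.sub hM₂) hz₁ hf₁.measurable t).trans (mul_le_mul_left hU _)
  · exact (wLp_evalPi_le hwm hvm hM₂ hz hm t).trans (mul_le_mul_left hU _)

/-- Quantitative bounds for any orbit of the semigroup which stays close to the germ of a pair of
modelled distributions. -/
lemma exists_orbit_bounds (hs : ∀ i, 1 ≤ s i) (hℓ : 0 < ℓ) (hG : ∀ x, 0 ≤ G x)
    (hQ : IsGTypeSemigroup s ℓ G Q) (𝒯 : RIStructure A T) (hα₀ : α₀ ≤ 0)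
    (hreg : IsRegularity A α₀) (hw : GControlled s ℓ G w wstar) (hv : GControlled s ℓ G v vstar)
    (hwv : GControlled s ℓ G (fun x => w x * v x) (fun x => wstar x * vstar x))
    (h0 : ∀ᵐ h : Sp d, h ≠ 0) (c : Idx) (hc : 0 < c.r) :
    ∃ C : ℝ, 0 < C ∧ ∀ (M₁ M₂ : ModelData d T) (f₁ f₂ : Sp d → ⨁ a, T a),
      IsModel s ℓ G Q 𝒯 w wstar M₁ → IsModel s ℓ G Q 𝒯 w wstar M₂ →
      IsModelled s v vstar c M₁ f₁ → IsModelled s v vstar c M₂ f₂ →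
      ∀ (Λ : ℝ → Sp d → ℝ) (B : ℝ≥0∞), IsOrbit Q (fun x => w x * v x) c.i Λ → B ≠ ∞ →
      (∀ t : Tm, wLp (fun x => w x * v x) c.i (fun x => Λ t x - germSub M₁ M₂ f₁ f₂ t x) ≤
        ENNReal.ofReal ((t : ℝ) ^ (c.r / ℓ)) * B) → ∀ t : Tm,
      wLp (fun x => w x * v x) c.i (fun x => Λ t x - germSub M₁ M₂ f₁ f₂ t x) ≤
        ENNReal.ofReal ((t : ℝ) ^ (c.r / ℓ)) *
          (ENNReal.ofReal C * pairSemi s ℓ w v vstar c M₁ M₂ f₁ f₂) ∧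
      wLp (fun x => w x * v x) c.i (Λ t) ≤ ENNReal.ofReal ((t : ℝ) ^ (α₀ / ℓ)) *
        (ENNReal.ofReal C * (pairSemi s ℓ w v vstar c M₁ M₂ f₁ f₂ +
          pairSize ℓ w v c M₁ M₂ f₁ f₂)) := by
  have hθ : 0 < c.r / ℓ := by positivity
  obtain ⟨C₁, hC₁, halm⟩ := exists_isAlmostOrbit_germSub hs hℓ hG hQ 𝒯 hw hv hwv h0 c
  obtain ⟨C₂, hC₂, hsz⟩ := exists_wLp_germSub_le 𝒯 hℓ hreg hw hv hwv c
  obtain ⟨C₃, hC₃, horb⟩ := IsOrbit.wLp_sub_le hs hG hQ hwv hθ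
  refine ⟨C₃ * C₁ + C₂, by positivity, fun M₁ M₂ f₁ f₂ hM₁ hM₂ hf₁ hf₂ Λ B hΛ hB hb t => ?_⟩
  have ht := t.2.1
  have hA := halm M₁ M₂ f₁ f₂ hM₁ hM₂ hf₁ hf₂
  have h1 := horb c.i c.one_le _ B _ Λ hA hΛ hB (fun t ht ht1 => by
    rw [extendTm_of_mem _ ht ht1]; exact hb ⟨t, ht, ht1⟩) t ht t.2.2
  rw [extendTm_coe] at h1
  have h2 : wLp (fun x => w x * v x) c.i (fun x => Λ t x - germSub M₁ M₂ f₁ f₂ t x) ≤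
      ENNReal.ofReal ((t : ℝ) ^ (c.r / ℓ)) *
        (ENNReal.ofReal (C₃ * C₁) * pairSemi s ℓ w v vstar c M₁ M₂ f₁ f₂) := by
    refine h1.trans (le_of_eq ?_)
    rw [ENNReal.ofReal_mul hC₃.le, ENNReal.ofReal_mul hC₃.le]
    ring
  refine ⟨h2.trans ?_, ?_⟩
  · gcongr
    linarith
  · have h3 := hA.mem t ht t.2.2
    rw [extendTm_coe] at h3
    have h4 := hΛ.mem t ht t.2.2
    have hpow : (t : ℝ) ^ (c.r / ℓ) ≤ (t : ℝ) ^ (α₀ / ℓ) :=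
      Real.rpow_le_rpow_of_exponent_ge ht t.2.2 (by gcongr; linarith)
    calc wLp (fun x => w x * v x) c.i (Λ t) = wLp (fun x => w x * v x) c.i
          (fun x => (Λ t x - germSub M₁ M₂ f₁ f₂ t x) + germSub M₁ M₂ f₁ f₂ t x) := by simp
      _ ≤ _ := wLp_add_le hwv.measurable_weight c.one_le (h4.1.sub h3.1) h3.1
      _ ≤ ENNReal.ofReal ((t : ℝ) ^ (α₀ / ℓ)) *
            (ENNReal.ofReal (C₃ * C₁ + C₂) * pairSemi s ℓ w v vstar c M₁ M₂ f₁ f₂) +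
          ENNReal.ofReal ((t : ℝ) ^ (α₀ / ℓ)) *
            (ENNReal.ofReal (C₃ * C₁ + C₂) * pairSize ℓ w v c M₁ M₂ f₁ f₂) := by
          refine add_le_add (h2.trans ?_) ((hsz M₁ M₂ f₁ f₂ hM₁.1 hM₂.1 hf₁ hf₂ t).trans ?_)
          · gcongr
            linarith
          · gcongr
            have := mul_pos hC₃ hC₁
            linarith
      _ = _ := by ring

/-! ### Existence and uniqueness of the reconstruction -/

lemma IsModel.memWLp_germ {M : ModelData d T} {f : Sp d → ⨁ a, T a}
    (hw : GControlled s ℓ G w wstar) (hv : GControlled s ℓ G v vstar)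
    (hM : IsModel s ℓ G Q 𝒯 w wstar M) (hf : IsModelled s v vstar c M f) (t : Tm) :
    MemWLp (fun x => w x * v x) c.i (fun x => M.evalPi t x (f x)) :=
  memWLp_evalPi (𝒯 := 𝒯) hw.measurable_weight hv.measurable_weight hM.1
    (le_self_add.trans_lt (hM.norm_lt_top hw c)).ne hf.eq_zero hf.measurable hf.size_lt_top.ne t

/-- Sewing the germ `Q_t(x, Π_x f(x))` gives a reconstruction. -/
lemma exists_isReconstruction (hs : ∀ i, 1 ≤ s i) (hℓ : 0 < ℓ) (hG : ∀ x, 0 ≤ G x)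
    (hQ : IsGTypeSemigroup s ℓ G Q) (𝒯 : RIStructure A T) (hα₀ : α₀ ≤ 0)
    (hreg : IsRegularity A α₀) (hw : GControlled s ℓ G w wstar) (hv : GControlled s ℓ G v vstar)
    (hwv : GControlled s ℓ G (fun x => w x * v x) (fun x => wstar x * vstar x))
    (h0 : ∀ᵐ h : Sp d, h ≠ 0) (hc : 0 < c.r) {M : ModelData d T} {f : Sp d → ⨁ a, T a}
    (hM : IsModel s ℓ G Q 𝒯 w wstar M) (hf : IsModelled s v vstar c M f) :
    ∃ Λ : BesovElt d, IsReconstruction Q ℓ α₀ (fun x => w x * v x) c M f Λ := by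
  have hpi : M.piNorm ℓ w c < ∞ := le_self_add.trans_lt (hM.norm_lt_top hw c)
  have hz := isModelled_zero (s := s) (v := v) (vstar := vstar) (c := c) M
  obtain ⟨C, hC, hbd⟩ := exists_orbit_bounds hs hℓ hG hQ 𝒯 hα₀ hreg hw hv hwv h0 c hc
  obtain ⟨C', hC', halm⟩ := exists_isAlmostOrbit_germSub hs hℓ hG hQ 𝒯 hw hv hwv h0 c
  have hE := halm M M f (fun _ => 0) hM hM hf hz
  have hsemi : pairSemi s ℓ w v vstar c M M f (fun _ => 0) < ∞ := by
    rw [pairSemi_zero]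
    exact ENNReal.mul_lt_top hpi hf.semi_lt_top
  have hsize : pairSize ℓ w v c M M f (fun _ => 0) < ∞ := by
    rw [pairSize_zero]
    exact ENNReal.mul_lt_top hpi hf.size_lt_top
  obtain ⟨Λ, B, hB, hΛ, hclose⟩ := hE.exists_isOrbit hs hG hQ hwv (by positivity) c.one_le
    (ENNReal.mul_lt_top ENNReal.ofReal_lt_top hsemi).ne
  have hclose' : ∀ t : Tm, wLp (fun x => w x * v x) c.i
      (fun x => Λ t x - germSub M M f (fun _ => 0) t x) ≤
        ENNReal.ofReal ((t : ℝ) ^ (c.r / ℓ)) * B := fun t => by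
    have := hclose t t.2.1 t.2.2
    rwa [extendTm_coe] at this
  have hb := hbd M M f (fun _ => 0) hM hM hf hz Λ B hΛ hB hclose'
  obtain ⟨Λ', hΛ', hae⟩ := hΛ.exists_memBesov hs hℓ hG hQ hwv c.one_le hα₀
    (ENNReal.mul_lt_top (ENNReal.ofReal_lt_top (r := C))
      (ENNReal.add_lt_top.2 ⟨hsemi, hsize⟩)).ne (fun t ht ht1 => (hb ⟨t, ht, ht1⟩).2)
  refine ⟨Λ', hΛ', lt_of_le_of_lt (recSup_le fun t => ?_) hB.lt_top⟩
  refine le_trans (le_of_eq (wLp_congr_ae ?_)) (hclose' t)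
  filter_upwards [hae t] with x hx
  rw [recDefect, hx, germSub_zero]

/-- The difference of two reconstructions is an orbit which is close to the zero orbit, hence
vanishes. -/
lemma IsReconstruction.unique (hs : ∀ i, 1 ≤ s i) (hℓ : 0 < ℓ) (hG : ∀ x, 0 ≤ G x)
    (hQ : IsGTypeSemigroup s ℓ G Q) (hw : GControlled s ℓ G w wstar)
    (hv : GControlled s ℓ G v vstar)
    (hwv : GControlled s ℓ G (fun x => w x * v x) (fun x => wstar x * vstar x)) (hc : 0 < c.r)
    {M : ModelData d T} {f : Sp d → ⨁ a, T a} {Λ₁ Λ₂ : BesovElt d}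
    (hM : IsModel s ℓ G Q 𝒯 w wstar M) (hf : IsModelled s v vstar c M f)
    (h₁ : IsReconstruction Q ℓ α₀ (fun x => w x * v x) c M f Λ₁)
    (h₂ : IsReconstruction Q ℓ α₀ (fun x => w x * v x) c M f Λ₂) : Λ₁ = Λ₂ := by
  have hWm := hwv.measurable_weight
  have hΔ := (h₁.1.isOrbit hs hG hQ hwv c.one_le).sub hs hG hQ hwv c.one_le
    (h₂.1.isOrbit hs hG hQ hwv c.one_le)
  have hE : IsAlmostOrbit Q (fun x => w x * v x) c.i (c.r / ℓ) 0 (fun _ _ => 0) := by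
    refine ⟨fun t _ _ => ⟨aestronglyMeasurable_const, by simp [wLp_zero]⟩, fun t u _ _ _ _ => ?_⟩
    simp [applyQ, wLp_zero]
  have hclose : ∀ t : Tm, wLp (fun x => w x * v x) c.i (fun x => Λ₁.eval t x - Λ₂.eval t x) ≤
      ENNReal.ofReal ((t : ℝ) ^ (c.r / ℓ)) * (recSup ℓ (fun x => w x * v x) c (recDefect M f Λ₁) +
        recSup ℓ (fun x => w x * v x) c (recDefect M f Λ₂)) := fun t => by
    rw [mul_add]
    have h := wLp_sub_le_add hWm c.one_le (Λ₁.aestronglyMeasurable_eval t)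
      (hM.memWLp_germ hw hv hf t).1 (Λ₂.aestronglyMeasurable_eval t)
    rw [wLp_sub_comm (fun x => M.evalPi t x (f x))] at h
    exact h.trans (add_le_add (wLp_recDefect_le _ M f Λ₁ t) (wLp_recDefect_le _ M f Λ₂ t))
  obtain ⟨C', hC', hle⟩ := IsOrbit.wLp_sub_le hs hG hQ hwv (show 0 < c.r / ℓ by positivity)
  have h3 := hle c.i c.one_le 0 _ _ _ hE hΔ (ENNReal.add_lt_top.2 ⟨h₁.2, h₂.2⟩).ne
    (fun t ht ht1 => by
      have := hclose ⟨t, ht, ht1⟩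
      simpa only [extendTm_of_mem _ ht ht1, sub_zero] using this)
  funext t
  have h4 := h3 t t.2.1 t.2.2
  simp only [extendTm_coe, sub_zero, mul_zero, nonpos_iff_eq_zero] at h4
  exact AEEqFun.ext (ae_eq_of_wLp_sub_eq_zero hWm hwv.weight_pos c.one_le
    (Λ₁.aestronglyMeasurable_eval t) (Λ₂.aestronglyMeasurable_eval t) h4)

lemma wLp_recDefect_sub_le (hw : GControlled s ℓ G w wstar)
    (hv : GControlled s ℓ G v vstar) {M₁ M₂ : ModelData d T} {f₁ f₂ : Sp d → ⨁ a, T a}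
    {Λ₁ Λ₂ : BesovElt d} (hM₁ : IsModel s ℓ G Q 𝒯 w wstar M₁)
    (hM₂ : IsModel s ℓ G Q 𝒯 w wstar M₂) (hf₁ : IsModelled s v vstar c M₁ f₁)
    (hf₂ : IsModelled s v vstar c M₂ f₂) (t : Tm) :
    wLp (fun x => w x * v x) c.i
        (fun x => recDefect M₁ f₁ Λ₁ t x - recDefect M₂ f₂ Λ₂ t x) ≤
      ENNReal.ofReal ((t : ℝ) ^ (c.r / ℓ)) *
        (recSup ℓ (fun x => w x * v x) c (recDefect M₁ f₁ Λ₁) +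
          recSup ℓ (fun x => w x * v x) c (recDefect M₂ f₂ Λ₂)) := by
  have hm := hw.measurable_weight.mul hv.measurable_weight
  rw [mul_add]
  have h₁ : AEStronglyMeasurable (recDefect M₁ f₁ Λ₁ t) volume :=
    (Λ₁.aestronglyMeasurable_eval t).sub (hM₁.memWLp_germ hw hv hf₁ t).1
  have h₂ : AEStronglyMeasurable (recDefect M₂ f₂ Λ₂ t) volume :=
    (Λ₂.aestronglyMeasurable_eval t).sub (hM₂.memWLp_germ hw hv hf₂ t).1
  exact (wLp_sub_le hm c.one_le h₁ h₂).trans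
    (add_le_add (wLp_recDefect_le _ M₁ f₁ Λ₁ t) (wLp_recDefect_le _ M₂ f₂ Λ₂ t))

end Pair

end RegInt

open RegInt in
theorem mainTheorem1 {d : ℕ} (hd : 1 ≤ d) (s : Fin d → ℝ) (hs : ∀ i, 1 ≤ s i)
    (ℓ : ℝ) (hℓ : 0 < ℓ)
    (G : Sp d → ℝ) (hG_nonneg : ∀ x, 0 ≤ G x) (hG_meas : Measurable G)
    (Q : ℝ → Sp d → Sp d → ℝ) (hQ : IsGTypeSemigroup s ℓ G Q)
    {A : Set Idx} {T : A → Type*} [∀ a, NormedAddCommGroup (T a)] [∀ a, NormedSpace ℝ (T a)]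
    [∀ a, CompleteSpace (T a)] (𝒯 : RIStructure A T)
    (α₀ : ℝ) (hα₀ : α₀ ≤ 0) (hreg : IsRegularity A α₀)
    (w wstar v vstar : Sp d → ℝ)
    (hw : GControlled s ℓ G w wstar) (hv : GControlled s ℓ G v vstar)
    (hwv : GControlled s ℓ G (fun x => w x * v x) (fun x => wstar x * vstar x))
    (hww : GControlled s ℓ G (fun x => w x * w x) (fun x => wstar x * wstar x))
    (c : Idx) (hc : 0 < c.r) :
    (∀ (M : ModelData d T) (f : Sp d → ⨁ a, T a),
      IsModel s ℓ G Q 𝒯 w wstar M → IsModelled s v vstar c M f →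
        ∃! Λ : BesovElt d, IsReconstruction Q ℓ α₀ (fun x => w x * v x) c M f Λ) ∧
    (∃ C : ℝ, 0 < C ∧ ∀ (M : ModelData d T) (f : Sp d → ⨁ a, T a) (Λ : BesovElt d),
      IsModel s ℓ G Q 𝒯 w wstar M → IsModelled s v vstar c M f →
      IsReconstruction Q ℓ α₀ (fun x => w x * v x) c M f Λ →
        besovNorm ℓ α₀ c.i (fun x => w x * v x) Λ.eval ≤
            ENNReal.ofReal C * (M.piNorm ℓ w c * mdNorm s v vstar c M f) ∧
        recSup ℓ (fun x => w x * v x) c (recDefect M f Λ) ≤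
            ENNReal.ofReal C * (M.piNorm ℓ w c * mdSemi s v vstar c M f)) ∧
    (∃ K₀ K₁ : ℝ, ∀ R : ℝ, 0 < R → 0 < K₀ + K₁ * R ∧
      ∀ (M₁ M₂ : ModelData d T) (f₁ f₂ : Sp d → ⨁ a, T a) (Λ₁ Λ₂ : BesovElt d),
      IsModel s ℓ G Q 𝒯 w wstar M₁ → IsModel s ℓ G Q 𝒯 w wstar M₂ →
      IsModelled s v vstar c M₁ f₁ → IsModelled s v vstar c M₂ f₂ →
      M₁.norm s ℓ w wstar c ≤ ENNReal.ofReal R → M₂.norm s ℓ w wstar c ≤ ENNReal.ofReal R →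
      mdNorm s v vstar c M₁ f₁ ≤ ENNReal.ofReal R → mdNorm s v vstar c M₂ f₂ ≤ ENNReal.ofReal R →
      IsReconstruction Q ℓ α₀ (fun x => w x * v x) c M₁ f₁ Λ₁ →
      IsReconstruction Q ℓ α₀ (fun x => w x * v x) c M₂ f₂ Λ₂ →
        besovNorm ℓ α₀ c.i (fun x => w x * v x) (fun t x => Λ₁.eval t x - Λ₂.eval t x) ≤
            ENNReal.ofReal (K₀ + K₁ * R) *
              ((M₁.sub M₂).piNorm ℓ w c + mdDist s v vstar c M₁ M₂ f₁ f₂) ∧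
        recSup ℓ (fun x => w x * v x) c
            (fun t x => recDefect M₁ f₁ Λ₁ t x - recDefect M₂ f₂ Λ₂ t x) ≤
            ENNReal.ofReal (K₀ + K₁ * R) *
              ((M₁.sub M₂).piNorm ℓ w c + mdSemiDist s v vstar c M₁ M₂ f₁ f₂)) := by
  -- models only carry data for `h ≠ 0`, and the origin is a null set because `d ≥ 1`
  have h0 : ∀ᵐ h : Sp d, h ≠ 0 := by
    have : Nonempty (Fin d) := ⟨⟨0, hd⟩⟩
    exact Measure.ae_ne volume 0
  obtain ⟨C, hC, hbd⟩ := exists_orbit_bounds hs hℓ hG_nonneg hQ 𝒯 hα₀ hreg hw hv hwv h0 c hc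
  refine ⟨fun M f hM hf => existsUnique_of_exists_of_unique
    (exists_isReconstruction hs hℓ hG_nonneg hQ 𝒯 hα₀ hreg hw hv hwv h0 hc hM hf)
    fun Λ₁ Λ₂ h₁ h₂ => h₁.unique hs hℓ hG_nonneg hQ hw hv hwv hc hM hf h₂, ?_, ?_⟩
  -- a single modelled distribution is compared with zero; the factor `2` stems from the two terms of
  -- the Besov norm
  · refine ⟨2 * C, by positivity, fun M f Λ hM hf hΛ => ?_⟩
    have hz := isModelled_zero (s := s) (v := v) (vstar := vstar) (c := c) M
    have hb := hbd M M f (fun _ => 0) hM hM hf hz (extendTm Λ.eval) _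
      (hΛ.1.isOrbit hs hG_nonneg hQ hwv c.one_le) hΛ.2.ne fun t => by
        simp only [extendTm_coe, germSub_zero]
        exact wLp_recDefect_le _ M f Λ t
    simp only [extendTm_coe, germSub_zero, pairSemi_zero, pairSize_zero, ← mul_add] at hb
    constructor
    · refine (besovNorm_le fun t => (hb t).2).trans (le_of_eq ?_)
      rw [mdNorm, add_comm (mdSize v c f), ENNReal.ofReal_mul zero_le_two, ENNReal.ofReal_ofNat,
        mul_assoc]
    · refine (recSup_le fun t => (hb t).1).trans ?_
      gcongr
      linarith
  · refine ⟨0, 2 * C, fun R hR => ⟨by positivity,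
      fun M₁ M₂ f₁ f₂ Λ₁ Λ₂ hM₁ hM₂ hf₁ hf₂ _ hR₂ hRf _ h₁ h₂ => ?_⟩⟩
    have hΔ := (h₁.1.isOrbit hs hG_nonneg hQ hwv c.one_le).sub hs hG_nonneg hQ hwv c.one_le
      (h₂.1.isOrbit hs hG_nonneg hQ hwv c.one_le)
    have hsub : ∀ (t : Tm) (x : Sp d), Λ₁.eval t x - Λ₂.eval t x - germSub M₁ M₂ f₁ f₂ t x =
        recDefect M₁ f₁ Λ₁ t x - recDefect M₂ f₂ Λ₂ t x := fun t x => by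
      simp only [germSub, recDefect]
      ring
    have hb := hbd M₁ M₂ f₁ f₂ hM₁ hM₂ hf₁ hf₂ _ _ hΔ (ENNReal.add_lt_top.2 ⟨h₁.2, h₂.2⟩).ne
      fun t => by
        simp only [extendTm_coe, hsub]
        exact wLp_recDefect_sub_le hw hv hM₁ hM₂ hf₁ hf₂ t
    simp only [extendTm_coe, hsub] at hb
    have hπ : M₂.piNorm ℓ w c ≤ ENNReal.ofReal R := le_self_add.trans hR₂
    have hsemi : pairSemi s ℓ w v vstar c M₁ M₂ f₁ f₂ ≤ ENNReal.ofReal R *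
        ((M₁.sub M₂).piNorm ℓ w c + mdSemiDist s v vstar c M₁ M₂ f₁ f₂) := by
      rw [pairSemi, mul_add, mul_comm _ (mdSemi s v vstar c M₁ f₁)]
      gcongr
      exact le_add_self.trans hRf
    have hsum : pairSemi s ℓ w v vstar c M₁ M₂ f₁ f₂ + pairSize ℓ w v c M₁ M₂ f₁ f₂ ≤
        ENNReal.ofReal R * ((M₁.sub M₂).piNorm ℓ w c + mdDist s v vstar c M₁ M₂ f₁ f₂) := by
      calc _ = (M₁.sub M₂).piNorm ℓ w c * mdNorm s v vstar c M₁ f₁ +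
            M₂.piNorm ℓ w c * mdDist s v vstar c M₁ M₂ f₁ f₂ := by
            rw [pairSemi, pairSize, mdNorm, mdDist]
            ring
        _ ≤ _ := by
            rw [mul_add, mul_comm _ (mdNorm s v vstar c M₁ f₁)]
            gcongr
    have hCR : ENNReal.ofReal (0 + 2 * C * R) = 2 * (ENNReal.ofReal C * ENNReal.ofReal R) := by
      rw [zero_add, mul_assoc, ENNReal.ofReal_mul zero_le_two, ENNReal.ofReal_mul hC.le,
        ENNReal.ofReal_ofNat]
    rw [hCR]
    constructor
    · refine (besovNorm_le fun t => (hb t).2).trans ?_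
      rw [mul_assoc, mul_assoc]
      gcongr
    · refine (recSup_le fun t => (hb t).1).trans ?_
      calc _ ≤ ENNReal.ofReal C * (ENNReal.ofReal R *
            ((M₁.sub M₂).piNorm ℓ w c + mdSemiDist s v vstar c M₁ M₂ f₁ f₂)) := by gcongr
        _ = 1 * (ENNReal.ofReal C * ENNReal.ofReal R) *
            ((M₁.sub M₂).piNorm ℓ w c + mdSemiDist s v vstar c M₁ M₂ f₁ f₂) := by ring
        _ ≤ _ := by
            gcongr
            exact one_le_two
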